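/- Let $\mathcal X,\mathcal Y,\mathcal Z$ be finite source alphabets, $\hat{\mathcal X},\hat{\mathcal Z}$ finite reconstruction alphabets, $d_x:\mathcal X\times\hat{\mathcal X}\to[0,\infty)$ and $d_z:\mathcal Z\times\hat{\mathcal Z}\to[0,\infty)$ distortion measures, and let $(X_i,Y_i,Z_i)$, $i\ge 1$, be i.i.d. with a joint distribution $p(x,y,z)$ for which $Y-X-Z$ is a Markov chain, i.e. $p(x,y,z)=p(x,y)p(z|x)$. Let $D_x,D_z\in\mathbb R$. Logarithms are to base $2$. A code of block length $n$ with $M_1,M_2,M_3$ messages, where $\mathcal M_i=\{1,\dots,M_i\}$, consists of encoders $$f_1:\mathcal Y^n\to\mathcal M_1,\qquad f_2:\mathcal Z^n\times\mathcal M_1\to\mathcal M_2,\qquad f_3:\mathcal X^n\times\mathcal M_1\times\mathcal M_2\to\mathcal M_3$$ and decoders $$g_2:\mathcal X^n\times\mathcal M_1\times\mathcal M_2\to\hat{\mathcal Z}^n,\qquad g_3:\mathcal Z^n\times\mathcal M_1\times\mathcal M_3\to\hat{\mathcal X}^n.$$ With $T_1=f_1(Y^n)$ (the helper's common message), $T_2=f_2(Z^n,T_1)$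 (the message of User Z) and $T_3=f_3(X^n,T_1,T_2)$ (the message of User X), the reconstructions are $\hat Z^n=g_2(X^n,T_1,T_2)$ at User X and $\hat X^n=g_3(Z^n,T_1,T_3)$ at User Z. A rate triple $(R_1,R_2,R_3)\in\mathbb R^3$ is achievable if for every $\epsilon>0$ and all sufficiently large $n$ there is such a code with $M_i=\lfloor 2^{nR_i}\rfloor$, $i=1,2,3$, and $$\mathbb E\Big[\frac1n\sum_{i=1}^n d_x(X_i,\hat X_i)\Big]\le D_x+\epsilon,\qquad \mathbb E\Big[\frac1n\sum_{i=1}^n d_z(Z_i,\hat Z_i)\Big]\le D_z+\epsilon .$$ The operational region $\mathcal R^O(D_x,D_z)$ is the closure in $\mathbb R^3$ of the set of achievable rate triples. Let $\mathcal R(D_x,D_z)$ be the set of all $(R_1,R_2,R_3)\in\mathbb R^3$ such that $$R_1\ge I(Y;U|Z),\qquad R_2\ge I(Z;V|U,X),\qquad R_3\ge I(X;W|U,V,Z)$$ for some auxiliary random variables $U,V,W$ with finite alphabets $\mathcal U,\mathcal V,\mathcal W$ and joint distribution $$p(x,y,z,u,v,w)=p(x,y)\,p(z|x)\,p(u|y)\,p(v|u,z)\,p(w|u,v,x)$$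 and some functions $\hat X=\hat X(U,W,Z)\in\hat{\mathcal X}$ and $\hat Z=\hat Z(U,V,X)\in\hat{\mathcal Z}$ with $$\mathbb E\,d_x(X,\hat X(U,W,Z))\le D_x,\qquad \mathbb E\,d_z(Z,\hat Z(U,V,X))\le D_z .$$ Then $\mathcal R^O(D_x,D_z)=\mathcal R(D_x,D_z)$. The equality also holds if in the definition of $\mathcal R(D_x,D_z)$ the auxiliary alphabets are required to have the bounded cardinalities $|\mathcal U|\le|\mathcal Y|+4$, $|\mathcal V|\le|\mathcal Z||\mathcal U|+3$, $|\mathcal W|\le|\mathcal U||\mathcal V||\mathcal X|+1$. -/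

import Mathlib

namespace TwoWay

noncomputable section

/-! ### Shannon quantities of random variables on a finite probability space (in bits) -/

section Information

variable {Ω α β γ : Type*} [Fintype Ω]

open Classical in
/-- The law of `A : Ω → α` under the mass function `q`: `law q A a = P(A = a)`. -/
def law (q : Ω → ℝ) (A : Ω → α) (a : α) : ℝ :=
  ∑ ω, if A ω = a then q ω else 0

/-- The conditional entropy `H(A|C) = -∑ P(a,c) log₂ P(a|c)`
(the summands with `P(a,c) = 0` vanish). -/
def condEntropy [Fintype α] [Fintype γ] (q : Ω → ℝ) (A : Ω → α) (C : Ω → γ) : ℝ :=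
  -∑ a, ∑ c, law q (fun ω => (A ω, C ω)) (a, c) *
    Real.logb 2 (law q (fun ω => (A ω, C ω)) (a, c) / law q C c)

/-- The conditional mutual information `I(A;B|C) = H(A|C) - H(A|B,C)`. -/
def condMutualInfo [Fintype α] [Fintype β] [Fintype γ]
    (q : Ω → ℝ) (A : Ω → α) (B : Ω → β) (C : Ω → γ) : ℝ :=
  condEntropy q A C - condEntropy q A (fun ω => (B ω, C ω))

end Information

/-! ### The source -/

/-- The Markov chain `Y - X - Z` under the joint mass function `p` of `(X, Y, Z)`:
`p(x,y,z) p(x) = p(x,y) p(x,z)`. -/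
def IsMarkovYXZ {X Y Z : Type*} [Fintype X] [Fintype Y] [Fintype Z]
    (p : X × Y × Z → ℝ) : Prop :=
  ∀ x y z, p (x, y, z) * (∑ y', ∑ z', p (x, y', z')) =
    (∑ z', p (x, y, z')) * (∑ y', p (x, y', z))

/-! ### The operational region -/

/-- The encoders `f₁, f₂, f₃` and decoders `g₂, g₃` of a code of block length `n` with message
sets of sizes `M₁, M₂, M₃`. -/
structure Code (X Y Z Xh Zh : Type*) (n M₁ M₂ M₃ : ℕ) where
  /-- the helper's message -/
  f₁ : (Fin n → Y) → Fin M₁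
  /-- the message of User Z -/
  f₂ : (Fin n → Z) → Fin M₁ → Fin M₂
  /-- the message of User X -/
  f₃ : (Fin n → X) → Fin M₁ → Fin M₂ → Fin M₃
  /-- the reconstruction of the `Z`-sequence at User X -/
  g₂ : (Fin n → X) → Fin M₁ → Fin M₂ → (Fin n → Zh)
  /-- the reconstruction of the `X`-sequence at User Z -/
  g₃ : (Fin n → Z) → Fin M₁ → Fin M₃ → (Fin n → Xh)

namespace Code

variable {X Y Z Xh Zh : Type*} {n M₁ M₂ M₃ : ℕ}

/-- The message `T₁` sent on the source block `s`. -/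
def T₁ (c : Code X Y Z Xh Zh n M₁ M₂ M₃) (s : Fin n → X × Y × Z) : Fin M₁ :=
  c.f₁ (fun i => (s i).2.1)

/-- The message `T₂` sent on the source block `s`. -/
def T₂ (c : Code X Y Z Xh Zh n M₁ M₂ M₃) (s : Fin n → X × Y × Z) : Fin M₂ :=
  c.f₂ (fun i => (s i).2.2) (c.T₁ s)

/-- The message `T₃` sent on the source block `s`. -/
def T₃ (c : Code X Y Z Xh Zh n M₁ M₂ M₃) (s : Fin n → X × Y × Z) : Fin M₃ :=
  c.f₃ (fun i => (s i).1) (c.T₁ s) (c.T₂ s)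

/-- The reconstruction `X̂ⁿ` of User Z. -/
def recX (c : Code X Y Z Xh Zh n M₁ M₂ M₃) (s : Fin n → X × Y × Z) : Fin n → Xh :=
  c.g₃ (fun i => (s i).2.2) (c.T₁ s) (c.T₃ s)

/-- The reconstruction `Ẑⁿ` of User X. -/
def recZ (c : Code X Y Z Xh Zh n M₁ M₂ M₃) (s : Fin n → X × Y × Z) : Fin n → Zh :=
  c.g₂ (fun i => (s i).1) (c.T₁ s) (c.T₂ s)

variable [Fintype X] [Fintype Y] [Fintype Z]

/-- `E[(1/n) ∑ᵢ d_x(Xᵢ, X̂ᵢ)]` for a block of i.i.d. triples with mass function `p`. -/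
def distX (c : Code X Y Z Xh Zh n M₁ M₂ M₃) (p : X × Y × Z → ℝ) (dx : X → Xh → ℝ) : ℝ :=
  ∑ s : Fin n → X × Y × Z, (∏ i, p (s i)) * ((1 / (n : ℝ)) * ∑ i, dx (s i).1 (c.recX s i))

/-- `E[(1/n) ∑ᵢ d_z(Zᵢ, Ẑᵢ)]` for a block of i.i.d. triples with mass function `p`. -/
def distZ (c : Code X Y Z Xh Zh n M₁ M₂ M₃) (p : X × Y × Z → ℝ) (dz : Z → Zh → ℝ) : ℝ :=
  ∑ s : Fin n → X × Y × Z, (∏ i, p (s i)) * ((1 / (n : ℝ)) * ∑ i, dz (s i).2.2 (c.recZ s i))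

end Code

section Regions

variable {X Y Z Xh Zh : Type*} [Fintype X] [Fintype Y] [Fintype Z]

/-- The rate triple `(R₁, R₂, R₃)` is achievable with distortions `(Dx, Dz)`: for every `ε > 0`
and all large `n` there is a code with `⌊2^(n Rᵢ)⌋` messages in the `i`-th message set and
expected distortions at most `Dx + ε` and `Dz + ε`. -/
def Achievable (p : X × Y × Z → ℝ) (dx : X → Xh → ℝ) (dz : Z → Zh → ℝ) (Dx Dz : ℝ)
    (R : ℝ × ℝ × ℝ) : Prop :=
  ∀ ε : ℝ, 0 < ε → ∃ N : ℕ, ∀ n : ℕ, N ≤ n →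
    ∃ c : Code X Y Z Xh Zh n ⌊(2 : ℝ) ^ ((n : ℝ) * R.1)⌋₊ ⌊(2 : ℝ) ^ ((n : ℝ) * R.2.1)⌋₊
        ⌊(2 : ℝ) ^ ((n : ℝ) * R.2.2)⌋₊,
      c.distX p dx ≤ Dx + ε ∧ c.distZ p dz ≤ Dz + ε

/-- The operational region: the closure of the set of achievable rate triples. -/
def operationalRegion (p : X × Y × Z → ℝ) (dx : X → Xh → ℝ) (dz : Z → Zh → ℝ) (Dx Dz : ℝ) :
    Set (ℝ × ℝ × ℝ) :=
  closure {R | Achievable p dx dz Dx Dz R}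

/-! ### The single-letter region -/

/-- Auxiliary variables `U, V, W` with values in alphabets of `kU, kV, kW` letters, given by
their conditional laws `p(u|y)`, `p(v|u,z)`, `p(w|u,v,x)`. -/
structure Aux (X Y Z : Type*) (kU kV kW : ℕ) where
  /-- `pU y u = p(u|y)` -/
  pU : Y → Fin kU → ℝ
  /-- `pV u z v = p(v|u,z)` -/
  pV : Fin kU → Z → Fin kV → ℝ
  /-- `pW u v x w = p(w|u,v,x)` -/
  pW : Fin kU → Fin kV → X → Fin kW → ℝ
  pU_mem : ∀ y, pU y ∈ stdSimplex ℝ (Fin kU)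
  pV_mem : ∀ u z, pV u z ∈ stdSimplex ℝ (Fin kV)
  pW_mem : ∀ u v x, pW u v x ∈ stdSimplex ℝ (Fin kW)

/-- Values of `(X, Y, Z, U, V, W)`. -/
abbrev Outcome (X Y Z : Type*) (kU kV kW : ℕ) : Type _ :=
  X × Y × Z × Fin kU × Fin kV × Fin kW

namespace Outcome

variable {X Y Z : Type*} {kU kV kW : ℕ}

/-- the variable `X` -/
def x (o : Outcome X Y Z kU kV kW) : X := o.1
/-- the variable `Y` -/
def y (o : Outcome X Y Z kU kV kW) : Y := o.2.1
/-- the variable `Z` -/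
def z (o : Outcome X Y Z kU kV kW) : Z := o.2.2.1
/-- the variable `U` -/
def u (o : Outcome X Y Z kU kV kW) : Fin kU := o.2.2.2.1
/-- the variable `V` -/
def v (o : Outcome X Y Z kU kV kW) : Fin kV := o.2.2.2.2.1
/-- the variable `W` -/
def w (o : Outcome X Y Z kU kV kW) : Fin kW := o.2.2.2.2.2

end Outcome

/-- The joint mass function `p(x,y,z) p(u|y) p(v|u,z) p(w|u,v,x)`; for a source with
`Y - X - Z` one has `p(x,y,z) = p(x,y) p(z|x)`. -/
def Aux.joint {kU kV kW : ℕ} (a : Aux X Y Z kU kV kW) (p : X × Y × Z → ℝ)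
    (o : Outcome X Y Z kU kV kW) : ℝ :=
  p (o.x, o.y, o.z) * a.pU o.y o.u * a.pV o.u o.z o.v * a.pW o.u o.v o.x o.w

/-- The rate triple `R` satisfies the three rate constraints and the two distortion constraints
for some auxiliary variables with alphabets of `kU, kV, kW` letters and some deterministic
reconstructions `X̂(U,W,Z)` and `Ẑ(U,V,X)`. -/
def SingleLetter (p : X × Y × Z → ℝ) (dx : X → Xh → ℝ) (dz : Z → Zh → ℝ) (Dx Dz : ℝ)
    (kU kV kW : ℕ) (R : ℝ × ℝ × ℝ) : Prop :=
  ∃ (a : Aux X Y Z kU kV kW)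
    (xhat : Fin kU → Fin kW → Z → Xh) (zhat : Fin kU → Fin kV → X → Zh),
    condMutualInfo (a.joint p) Outcome.y Outcome.u Outcome.z ≤ R.1 ∧
    condMutualInfo (a.joint p) Outcome.z Outcome.v (fun o => (o.u, o.x)) ≤ R.2.1 ∧
    condMutualInfo (a.joint p) Outcome.x Outcome.w (fun o => (o.u, o.v, o.z)) ≤ R.2.2 ∧
    ∑ o, a.joint p o * dx o.x (xhat o.u o.w o.z) ≤ Dx ∧
    ∑ o, a.joint p o * dz o.z (zhat o.u o.v o.x) ≤ Dz

/-- The single-letter region, with auxiliary variables in arbitrary finite alphabets. -/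
def region (p : X × Y × Z → ℝ) (dx : X → Xh → ℝ) (dz : Z → Zh → ℝ) (Dx Dz : ℝ) :
    Set (ℝ × ℝ × ℝ) :=
  {R | ∃ kU kV kW : ℕ, SingleLetter p dx dz Dx Dz kU kV kW R}

/-- The single-letter region, with auxiliary variables in alphabets of bounded cardinality:
`|U| ≤ |Y| + 4`, `|V| ≤ |Z||U| + 3`, `|W| ≤ |U||V||X| + 1`. -/
def boundedRegion (p : X × Y × Z → ℝ) (dx : X → Xh → ℝ) (dz : Z → Zh → ℝ) (Dx Dz : ℝ) :
    Set (ℝ × ℝ × ℝ) :=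
  {R | ∃ kU kV kW : ℕ, kU ≤ Fintype.card Y + 4 ∧ kV ≤ Fintype.card Z * kU + 3 ∧
    kW ≤ kU * kV * Fintype.card X + 1 ∧ SingleLetter p dx dz Dx Dz kU kV kW R}

end Regions

end

end TwoWay

/-! Converse. Given a code, draw a time index I uniformly and independently of the source block, and
put U = (I, T₁, the X-letters before I, the Z-letters after I), V = T₂, W = (T₂, T₃). Each Markov
condition follows from an exchange argument: take two independent copies that agree on the
conditioning variable and exchange some letters between them; the product of their probabilities
does not change (`condIndep_of_swap`). For exchanges of Z-letters alone this is where Y - X - Z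
enters. For the rates, conditional independence allows more conditioning to be added until the
mutual information becomes an increment of H(T | D_k) in k; averaging over I telescopes these
increments to at most log M / n (`abs_ent_telescope_le`). What a decoder sees at other times carries
no further information about the current letter, so it can be dropped
(`CondIndep.exists_estimator`).

A code meets the distortions only up to ε, so the converse needs a closed region. The auxiliary
alphabets are cut down by passing to a basic feasible solution of a linear system
(`exists_sparse_weights`). With bounded alphabets the kernels range over a compact set, and ε can
tend to 0.

Achievability uses neither typical sets nor binning. All parties share exponential clocks indexed by
pairs (codeword, message). An encoder picks the winner of the race whose speeds are its conditional
law spread evenly over the messages; a decoder, told the message, runs the same clocks with its own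
conditional law. All winners coincide with a probability bounded from below by
`exists_measurableSet_wins`. Fixing good clocks gives a deterministic code (`exists_clocks`). The
loss is governed by the event that a log-likelihood ratio exceeds nR, which is rare by a Chernoff
bound as soon as the rate exceeds the mutual information (`tendsto_sum_blockLaw_min`). Both users
must recover the same U from the one helper message; rate I(Y;U|Z) serves both, because I(Y;U|X) ≤
I(Y;U|Z) (`Aux.condMutualInfo_x_le_z`). -/

namespace TwoWay

noncomputable section

/-! ### Laws of random variables on a finite space. -/

section Law

variable {Ω α β γ δ : Type*} [Fintype Ω] {q : Ω → ℝ}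

lemma law_nonneg (hq : ∀ ω, 0 ≤ q ω) (A : Ω → α) (a : α) : 0 ≤ law q A a := by
  unfold law
  refine Finset.sum_nonneg fun ω _ => ?_
  split_ifs
  · exact hq ω
  · exact le_rfl

lemma law_pos (hq : ∀ ω, 0 ≤ q ω) (A : Ω → α) {ω : Ω} (h : 0 < q ω) :
    0 < law q A (A ω) := by
  classical
  unfold law
  refine Finset.sum_pos' (fun ω _ => ?_) ⟨ω, Finset.mem_univ _, ?_⟩
  · split_ifs
    · exact hq ω
    · exact le_rfl
  · simpa using h

lemma sum_mul_comp [Fintype α] (q : Ω → ℝ) (A : Ω → α) (F : α → ℝ) :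
    ∑ ω, q ω * F (A ω) = ∑ a, law q A a * F a := by
  classical
  unfold law
  simp_rw [Finset.sum_mul]
  rw [Finset.sum_comm]
  refine Finset.sum_congr rfl fun ω _ => ?_
  simp [ite_mul]

lemma sum_law [Fintype α] (q : Ω → ℝ) (A : Ω → α) : ∑ a, law q A a = ∑ ω, q ω := by
  simpa using (sum_mul_comp q A (fun _ => 1)).symm

lemma law_fst [Fintype β] (q : Ω → ℝ) (A : Ω → α) (B : Ω → β) (a : α) :
    ∑ b, law q (fun ω => (A ω, B ω)) (a, b) = law q A a := by
  classical
  unfold law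
  rw [Finset.sum_comm]
  refine Finset.sum_congr rfl fun ω _ => ?_
  by_cases h : A ω = a <;> simp [h]

lemma law_snd [Fintype α] (q : Ω → ℝ) (A : Ω → α) (B : Ω → β) (b : β) :
    ∑ a, law q (fun ω => (A ω, B ω)) (a, b) = law q B b := by
  classical
  unfold law
  rw [Finset.sum_comm]
  refine Finset.sum_congr rfl fun ω _ => ?_
  by_cases h : B ω = b <;> simp [h]

lemma law_congr_partition {q : Ω → ℝ} {A : Ω → α} {B : Ω → β} {ω : Ω}
    (h : ∀ ω', A ω' = A ω ↔ B ω' = B ω) : law q A (A ω) = law q B (B ω) := by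
  unfold law
  exact Finset.sum_congr rfl fun ω' _ => by
    classical exact if_congr (h ω') rfl rfl

lemma law_le_of_imp (hq : ∀ ω, 0 ≤ q ω) {A : Ω → α} {B : Ω → β} {a : α} {b : β}
    (h : ∀ ω, A ω = a → B ω = b) : law q A a ≤ law q B b := by
  unfold law
  refine Finset.sum_le_sum fun ω _ => ?_
  by_cases h1 : A ω = a
  · simp [h1, h ω h1]
  · rw [if_neg h1]
    split_ifs
    · exact hq ω
    · exact le_rfl

lemma law_eq_of_iff {A : Ω → α} {B : Ω → β} {a : α} {b : β}
    (h : ∀ ω, A ω = a ↔ B ω = b) : law q A a = law q B b := by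
  unfold law
  exact Finset.sum_congr rfl fun ω _ => by
    classical exact if_congr (h ω) rfl rfl

end Law

/-! ### Entropy -/

section Entropy

variable {Ω α β γ δ τ : Type*} [Fintype Ω] {q : Ω → ℝ}

/-- The entropy of `A`, as an expectation of `-log₂ P(A)`. -/
def ent (q : Ω → ℝ) (A : Ω → α) : ℝ := -∑ ω, q ω * Real.logb 2 (law q A (A ω))

/-- Entropy sees only the partition of `Ω` into level sets, so tuples may be reordered, regrouped,
or enlarged by functions of themselves. -/
lemma ent_congr {A : Ω → α} {B : Ω → β} (h : ∀ ω ω', A ω' = A ω ↔ B ω' = B ω) :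
    ent q A = ent q B := by
  unfold ent
  congr 1
  exact Finset.sum_congr rfl fun ω _ => by rw [law_congr_partition (h ω)]

/-- Jensen's inequality in the form log t ≤ t - 1. It is the only analytic input of the entropy
inequalities below. -/
lemma sum_logb_le (hq : ∀ ω, 0 ≤ q ω) {F : Ω → ℝ} (hF : ∀ ω, 0 < q ω → 0 < F ω)
    (h : ∑ ω, q ω * F ω ≤ ∑ ω, q ω) : ∑ ω, q ω * Real.logb 2 (F ω) ≤ 0 := by
  have h2 : (0 : ℝ) < Real.log 2 := Real.log_pos one_lt_two
  have key : ∀ ω ∈ Finset.univ, q ω * Real.logb 2 (F ω) ≤ (q ω * F ω - q ω) / Real.log 2 := by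
    intro ω _
    rcases (hq ω).eq_or_lt with h0 | h0
    · simp [← h0]
    · rw [Real.logb, ← mul_div_assoc]
      gcongr
      have := Real.log_le_sub_one_of_pos (hF ω h0)
      nlinarith
  refine (Finset.sum_le_sum key).trans ?_
  rw [← Finset.sum_div, Finset.sum_sub_distrib]
  exact div_nonpos_of_nonpos_of_nonneg (by linarith) h2.le

lemma condEntropy_eq_sum [Fintype α] [Fintype γ] (q : Ω → ℝ) (A : Ω → α) (C : Ω → γ) :
    condEntropy q A C = -∑ ω, q ω * Real.logb 2
      (law q (fun ω => (A ω, C ω)) (A ω, C ω) / law q C (C ω)) := by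
  unfold condEntropy
  rw [sum_mul_comp q (fun ω => (A ω, C ω)) (fun x => Real.logb 2
      (law q (fun ω => (A ω, C ω)) x / law q C x.2)), Fintype.sum_prod_type]

lemma condEntropy_eq_ent [Fintype α] [Fintype γ] (hq : ∀ ω, 0 ≤ q ω) (A : Ω → α) (C : Ω → γ) :
    condEntropy q A C = ent q (fun ω => (A ω, C ω)) - ent q C := by
  rw [condEntropy_eq_sum]
  unfold ent
  rw [neg_sub_neg, ← neg_sub, ← Finset.sum_sub_distrib]
  congr 1
  refine Finset.sum_congr rfl fun ω _ => ?_
  rcases (hq ω).eq_or_lt with h0 | h0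
  · simp [← h0]
  · rw [Real.logb_div (law_pos hq (fun ω => (A ω, C ω)) h0).ne' (law_pos hq C h0).ne']
    ring

lemma condMutualInfo_eq_ent [Fintype α] [Fintype β] [Fintype γ] (hq : ∀ ω, 0 ≤ q ω)
    (A : Ω → α) (B : Ω → β) (C : Ω → γ) :
    condMutualInfo q A B C = ent q (fun ω => (A ω, C ω)) - ent q C
      - ent q (fun ω => (A ω, B ω, C ω)) + ent q (fun ω => (B ω, C ω)) := by
  unfold condMutualInfo
  rw [condEntropy_eq_ent hq, condEntropy_eq_ent hq]
  ring

/-- Submodularity of entropy. -/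
lemma ent_submodular [Fintype α] [Fintype β] [Fintype γ] (hq : ∀ ω, 0 ≤ q ω)
    (A : Ω → α) (B : Ω → β) (C : Ω → γ) :
    ent q (fun ω => (A ω, B ω, C ω)) + ent q C ≤
      ent q (fun ω => (A ω, C ω)) + ent q (fun ω => (B ω, C ω)) := by
  have h := sum_logb_le (q := q) hq
    (F := fun ω => law q (fun ω => (A ω, C ω)) (A ω, C ω) * law q (fun ω => (B ω, C ω)) (B ω, C ω) /
      (law q (fun ω => (A ω, B ω, C ω)) (A ω, B ω, C ω) * law q C (C ω))) ?_ ?_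
  · unfold ent
    rw [← sub_nonpos]
    refine le_trans (le_of_eq ?_) h
    rw [← neg_add, ← neg_add, neg_sub_neg, ← Finset.sum_add_distrib, ← Finset.sum_add_distrib,
      ← Finset.sum_sub_distrib]
    refine Finset.sum_congr rfl fun ω _ => ?_
    rcases (hq ω).eq_or_lt with h0 | h0
    · simp [← h0]
    · have h1 := (law_pos hq (fun ω => (A ω, C ω)) h0).ne'
      have h2 := (law_pos hq (fun ω => (B ω, C ω)) h0).ne'
      have h3 := (law_pos hq (fun ω => (A ω, B ω, C ω)) h0).ne'
      have h4 := (law_pos hq C h0).ne'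
      rw [Real.logb_div (mul_ne_zero h1 h2) (mul_ne_zero h3 h4), Real.logb_mul h1 h2,
        Real.logb_mul h3 h4]
      ring
  · intro ω h0
    have h1 := law_pos hq (fun ω => (A ω, C ω)) h0
    have h2 := law_pos hq (fun ω => (B ω, C ω)) h0
    have h3 := law_pos hq (fun ω => (A ω, B ω, C ω)) h0
    have h4 := law_pos hq C h0
    positivity
  · rw [sum_mul_comp q (fun ω => (A ω, B ω, C ω)) (fun x =>
      law q (fun ω => (A ω, C ω)) (x.1, x.2.2) * law q (fun ω => (B ω, C ω)) x.2 /
      (law q (fun ω => (A ω, B ω, C ω)) x * law q C x.2.2)), ← sum_law q C]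
    -- Only an inequality: triples of probability zero contribute nothing on the left but may
    -- contribute on the right.
    have : ∀ x : α × β × γ, law q (fun ω => (A ω, B ω, C ω)) x *
        (law q (fun ω => (A ω, C ω)) (x.1, x.2.2) * law q (fun ω => (B ω, C ω)) x.2 /
          (law q (fun ω => (A ω, B ω, C ω)) x * law q C x.2.2)) ≤
        law q (fun ω => (A ω, C ω)) (x.1, x.2.2) * law q (fun ω => (B ω, C ω)) x.2 /
          law q C x.2.2 := by
      intro x
      have h1 := law_nonneg hq (fun ω => (A ω, C ω)) (x.1, x.2.2)
      have h2 := law_nonneg hq (fun ω => (B ω, C ω)) x.2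
      have h4 := law_nonneg hq C x.2.2
      rcases (law_nonneg hq (fun ω => (A ω, B ω, C ω)) x).eq_or_lt with h0 | h0
      · rw [← h0]
        simp only [zero_mul]
        positivity
      · rw [mul_div_assoc', mul_div_mul_left _ _ h0.ne']
    refine (Finset.sum_le_sum fun x _ => this x).trans ?_
    rw [Fintype.sum_prod_type]
    simp_rw [Fintype.sum_prod_type]
    calc _ = ∑ c, ∑ a, ∑ b, law q (fun ω => (A ω, C ω)) (a, c) *
          law q (fun ω => (B ω, C ω)) (b, c) / law q C c := by
          rw [Finset.sum_comm (s := (Finset.univ : Finset γ))]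
          exact Finset.sum_congr rfl fun a _ => Finset.sum_comm
      _ ≤ _ := by
          refine Finset.sum_le_sum fun c _ => ?_
          simp_rw [← Finset.sum_div, ← Finset.mul_sum, ← Finset.sum_mul, law_snd]
          exact (mul_self_div_self _).le

lemma ent_le_ent_pair (hq : ∀ ω, 0 ≤ q ω) (T : Ω → τ) (D : Ω → δ) :
    ent q D ≤ ent q (fun ω => (T ω, D ω)) := by
  unfold ent
  rw [neg_le_neg_iff]
  refine Finset.sum_le_sum fun ω _ => ?_
  rcases (hq ω).eq_or_lt with h0 | h0
  · simp [← h0]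
  · refine mul_le_mul_of_nonneg_left ?_ (hq ω)
    refine Real.logb_le_logb_of_le one_lt_two (law_pos hq (fun ω => (T ω, D ω)) h0) ?_
    exact law_le_of_imp hq fun ω' h => (Prod.ext_iff.1 h).2

/-- H(T|D) ≤ log |τ|, by comparing the conditional law of `T` with the uniform law. -/
lemma ent_pair_le [Fintype τ] [Fintype δ] (hq : ∀ ω, 0 ≤ q ω) (h1 : ∑ ω, q ω = 1)
    (T : Ω → τ) (D : Ω → δ) :
    ent q (fun ω => (T ω, D ω)) ≤ ent q D + Real.logb 2 (Fintype.card τ) := by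
  rcases isEmpty_or_nonempty τ with hτ | hτ
  · have : IsEmpty Ω := ⟨fun ω => hτ.elim (T ω)⟩
    simp at h1
  have hc : (0 : ℝ) < Fintype.card τ := by exact_mod_cast Fintype.card_pos
  have h := sum_logb_le (q := q) hq
    (F := fun ω => law q D (D ω) / (Fintype.card τ * law q (fun ω => (T ω, D ω)) (T ω, D ω))) ?_ ?_
  · rw [← sub_nonpos]
    refine le_trans (le_of_eq ?_) h
    have : Real.logb 2 (Fintype.card τ) = ∑ ω, q ω * Real.logb 2 (Fintype.card τ) := by
      rw [← Finset.sum_mul, h1, one_mul]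
    rw [this]
    unfold ent
    rw [← sub_sub, neg_sub_neg, ← Finset.sum_sub_distrib, ← Finset.sum_sub_distrib]
    refine Finset.sum_congr rfl fun ω _ => ?_
    rcases (hq ω).eq_or_lt with h0 | h0
    · simp [← h0]
    · have h3 := (law_pos hq (fun ω => (T ω, D ω)) h0).ne'
      rw [Real.logb_div (law_pos hq D h0).ne' (mul_ne_zero hc.ne' h3), Real.logb_mul hc.ne' h3]
      ring
  · intro ω h0
    have := law_pos hq (fun ω => (T ω, D ω)) h0
    have := law_pos hq D h0
    positivity
  · rw [sum_mul_comp q (fun ω => (T ω, D ω)) (fun x =>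
      law q D x.2 / (Fintype.card τ * law q (fun ω => (T ω, D ω)) x)), ← sum_law q D]
    have : ∀ x : τ × δ, law q (fun ω => (T ω, D ω)) x *
        (law q D x.2 / (Fintype.card τ * law q (fun ω => (T ω, D ω)) x)) ≤
        law q D x.2 / Fintype.card τ := by
      intro x
      have h4 := law_nonneg hq D x.2
      rcases (law_nonneg hq (fun ω => (T ω, D ω)) x).eq_or_lt with h0 | h0
      · rw [← h0]
        simp only [zero_mul]
        positivity
      · rw [mul_comm (Fintype.card τ : ℝ), mul_div_assoc', mul_div_mul_left _ _ h0.ne']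
    refine (Finset.sum_le_sum fun x _ => this x).trans (le_of_eq ?_)
    rw [Fintype.sum_prod_type]
    simp only [← Finset.sum_div, Finset.sum_const, Finset.card_univ, nsmul_eq_mul]
    field_simp

end Entropy

/-! ### Conditional independence -/

section CondIndep

variable {Ω α β γ η : Type*} [Fintype Ω] {q : Ω → ℝ}

/-- `A` and `B` are conditionally independent given `C`. -/
def CondIndep (q : Ω → ℝ) (A : Ω → α) (B : Ω → β) (C : Ω → γ) : Prop :=
  ∀ a b c, law q (fun ω => (A ω, B ω, C ω)) (a, b, c) * law q C c =
    law q (fun ω => (A ω, C ω)) (a, c) * law q (fun ω => (B ω, C ω)) (b, c)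

/-- Conditional independence from an involution on pairs of outcomes that exchanges the values of
`A` while keeping `B`, whenever the values of `C` agree. -/
lemma condIndep_of_swap {A : Ω → α} {B : Ω → β} {C : Ω → γ} (σ : Ω × Ω → Ω × Ω)
    (hσ : Function.Involutive σ)
    (h : ∀ ω ω', C ω = C ω' → q (σ (ω, ω')).1 * q (σ (ω, ω')).2 = q ω * q ω' ∧
      A (σ (ω, ω')).1 = A ω' ∧ B (σ (ω, ω')).1 = B ω ∧
      C (σ (ω, ω')).1 = C ω ∧ C (σ (ω, ω')).2 = C ω) : CondIndep q A B C := by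
  classical
  intro a b c
  unfold law
  rw [Finset.sum_mul_sum, Finset.sum_mul_sum, ← Finset.sum_product', ← Finset.sum_product',
    Finset.univ_product_univ]
  -- As `σ` is an involution, the hypothesis also applies to the image, so agreement of `C` after
  -- the exchange gives agreement before it.
  have hC : ∀ x : Ω × Ω, C (σ x).1 = c ∧ C (σ x).2 = c → C x.1 = c ∧ C x.2 = c := by
    intro x hx
    have := h (σ x).1 (σ x).2 (hx.1.trans hx.2.symm)
    rw [Prod.mk.eta, hσ x] at this
    exact ⟨this.2.2.2.1.trans hx.1, this.2.2.2.2.trans hx.1⟩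
  -- Both products of laws are sums over pairs of outcomes. Reindexing the left one by `σ` and the
  -- right one by the flip makes them agree term by term.
  refine (Function.Bijective.sum_comp hσ.bijective _).symm.trans ?_
  refine Eq.trans ?_ (Equiv.sum_comp (Equiv.prodComm Ω Ω) _)
  refine Finset.sum_congr rfl fun x _ => ?_
  obtain ⟨ω, ω'⟩ := x
  simp only [Equiv.prodComm_apply, Prod.swap, Prod.mk.injEq]
  by_cases hc : C ω = c ∧ C ω' = c
  · obtain ⟨h1, h2, h3, h4, h5⟩ := h ω ω' (hc.1.trans hc.2.symm)
    simp only [h2, h3, h4, h5, hc.1, hc.2]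
    by_cases ha : A ω' = a <;> by_cases hb : B ω = b <;> simp [ha, hb, h1, mul_comm (q ω')]
  · have hc' : ¬ (C (σ (ω, ω')).1 = c ∧ C (σ (ω, ω')).2 = c) := fun hh => hc (hC _ hh)
    have e1 : ∀ (P P' : Prop) [Decidable P] [Decidable P'] (r r' : ℝ), ¬ (P ∧ P') →
        (if P then r else 0) * (if P' then r' else 0) = 0 := by
      intro P P' _ _ r r' hP
      by_cases h1 : P <;> by_cases h2 : P' <;> simp_all
    rw [e1 _ _ _ _ fun hh => hc' ⟨hh.1.2.2, hh.2⟩, e1 _ _ _ _ fun hh => hc ⟨hh.2.2, hh.1.2⟩]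

/-- Taking logarithms in the factorization turns submodularity into an equality. -/
lemma CondIndep.ent_eq (hq : ∀ ω, 0 ≤ q ω) {A : Ω → α} {B : Ω → β} {C : Ω → γ}
    (h : CondIndep q A B C) :
    ent q (fun ω => (A ω, B ω, C ω)) + ent q C =
      ent q (fun ω => (A ω, C ω)) + ent q (fun ω => (B ω, C ω)) := by
  unfold ent
  rw [← neg_add, ← neg_add, ← Finset.sum_add_distrib, ← Finset.sum_add_distrib]
  congr 1
  refine Finset.sum_congr rfl fun ω _ => ?_
  rcases (hq ω).eq_or_lt with h0 | h0
  · simp [← h0]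
  · rw [← mul_add, ← mul_add,
      ← Real.logb_mul (law_pos hq (fun ω => (A ω, B ω, C ω)) h0).ne' (law_pos hq C h0).ne',
      ← Real.logb_mul (law_pos hq (fun ω => (A ω, C ω)) h0).ne'
        (law_pos hq (fun ω => (B ω, C ω)) h0).ne', h]

lemma CondIndep.exists_kernel [Fintype α] [Fintype β] [Nonempty β] (hq : ∀ ω, 0 ≤ q ω)
    {A : Ω → α} {B : Ω → β} {C : Ω → γ} (h : CondIndep q A B C) :
    ∃ κ : γ → β → ℝ, (∀ c, κ c ∈ stdSimplex ℝ β) ∧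
      ∀ a b c, law q (fun ω => (A ω, B ω, C ω)) (a, b, c) =
        law q (fun ω => (A ω, C ω)) (a, c) * κ c b := by
  classical
  -- The kernel is the conditional law of `B` given `C`; where `C` has no mass an arbitrary point
  -- mass keeps it stochastic.
  refine ⟨fun c b => if law q C c = 0 then Pi.single (M := fun _ => ℝ) (Classical.arbitrary β) 1 b
    else law q (fun ω => (B ω, C ω)) (b, c) / law q C c, fun c => ?_, fun a b c => ?_⟩
  · by_cases h0 : law q C c = 0
    · simp only [h0, if_true]
      exact single_mem_stdSimplex ℝ _
    · simp only [h0, if_false]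
      refine ⟨fun b => div_nonneg (law_nonneg hq _ _) (law_nonneg hq _ _), ?_⟩
      rw [← Finset.sum_div, law_snd, div_self h0]
  · by_cases h0 : law q C c = 0
    · have h1 : law q (fun ω => (A ω, C ω)) (a, c) = 0 :=
        le_antisymm ((law_le_of_imp hq fun ω h => (Prod.ext_iff.1 h).2).trans h0.le)
          (law_nonneg hq _ _)
      have h2 : law q (fun ω => (A ω, B ω, C ω)) (a, b, c) = 0 :=
        le_antisymm ((law_le_of_imp hq fun ω h => (Prod.ext_iff.1 (Prod.ext_iff.1 h).2).2).trans
          h0.le) (law_nonneg hq _ _)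
      rw [h1, h2, zero_mul]
    · simp only [h0, if_false]
      rw [mul_div_assoc', ← h a b c, mul_div_cancel_right₀ _ h0]

/-- An estimator of `A` that uses `B` and `C` can be replaced by one that uses only `C`. -/
lemma CondIndep.exists_estimator [Fintype α] [Fintype β] [Fintype γ] [Nonempty β]
    (hq : ∀ ω, 0 ≤ q ω) {A : Ω → α} {B : Ω → β} {C : Ω → γ} (h : CondIndep q A B C)
    (d : α → η → ℝ) (G : β → γ → η) :
    ∃ g : γ → η, ∑ ω, q ω * d (A ω) (g (C ω)) ≤ ∑ ω, q ω * d (A ω) (G (B ω) (C ω)) := by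
  obtain ⟨κ, hκ, hl⟩ := h.exists_kernel hq
  -- Given `C = c`, the cost of the estimator is an average over `b` under `κ c`, so replacing `B`
  -- by the best constant value does no worse.
  have hmin : ∀ c, ∃ b₀, ∀ b, ∑ a, law q (fun ω => (A ω, C ω)) (a, c) * d a (G b₀ c) ≤
      ∑ a, law q (fun ω => (A ω, C ω)) (a, c) * d a (G b c) := fun c =>
    Finite.exists_min fun b => ∑ a, law q (fun ω => (A ω, C ω)) (a, c) * d a (G b c)
  choose b₀ hb₀ using hmin
  refine ⟨fun c => G (b₀ c) c, ?_⟩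
  rw [sum_mul_comp q (fun ω => (A ω, C ω)) (fun x => d x.1 (G (b₀ x.2) x.2)),
    sum_mul_comp q (fun ω => (A ω, B ω, C ω)) (fun x => d x.1 (G x.2.1 x.2.2)),
    Fintype.sum_prod_type_right, Fintype.sum_prod_type_right]
  simp only [Fintype.sum_prod_type_right (α₁ := β), hl]
  refine Finset.sum_le_sum fun c _ => ?_
  calc _ = ∑ b, κ c b * ∑ a, law q (fun ω => (A ω, C ω)) (a, c) * d a (G (b₀ c) c) := by
        rw [← Finset.sum_mul, (hκ c).2, one_mul]
    _ ≤ ∑ b, κ c b * ∑ a, law q (fun ω => (A ω, C ω)) (a, c) * d a (G b c) :=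
        Finset.sum_le_sum fun b _ => mul_le_mul_of_nonneg_left (hb₀ c b) ((hκ c).1 b)
    _ = _ := by
        refine Finset.sum_congr rfl fun b _ => ?_
        rw [Finset.mul_sum]
        exact Finset.sum_congr rfl fun a _ => by ring

end CondIndep

/-! ### Transfer of information quantities between probability spaces. -/

section Transfer

variable {Ω Ω' α β γ : Type*} [Fintype Ω] [Fintype Ω'] {q : Ω → ℝ} {q' : Ω' → ℝ}

lemma law_congr_of_expect {A : Ω → α} {A' : Ω' → α}
    (h : ∀ F : α → ℝ, ∑ ω, q ω * F (A ω) = ∑ ω, q' ω * F (A' ω)) : law q A = law q' A' := by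
  classical
  funext a
  have := h fun b => if b = a then 1 else 0
  simpa [law] using this

/-- Test functions determine the joint law of the three variables. The spaces may differ, and only
this one marginal has to match. -/
lemma condMutualInfo_congr_of_expect [Fintype α] [Fintype β] [Fintype γ]
    {A : Ω → α} {B : Ω → β} {C : Ω → γ} {A' : Ω' → α} {B' : Ω' → β} {C' : Ω' → γ}
    (h : ∀ F : α → β → γ → ℝ, ∑ ω, q ω * F (A ω) (B ω) (C ω) =
      ∑ ω, q' ω * F (A' ω) (B' ω) (C' ω)) :
    condMutualInfo q A B C = condMutualInfo q' A' B' C' := by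
  unfold condMutualInfo condEntropy
  rw [law_congr_of_expect (A := C) (A' := C') fun F => h fun _ _ c => F c,
    law_congr_of_expect (A := fun ω => (A ω, C ω)) (A' := fun ω => (A' ω, C' ω))
      fun F => h fun a _ c => F (a, c),
    law_congr_of_expect (A := fun ω => (B ω, C ω)) (A' := fun ω => (B' ω, C' ω))
      fun F => h fun _ b c => F (b, c),
    law_congr_of_expect (A := fun ω => (A ω, B ω, C ω)) (A' := fun ω => (A' ω, B' ω, C' ω))
      fun F => h fun a b c => F (a, b, c)]

lemma condMutualInfo_congr_partition {α' β' γ' : Type*} [Fintype α] [Fintype β] [Fintype γ]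
    [Fintype α'] [Fintype β'] [Fintype γ'] (hq : ∀ ω, 0 ≤ q ω)
    {A : Ω → α} {B : Ω → β} {C : Ω → γ} {A' : Ω → α'} {B' : Ω → β'} {C' : Ω → γ'}
    (hA : ∀ ω ω', A ω' = A ω ↔ A' ω' = A' ω) (hB : ∀ ω ω', B ω' = B ω ↔ B' ω' = B' ω)
    (hC : ∀ ω ω', C ω' = C ω ↔ C' ω' = C' ω) :
    condMutualInfo q A B C = condMutualInfo q A' B' C' := by
  rw [condMutualInfo_eq_ent hq, condMutualInfo_eq_ent hq, ent_congr hC,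
    ent_congr (A := fun ω => (A ω, C ω)) (B := fun ω => (A' ω, C' ω)) (by simp [hA, hC]),
    ent_congr (A := fun ω => (B ω, C ω)) (B := fun ω => (B' ω, C' ω)) (by simp [hB, hC]),
    ent_congr (A := fun ω => (A ω, B ω, C ω)) (B := fun ω => (A' ω, B' ω, C' ω))
      (by simp [hA, hB, hC])]

end Transfer

/-! ### Marginals of the joint law with auxiliary variables. -/

namespace Aux

variable {X Y Z : Type*} [Fintype X] [Fintype Y] [Fintype Z] {kU kV kW : ℕ}
  (a : Aux X Y Z kU kV kW) (p : X × Y × Z → ℝ)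

lemma joint_nonneg {X Y Z : Type*} (a : Aux X Y Z kU kV kW) {p : X × Y × Z → ℝ}
    (hp : ∀ s, 0 ≤ p s) (o : Outcome X Y Z kU kV kW) : 0 ≤ a.joint p o :=
  mul_nonneg (mul_nonneg (mul_nonneg (hp _) ((a.pU_mem _).1 _)) ((a.pV_mem _ _).1 _))
    ((a.pW_mem _ _ _).1 _)

lemma sum_joint (F : X → Y → Z → Fin kU → Fin kV → Fin kW → ℝ) :
    ∑ o, a.joint p o * F o.x o.y o.z o.u o.v o.w =
      ∑ x, ∑ y, ∑ z, ∑ u, ∑ v, ∑ w,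
        p (x, y, z) * a.pU y u * a.pV u z v * a.pW u v x w * F x y z u v w := by
  simp_rw [Fintype.sum_prod_type]
  rfl

lemma sum_joint_xyzu (F : X → Y → Z → Fin kU → ℝ) :
    ∑ o, a.joint p o * F o.x o.y o.z o.u =
      ∑ x, ∑ y, ∑ z, ∑ u, p (x, y, z) * a.pU y u * F x y z u := by
  rw [a.sum_joint p fun x y z u _ _ => F x y z u]
  refine Finset.sum_congr rfl fun x _ => Finset.sum_congr rfl fun y _ =>
    Finset.sum_congr rfl fun z _ => Finset.sum_congr rfl fun u _ => ?_
  simp_rw [mul_right_comm _ (a.pW _ _ _ _), ← Finset.mul_sum, (a.pW_mem _ _ _).2, mul_one,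
    mul_right_comm _ (a.pV _ _ _), ← Finset.mul_sum, (a.pV_mem _ _).2, mul_one]

lemma sum_joint_xzuvw (F : X → Z → Fin kU → Fin kV → Fin kW → ℝ) :
    ∑ o, a.joint p o * F o.x o.z o.u o.v o.w =
      ∑ x, ∑ z, ∑ u, ∑ v, ∑ w,
        (∑ y, p (x, y, z) * a.pU y u) * a.pV u z v * a.pW u v x w * F x z u v w := by
  rw [a.sum_joint p fun x _ z u v w => F x z u v w]
  refine Finset.sum_congr rfl fun x _ => ?_
  rw [Finset.sum_comm]
  refine Finset.sum_congr rfl fun z _ => ?_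
  rw [Finset.sum_comm]
  refine Finset.sum_congr rfl fun u _ => ?_
  rw [Finset.sum_comm]
  refine Finset.sum_congr rfl fun v _ => ?_
  rw [Finset.sum_comm]
  refine Finset.sum_congr rfl fun w _ => ?_
  simp_rw [Finset.sum_mul]

lemma sum_joint_eq_one {p : X × Y × Z → ℝ} (hp : p ∈ stdSimplex ℝ (X × Y × Z)) :
    ∑ o, a.joint p o = 1 := by
  have := a.sum_joint_xyzu p fun _ _ _ _ => 1
  simp only [mul_one, ← Finset.mul_sum, (a.pU_mem _).2] at this
  rw [this, ← hp.2]
  simp_rw [Fintype.sum_prod_type]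

end Aux

/-! ### From Markov conditions to kernels of auxiliary variables. -/

section Realize

variable {X Y Z Xh Zh : Type*} [Fintype X] [Fintype Y] [Fintype Z]
variable {Ω : Type*} [Fintype Ω] {q : Ω → ℝ}

lemma CondIndep.symm {α β γ : Type*} {A : Ω → α} {B : Ω → β} {C : Ω → γ}
    (h : CondIndep q A B C) : CondIndep q B A C := by
  intro b a c
  have := h a b c
  rw [law_eq_of_iff (B := fun ω => (A ω, B ω, C ω)) (b := (a, b, c)) (by grind), this, mul_comm]

/-- The conditional laws of u, v, w serve as the kernels. The joint law of all six variables need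
not be reproduced: the marginals of (X,Y,Z,U) and of (X,Z,U,V,W) are, and rates and distortions see
nothing else. Hence the Markov conditions on `v` and `w` do not mention `y`. -/
lemma singleLetter_of_condIndep_fin {kU kV kW : ℕ} (hq : ∀ ω, 0 ≤ q ω) [Nonempty Ω]
    {p : X × Y × Z → ℝ} {dx : X → Xh → ℝ} {dz : Z → Zh → ℝ} {Dx Dz : ℝ} {R : ℝ × ℝ × ℝ}
    {x : Ω → X} {y : Ω → Y} {z : Ω → Z} {u : Ω → Fin kU} {v : Ω → Fin kV} {w : Ω → Fin kW}
    (hlaw : ∀ s, law q (fun ω => (x ω, y ω, z ω)) s = p s)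
    (hU : CondIndep q (fun ω => (x ω, z ω)) u y)
    (hV : CondIndep q x v (fun ω => (u ω, z ω)))
    (hW : CondIndep q z w (fun ω => (u ω, v ω, x ω)))
    (h1 : condMutualInfo q y u z ≤ R.1)
    (h2 : condMutualInfo q z v (fun ω => (u ω, x ω)) ≤ R.2.1)
    (h3 : condMutualInfo q x w (fun ω => (u ω, v ω, z ω)) ≤ R.2.2)
    (xhat : Fin kU → Fin kW → Z → Xh) (zhat : Fin kU → Fin kV → X → Zh)
    (hx : ∑ ω, q ω * dx (x ω) (xhat (u ω) (w ω) (z ω)) ≤ Dx)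
    (hz : ∑ ω, q ω * dz (z ω) (zhat (u ω) (v ω) (x ω)) ≤ Dz) :
    SingleLetter p dx dz Dx Dz kU kV kW R := by
  have : Nonempty (Fin kU) := ‹Nonempty Ω›.map u
  have : Nonempty (Fin kV) := ‹Nonempty Ω›.map v
  have : Nonempty (Fin kW) := ‹Nonempty Ω›.map w
  obtain ⟨κU, hκU, eU⟩ := hU.exists_kernel hq
  obtain ⟨κV, hκV, eV⟩ := hV.exists_kernel hq
  obtain ⟨κW, hκW, eW⟩ := hW.exists_kernel hq
  let a : Aux X Y Z kU kV kW :=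
    { pU := κU, pV := fun u z => κV (u, z), pW := fun u v x => κW (u, v, x)
      pU_mem := hκU, pV_mem := fun _ _ => hκV _, pW_mem := fun _ _ _ => hκW _ }
  have lxyzu : ∀ x' y' z' u', p (x', y', z') * κU y' u' =
      law q (fun ω => (x ω, y ω, z ω, u ω)) (x', y', z', u') := by
    intro x' y' z' u'
    rw [← hlaw, law_eq_of_iff (A := fun ω => (x ω, y ω, z ω)) (B := fun ω => ((x ω, z ω), y ω))
      (b := ((x', z'), y')) (by grind), ← eU]
    exact law_eq_of_iff (by grind)
  have lxzu : ∀ x' z' u', ∑ y', p (x', y', z') * κU y' u' =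
      law q (fun ω => (x ω, z ω, u ω)) (x', z', u') := by
    intro x' z' u'
    simp_rw [lxyzu]
    rw [← law_fst q (fun ω => (x ω, z ω, u ω)) y]
    exact Finset.sum_congr rfl fun y' _ => law_eq_of_iff (by grind)
  have lall : ∀ x' z' u' v' w', (∑ y', p (x', y', z') * κU y' u') * κV (u', z') v' *
      κW (u', v', x') w' =
      law q (fun ω => (x ω, z ω, u ω, v ω, w ω)) (x', z', u', v', w') := by
    intro x' z' u' v' w'
    rw [lxzu, law_eq_of_iff (A := fun ω => (x ω, z ω, u ω)) (B := fun ω => (x ω, u ω, z ω))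
      (b := (x', u', z')) (by grind), ← eV,
      law_eq_of_iff (B := fun ω => (z ω, u ω, v ω, x ω)) (b := (z', u', v', x')) (by grind), ← eW]
    exact law_eq_of_iff (by grind)
  have e1 : ∀ F : X → Y → Z → Fin kU → ℝ, ∑ o, a.joint p o * F o.x o.y o.z o.u =
      ∑ ω, q ω * F (x ω) (y ω) (z ω) (u ω) := by
    intro F
    rw [a.sum_joint_xyzu, sum_mul_comp q (fun ω => (x ω, y ω, z ω, u ω))
      (fun s => F s.1 s.2.1 s.2.2.1 s.2.2.2)]
    simp_rw [Fintype.sum_prod_type, ← lxyzu]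
    rfl
  have e2 : ∀ F : X → Z → Fin kU → Fin kV → Fin kW → ℝ,
      ∑ o, a.joint p o * F o.x o.z o.u o.v o.w =
      ∑ ω, q ω * F (x ω) (z ω) (u ω) (v ω) (w ω) := by
    intro F
    rw [a.sum_joint_xzuvw, sum_mul_comp q (fun ω => (x ω, z ω, u ω, v ω, w ω))
      (fun s => F s.1 s.2.1 s.2.2.1 s.2.2.2.1 s.2.2.2.2)]
    simp_rw [Fintype.sum_prod_type, ← lall]
    rfl
  refine ⟨a, xhat, zhat, ?_, ?_, ?_, ?_, ?_⟩
  · rwa [condMutualInfo_congr_of_expect fun F => e1 fun _ y z u => F y u z]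
  · rwa [condMutualInfo_congr_of_expect fun F => e2 fun x z u v _ => F z v (u, x)]
  · rwa [condMutualInfo_congr_of_expect fun F => e2 fun x z u v w => F x w (u, v, z)]
  · rwa [e2 fun x z u v w => dx x (xhat u w z)]
  · rwa [e2 fun x z u v w => dz z (zhat u v x)]

lemma CondIndep.transport {α β γ β' γ' : Type*} {A : Ω → α} {B : Ω → β} {C : Ω → γ}
    (h : CondIndep q A B C) (f : β ≃ β') (g : γ ≃ γ') :
    CondIndep q A (fun ω => f (B ω)) (fun ω => g (C ω)) := by
  intro a b c
  have e := fun (c' : γ) => (Equiv.eq_symm_apply g (x := c) (y := c'))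
  have ef := fun (c' : β) => (Equiv.eq_symm_apply f (x := b) (y := c'))
  convert h a (f.symm b) (g.symm c) using 2 <;> exact law_eq_of_iff (by simp [e, ef])

/-- Random variables on a finite probability space that satisfy the Markov conditions, the rate
constraints and the distortion constraints witness membership in the single-letter region. -/
lemma singleLetter_of_condIndep {𝒰 𝒱 𝒲 : Type*} [Fintype 𝒰] [Fintype 𝒱] [Fintype 𝒲]
    (hq : ∀ ω, 0 ≤ q ω) [Nonempty Ω]
    {p : X × Y × Z → ℝ} {dx : X → Xh → ℝ} {dz : Z → Zh → ℝ} {Dx Dz : ℝ} {R : ℝ × ℝ × ℝ}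
    {x : Ω → X} {y : Ω → Y} {z : Ω → Z} {u : Ω → 𝒰} {v : Ω → 𝒱} {w : Ω → 𝒲}
    (hlaw : ∀ s, law q (fun ω => (x ω, y ω, z ω)) s = p s)
    (hU : CondIndep q (fun ω => (x ω, z ω)) u y)
    (hV : CondIndep q x v (fun ω => (u ω, z ω)))
    (hW : CondIndep q z w (fun ω => (u ω, v ω, x ω)))
    (h1 : condMutualInfo q y u z ≤ R.1)
    (h2 : condMutualInfo q z v (fun ω => (u ω, x ω)) ≤ R.2.1)
    (h3 : condMutualInfo q x w (fun ω => (u ω, v ω, z ω)) ≤ R.2.2)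
    (xhat : 𝒰 → 𝒲 → Z → Xh) (zhat : 𝒰 → 𝒱 → X → Zh)
    (hx : ∑ ω, q ω * dx (x ω) (xhat (u ω) (w ω) (z ω)) ≤ Dx)
    (hz : ∑ ω, q ω * dz (z ω) (zhat (u ω) (v ω) (x ω)) ≤ Dz) :
    R ∈ region p dx dz Dx Dz := by
  let eU := Fintype.equivFin 𝒰
  let eV := Fintype.equivFin 𝒱
  let eW := Fintype.equivFin 𝒲
  refine ⟨Fintype.card 𝒰, Fintype.card 𝒱, Fintype.card 𝒲,
    singleLetter_of_condIndep_fin hq (x := x) (y := y) (z := z) (u := fun ω => eU (u ω))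
      (v := fun ω => eV (v ω)) (w := fun ω => eW (w ω)) hlaw
      (hU.transport eU (Equiv.refl _)) (hV.transport eV (eU.prodCongr (Equiv.refl _)))
      (hW.transport eW (eU.prodCongr (eV.prodCongr (Equiv.refl _))))
      (le_of_eq_of_le ?_ h1) (le_of_eq_of_le ?_ h2) (le_of_eq_of_le ?_ h3)
      (fun u w z => xhat (eU.symm u) (eW.symm w) z) (fun u v x => zhat (eU.symm u) (eV.symm v) x)
      (by simpa using hx) (by simpa using hz)⟩ <;>
  exact condMutualInfo_congr_partition hq (by simp) (by simp) (by simp)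

end Realize

/-! ### Two inequalities for conditional mutual information. -/

section InfoInequalities

variable {Ω α β γ δ : Type*} [Fintype Ω] {q : Ω → ℝ} [Fintype α] [Fintype β] [Fintype γ]
  [Fintype δ]

/-- If `A` and `D` are independent given `C`, conditioning on `D` can only increase `I(A;B|C)`. -/
lemma condMutualInfo_le_of_condIndep (hq : ∀ ω, 0 ≤ q ω) {A : Ω → α} {B : Ω → β} {C : Ω → γ}
    {D : Ω → δ} (h : CondIndep q A D C) :
    condMutualInfo q A B C ≤
      (ent q (fun ω => (B ω, D ω, C ω)) - ent q (fun ω => (D ω, C ω))) -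
      (ent q (fun ω => (B ω, A ω, D ω, C ω)) - ent q (fun ω => (A ω, D ω, C ω))) := by
  -- The right-hand side is I(A;B|C,D), spelled out as H(B|C,D) - H(B|A,C,D) because that is the
  -- shape of a telescoping increment.
  rw [condMutualInfo_eq_ent hq]
  have h1 := h.ent_eq hq
  have h2 := ent_submodular hq A D (fun ω => (B ω, C ω))
  rw [ent_congr (A := fun ω => (A ω, D ω, B ω, C ω)) (B := fun ω => (B ω, A ω, D ω, C ω))
      (by grind), ent_congr (A := fun ω => (D ω, B ω, C ω)) (B := fun ω => (B ω, D ω, C ω))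
      (by grind)] at h2
  linarith

/-- The difference is I(D;B|A,C), which is nonnegative. -/
lemma condMutualInfo_le_pair (hq : ∀ ω, 0 ≤ q ω) (A : Ω → α) (B : Ω → β) (C : Ω → γ)
    (D : Ω → δ) : condMutualInfo q A B C ≤ condMutualInfo q (fun ω => (D ω, A ω)) B C := by
  rw [condMutualInfo_eq_ent hq, condMutualInfo_eq_ent hq]
  have := ent_submodular hq D B (fun ω => (A ω, C ω))
  rw [ent_congr (A := fun ω => (B ω, A ω, C ω)) (B := fun ω => (A ω, B ω, C ω)) (by grind),
    ent_congr (A := fun ω => (D ω, A ω, C ω)) (B := fun ω => ((D ω, A ω), C ω)) (by grind),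
    ent_congr (A := fun ω => (D ω, B ω, A ω, C ω)) (B := fun ω => ((D ω, A ω), B ω, C ω))
      (by grind)] at this
  linarith

end InfoInequalities

/-! ### A uniform time index and telescoping entropies. -/

section Mixture

variable {n : ℕ} {S α τ δ : Type*} [Fintype S]

/-- The law of `n` i.i.d. letters with mass function `p`. -/
def blockLaw (n : ℕ) (p : S → ℝ) (s : Fin n → S) : ℝ := ∏ i, p (s i)

/-- The law of a uniform time index and an independent i.i.d. block. -/
def timeLaw (n : ℕ) (p : S → ℝ) (ω : Fin n × (Fin n → S)) : ℝ := (1 / (n : ℝ)) * blockLaw n p ω.2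

lemma blockLaw_nonneg {S : Type*} {p : S → ℝ} (hp : ∀ s, 0 ≤ p s) (s : Fin n → S) :
    0 ≤ blockLaw n p s :=
  Finset.prod_nonneg fun _ _ => hp _

lemma sum_blockLaw {p : S → ℝ} (hp : ∑ s, p s = 1) : ∑ s, blockLaw n p s = 1 := by
  classical
  unfold blockLaw
  rw [← Fintype.piFinset_univ, ← Finset.prod_univ_sum (fun _ => Finset.univ) (fun _ s => p s)]
  simp [hp]

lemma timeLaw_nonneg {S : Type*} {p : S → ℝ} (hp : ∀ s, 0 ≤ p s) (ω : Fin n × (Fin n → S)) :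
    0 ≤ timeLaw n p ω :=
  mul_nonneg (by positivity) (blockLaw_nonneg hp _)

lemma law_timeLaw (p : S → ℝ) (A : Fin n → (Fin n → S) → α) (i : Fin n) (a : α) :
    law (timeLaw n p) (fun ω => (ω.1, A ω.1 ω.2)) (i, a) =
      (1 / (n : ℝ)) * law (blockLaw n p) (A i) a := by
  classical
  unfold law timeLaw
  rw [Fintype.sum_prod_type, Finset.sum_eq_single i]
  · rw [Finset.mul_sum]
    refine Finset.sum_congr rfl fun s _ => ?_
    by_cases h : A i s = a <;> simp [h]
  · intro j _ hj
    exact Finset.sum_eq_zero fun s _ => by simp [hj]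
  · simp

/-- Chain rule: the index contributes log n, and the remaining conditional entropy is an average
over the index. The term log n cancels in all later differences. -/
lemma ent_timeLaw (hn : n ≠ 0) {p : S → ℝ} (hp : ∀ s, 0 ≤ p s) (h1 : ∑ s, p s = 1)
    (A : Fin n → (Fin n → S) → α) :
    ent (timeLaw n p) (fun ω => (ω.1, A ω.1 ω.2)) =
      Real.logb 2 n + (1 / (n : ℝ)) * ∑ i, ent (blockLaw n p) (A i) := by
  have hn' : (n : ℝ) ≠ 0 := by exact_mod_cast hn
  unfold ent
  simp only [law_timeLaw]
  rw [Fintype.sum_prod_type, Finset.sum_neg_distrib, mul_neg, Finset.mul_sum]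
  have : ∀ i : Fin n, ∑ s, timeLaw n p (i, s) *
      Real.logb 2 (1 / (n : ℝ) * law (blockLaw n p) (A i) (A i s)) =
      -((1 / (n : ℝ)) * Real.logb 2 n) +
        1 / (n : ℝ) * ∑ s, blockLaw n p s * Real.logb 2 (law (blockLaw n p) (A i) (A i s)) := by
    intro i
    have e : (1 / (n : ℝ)) * Real.logb 2 n =
        ∑ s, (1 / (n : ℝ)) * (blockLaw n p s * Real.logb 2 n) := by
      rw [← Finset.mul_sum, ← Finset.sum_mul, sum_blockLaw h1, one_mul]
    rw [e, Finset.mul_sum, ← Finset.sum_neg_distrib, ← Finset.sum_add_distrib]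
    refine Finset.sum_congr rfl fun s _ => ?_
    unfold timeLaw
    rcases (blockLaw_nonneg hp s).eq_or_lt with h0 | h0
    · simp [← h0]
    · rw [Real.logb_mul (by positivity) (law_pos (blockLaw_nonneg hp) (A i) h0).ne',
        one_div, Real.logb_inv]
      ring
  simp_rw [this]
  rw [Finset.sum_add_distrib]
  simp
  field_simp
  ring

/-- The telescoping sum of the increments of `H(T|D_k)` is at most `log |τ|`. -/
lemma abs_ent_telescope_le [Fintype τ] [Fintype δ] (hn : n ≠ 0) {p : S → ℝ} (hp : ∀ s, 0 ≤ p s)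
    (h1 : ∑ s, p s = 1) (T : (Fin n → S) → τ) (D : ℕ → (Fin n → S) → δ) :
    |(ent (timeLaw n p) (fun ω => (ω.1, T ω.2, D ω.1 ω.2)) -
        ent (timeLaw n p) (fun ω => (ω.1, D ω.1 ω.2))) -
      (ent (timeLaw n p) (fun ω => (ω.1, T ω.2, D (ω.1 + 1) ω.2)) -
        ent (timeLaw n p) (fun ω => (ω.1, D (ω.1 + 1) ω.2)))| ≤
      Real.logb 2 (Fintype.card τ) / n := by
  have hn' : (0 : ℝ) < n := by exact_mod_cast Nat.pos_of_ne_zero hn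
  -- `φ k` is H(T|D_k), which lies between 0 and log |τ|. The absolute value in the statement covers
  -- families `D` that become finer with `k` as well as coarser ones.
  set φ : ℕ → ℝ := fun k => ent (blockLaw n p) (fun s => (T s, D k s)) - ent (blockLaw n p) (D k)
    with hφ
  have h0 : ∀ k, 0 ≤ φ k := fun k => sub_nonneg.2 (ent_le_ent_pair (blockLaw_nonneg hp) T (D k))
  have hle : ∀ k, φ k ≤ Real.logb 2 (Fintype.card τ) := fun k => by
    have := ent_pair_le (blockLaw_nonneg hp) (sum_blockLaw h1) T (D k)
    simp only [hφ]
    linarith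
  rw [ent_timeLaw hn hp h1 (fun i s => (T s, D i s)), ent_timeLaw hn hp h1 (fun i s => D i s),
    ent_timeLaw hn hp h1 (fun i s => (T s, D (i + 1) s)),
    ent_timeLaw hn hp h1 (fun i s => D (i + 1) s)]
  have : ∑ i : Fin n, (φ i - φ (i + 1)) = φ 0 - φ n := by
    rw [Fin.sum_univ_eq_sum_range (fun i => φ i - φ (i + 1)), Finset.sum_range_sub']
  have e : ∀ a b c d l m : ℝ, (l + m * a - (l + m * b)) - (l + m * c - (l + m * d)) =
      m * ((a - b) - (c - d)) := fun _ _ _ _ _ _ => by ring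
  rw [e, ← Finset.sum_sub_distrib, ← Finset.sum_sub_distrib, ← Finset.sum_sub_distrib]
  change |1 / (n : ℝ) * ∑ i : Fin n, (φ i - φ (i + 1))| ≤ _
  rw [this, abs_mul, abs_of_pos (by positivity), one_div_mul_eq_div]
  gcongr
  rw [abs_le]
  constructor <;> linarith [h0 0, h0 n, hle 0, hle n]

end Mixture

/-! ### Exchanges of letters between two independent blocks. -/

section Swaps

variable {X Y Z S : Type*} {n : ℕ}

/-- Exchange the letters that the two time indices point at. -/
def letterSwap (x : (Fin n × (Fin n → S)) × (Fin n × (Fin n → S))) :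
    (Fin n × (Fin n → S)) × (Fin n × (Fin n → S)) :=
  ((x.1.1, Function.update x.1.2 x.1.1 (x.2.2 x.2.1)),
    (x.2.1, Function.update x.2.2 x.2.1 (x.1.2 x.1.1)))

lemma letterSwap_involutive : Function.Involutive (letterSwap (S := S) (n := n)) := by
  rintro ⟨⟨i, s⟩, ⟨i', s'⟩⟩
  simp [letterSwap]

/-- The exchange permutes the factors of the two product measures, so it needs no property of the
source. -/
lemma timeLaw_letterSwap (p : S → ℝ) (ω ω' : Fin n × (Fin n → S)) :
    timeLaw n p (letterSwap (ω, ω')).1 * timeLaw n p (letterSwap (ω, ω')).2 =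
      timeLaw n p ω * timeLaw n p ω' := by
  obtain ⟨i, s⟩ := ω
  obtain ⟨j, t⟩ := ω'
  have e : ∀ (s : Fin n → S) (i : Fin n) (a : S), blockLaw n p (Function.update s i a) =
      p a * ∏ j ∈ Finset.univ.erase i, p (s j) := by
    intro s i a
    unfold blockLaw
    rw [← Finset.mul_prod_erase _ _ (Finset.mem_univ i), Function.update_self]
    congr 1
    exact Finset.prod_congr rfl fun j hj => by rw [Function.update_of_ne (Finset.ne_of_mem_erase hj)]
  have hsplit : ∀ (s : Fin n → S) (i : Fin n), blockLaw n p s =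
      p (s i) * ∏ j ∈ Finset.univ.erase i, p (s j) := by
    intro s i
    rw [← e, Function.update_eq_self]
  simp only [letterSwap, timeLaw]
  rw [e, e, hsplit s i, hsplit t j]
  ring

/-- Exchange the `Z`-letters at the times selected by `c` when the two time indices agree. -/
def cutSwap (c : Fin n → Fin n → Prop) [∀ i j, Decidable (c i j)]
    (x : (Fin n × (Fin n → X × Y × Z)) × (Fin n × (Fin n → X × Y × Z))) :
    (Fin n × (Fin n → X × Y × Z)) × (Fin n × (Fin n → X × Y × Z)) :=
  ((x.1.1, fun j => ((x.1.2 j).1, (x.1.2 j).2.1,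
      if x.1.1 = x.2.1 ∧ c x.1.1 j then (x.2.2 j).2.2 else (x.1.2 j).2.2)),
    (x.2.1, fun j => ((x.2.2 j).1, (x.2.2 j).2.1,
      if x.1.1 = x.2.1 ∧ c x.1.1 j then (x.1.2 j).2.2 else (x.2.2 j).2.2)))

lemma cutSwap_involutive (c : Fin n → Fin n → Prop) [∀ i j, Decidable (c i j)] :
    Function.Involutive (cutSwap (X := X) (Y := Y) (Z := Z) c) := by
  rintro ⟨⟨i, s⟩, ⟨i', s'⟩⟩
  simp only [cutSwap]
  congr 2 <;> funext j <;> split_ifs <;> rfl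

variable [Fintype X] [Fintype Y] [Fintype Z]

/-- Given X, the law of (Y,Z) is a product, so two triples with the same X-letter can trade their
Z-letters. -/
lemma IsMarkovYXZ.swap {p : X × Y × Z → ℝ} (hp : ∀ s, 0 ≤ p s) (hM : IsMarkovYXZ p)
    (x : X) (y y' : Y) (z z' : Z) :
    p (x, y, z') * p (x, y', z) = p (x, y, z) * p (x, y', z') := by
  -- The Markov identity carries the factor p(x). If it vanishes, so do all terms; otherwise it is
  -- cancelled twice.
  by_cases h0 : ∑ y', ∑ z', p (x, y', z') = 0
  · have : ∀ y z, p (x, y, z) = 0 := by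
      intro y z
      rw [Finset.sum_eq_zero_iff_of_nonneg fun y _ => Finset.sum_nonneg fun z _ => hp _] at h0
      have h1 := h0 y (Finset.mem_univ _)
      rw [Finset.sum_eq_zero_iff_of_nonneg fun z _ => hp _] at h1
      exact h1 z (Finset.mem_univ _)
    simp [this]
  · have h1 := hM x y z'
    have h2 := hM x y' z
    have h3 := hM x y z
    have h4 := hM x y' z'
    refine mul_right_cancel₀ (mul_ne_zero h0 h0) ?_
    linear_combination h1 * (p (x, y', z) * ∑ y', ∑ z', p (x, y', z')) +
      h2 * ((∑ z', p (x, y, z')) * ∑ y', p (x, y', z')) -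
      h3 * (p (x, y', z') * ∑ y', ∑ z', p (x, y', z')) -
      h4 * ((∑ z', p (x, y, z')) * ∑ y', p (x, y', z))

lemma timeLaw_cutSwap {p : X × Y × Z → ℝ} (hp : ∀ s, 0 ≤ p s) (hM : IsMarkovYXZ p)
    (c : Fin n → Fin n → Prop) [∀ i j, Decidable (c i j)] (ω ω' : Fin n × (Fin n → X × Y × Z))
    (h : ∀ j, c ω.1 j → (ω.2 j).1 = (ω'.2 j).1) :
    timeLaw n p (cutSwap c (ω, ω')).1 * timeLaw n p (cutSwap c (ω, ω')).2 =
      timeLaw n p ω * timeLaw n p ω' := by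
  obtain ⟨i, s⟩ := ω
  obtain ⟨i', s'⟩ := ω'
  have : blockLaw n p (cutSwap c ((i, s), (i', s'))).1.2 *
      blockLaw n p (cutSwap c ((i, s), (i', s'))).2.2 = blockLaw n p s * blockLaw n p s' := by
    unfold blockLaw
    rw [← Finset.prod_mul_distrib, ← Finset.prod_mul_distrib]
    refine Finset.prod_congr rfl fun j _ => ?_
    by_cases hc : i = i' ∧ c i j
    · have hx := h j hc.2
      simp only at hx
      have := hM.swap hp (s j).1 (s j).2.1 (s' j).2.1 (s j).2.2 (s' j).2.2
      simp only [cutSwap]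
      rw [if_pos hc, if_pos hc, ← hx, this, hx]
      congr 2
      rw [← hx]
    · simp only [cutSwap, hc, if_false]
  simp only [timeLaw]
  linear_combination (1 / (n : ℝ)) ^ 2 * this

end Swaps

/-! ### Converse: a code yields auxiliary variables. -/

section Converse

variable {X Y Z Xh Zh : Type*} {n M₁ M₂ M₃ : ℕ}

/-- The block with the `X`- and `Y`-letters of `s` and the `Z`-letters of `s'`. -/
def graftZ (s s' : Fin n → X × Y × Z) : Fin n → X × Y × Z :=
  fun j => ((s j).1, (s j).2.1, (s' j).2.2)

/-- When the Z-letters already agree outside the cut, exchanging those inside amounts to exchanging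
the whole Z-sequences, whose effect on the messages is easy to follow. -/
lemma cutSwap_eq (c : Fin n → Fin n → Prop) [∀ i j, Decidable (c i j)] {i : Fin n}
    {s s' : Fin n → X × Y × Z} (h : ∀ j, ¬ c i j → (s j).2.2 = (s' j).2.2) :
    cutSwap c ((i, s), (i, s')) = ((i, graftZ s s'), (i, graftZ s' s)) := by
  simp only [cutSwap, true_and]
  congr 2 <;> funext j <;> split_ifs with hc
  · rfl
  · rw [h j hc]
    rfl
  · rfl
  · rw [← h j hc]
    rfl

/-- The letters of a sequence at the times selected by `c`. -/
def mask {α : Type*} (c : Fin n → Prop) [DecidablePred c] (f : Fin n → α) : Fin n → Option α :=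
  fun j => if c j then some (f j) else none

lemma mask_eq_mask_iff {α : Type*} {c : Fin n → Prop} [DecidablePred c] {f g : Fin n → α} :
    mask c f = mask c g ↔ ∀ j, c j → f j = g j := by
  rw [funext_iff]
  refine forall_congr' fun j => ?_
  by_cases h : c j <;> simp [mask, h]

namespace Code

variable (c : Code X Y Z Xh Zh n M₁ M₂ M₃)

/-- The auxiliary variable of the helper: the time index, the message `T₁`, the past of `X` and the
future of `Z`. -/
def auxU (ω : Fin n × (Fin n → X × Y × Z)) :
    Fin n × Fin M₁ × (Fin n → Option X) × (Fin n → Option Z) :=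
  (ω.1, c.T₁ ω.2, mask (· < ω.1) (fun j => (ω.2 j).1), mask (ω.1 < ·) (fun j => (ω.2 j).2.2))

/-- The auxiliary variable of User X: the messages `T₂` and `T₃`. -/
def auxW (ω : Fin n × (Fin n → X × Y × Z)) : Fin M₂ × Fin M₃ := (c.T₂ ω.2, c.T₃ ω.2)

lemma auxU_eq_iff {i i' : Fin n} {s s' : Fin n → X × Y × Z} :
    c.auxU (i, s) = c.auxU (i', s') ↔ i = i' ∧ c.T₁ s = c.T₁ s' ∧
      (∀ j, j < i → (s j).1 = (s' j).1) ∧ (∀ j, i < j → (s j).2.2 = (s' j).2.2) := by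
  simp only [auxU, Prod.mk.injEq]
  constructor
  · rintro ⟨rfl, h1, h2, h3⟩
    exact ⟨rfl, h1, mask_eq_mask_iff.1 h2, mask_eq_mask_iff.1 h3⟩
  · rintro ⟨rfl, h1, h2, h3⟩
    exact ⟨rfl, h1, mask_eq_mask_iff.2 h2, mask_eq_mask_iff.2 h3⟩

lemma T₁_graftZ (s s' : Fin n → X × Y × Z) : c.T₁ (graftZ s s') = c.T₁ s := rfl

/-- User Z sees only `T₁` and its own sequence, so `T₂` follows the block that lends the Z-letters.
-/
lemma T₂_graftZ {s s' : Fin n → X × Y × Z} (h : c.T₁ s = c.T₁ s') :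
    c.T₂ (graftZ s s') = c.T₂ s' := by
  simp only [T₂, T₁_graftZ, h]
  rfl

/-- Once the blocks agree on `T₁` and `T₂`, only the X-sequence matters for `T₃`, so it stays with
the block that lends the X-letters. -/
lemma T₃_graftZ {s s' : Fin n → X × Y × Z} (h : c.T₁ s = c.T₁ s') (h' : c.T₂ s = c.T₂ s') :
    c.T₃ (graftZ s s') = c.T₃ s := by
  simp only [T₃, T₁_graftZ, T₂_graftZ c h, ← h']
  rfl

end Code

variable [Fintype X] [Fintype Y] [Fintype Z]

/-- Both variables reveal the time index, so their level sets need only be compared at a fixed time.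
-/
lemma ent_congr_time {S α β : Type*} [Fintype S] {q : Fin n × (Fin n → S) → ℝ}
    {A : Fin n × (Fin n → S) → α} {B : Fin n × (Fin n → S) → β}
    (hA : ∀ ω ω', A ω' = A ω → ω'.1 = ω.1) (hB : ∀ ω ω', B ω' = B ω → ω'.1 = ω.1)
    (h : ∀ i s s', A (i, s') = A (i, s) ↔ B (i, s') = B (i, s)) : ent q A = ent q B := by
  refine ent_congr ?_
  rintro ⟨i, s⟩ ⟨i', s'⟩
  constructor
  · intro h'
    obtain rfl : i' = i := hA _ _ h'
    exact (h _ _ _).1 h'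
  · intro hb
    obtain rfl : i' = i := hB _ _ hb
    exact (h _ _ _).2 hb

/-- Given the `X`-letters inside a cut and the `Z`-letters outside of it, the `Z`-letters inside
are independent of everything that depends on the source otherwise. -/
lemma condIndep_of_cut {α β γ : Type*} {p : X × Y × Z → ℝ} (hp : ∀ s, 0 ≤ p s)
    (hM : IsMarkovYXZ p) (c : Fin n → Fin n → Prop) [∀ i j, Decidable (c i j)]
    {A : Fin n × (Fin n → X × Y × Z) → α} {B : Fin n × (Fin n → X × Y × Z) → β}
    {C : Fin n × (Fin n → X × Y × Z) → γ}
    (h : ∀ i i' s s', C (i, s) = C (i', s') → i = i' ∧ (∀ j, c i j → (s j).1 = (s' j).1) ∧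
      (∀ j, ¬ c i j → (s j).2.2 = (s' j).2.2))
    (h' : ∀ i s s', C (i, s) = C (i, s') → (∀ j, c i j → (s j).1 = (s' j).1) →
      (∀ j, ¬ c i j → (s j).2.2 = (s' j).2.2) → A (i, graftZ s s') = A (i, s') ∧
      B (i, graftZ s s') = B (i, s) ∧ C (i, graftZ s s') = C (i, s)) :
    CondIndep (timeLaw n p) A B C := by
  refine condIndep_of_swap (cutSwap c) (cutSwap_involutive c) ?_
  rintro ⟨i, s⟩ ⟨i', s'⟩ hC
  obtain ⟨rfl, hx, hz⟩ := h _ _ _ _ hC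
  refine ⟨timeLaw_cutSwap hp hM c _ _ hx, ?_⟩
  rw [cutSwap_eq c hz]
  obtain ⟨h1, h2, h3⟩ := h' i s s' hC hx hz
  obtain ⟨-, -, h4⟩ := h' i s' s hC.symm (fun j hj => (hx j hj).symm) (fun j hj => (hz j hj).symm)
  exact ⟨h1, h2, h3, h4.trans hC.symm⟩

/-- For variables `A` of the current letter alone. Exchanging the current letters of two independent
copies moves `A`, while `B` must be insensitive to a new letter with the same value of `C`. -/
lemma condIndep_of_letterSwap {α β γ : Type*} {p : X × Y × Z → ℝ}
    {A : Fin n × (Fin n → X × Y × Z) → α} {B : Fin n × (Fin n → X × Y × Z) → β}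
    {C : X × Y × Z → γ}
    (hA : ∀ i i' s s', A (i, Function.update s i (s' i')) = A (i', s'))
    (hB : ∀ i s a, C (s i) = C a → B (i, Function.update s i a) = B (i, s)) :
    CondIndep (timeLaw n p) A B (fun ω => C (ω.2 ω.1)) := by
  refine condIndep_of_swap letterSwap letterSwap_involutive ?_
  rintro ⟨i, s⟩ ⟨i', s'⟩ hC
  exact ⟨timeLaw_letterSwap p _ _, hA i i' s s', hB i s _ hC, by simpa [letterSwap] using hC.symm,
    by simp [letterSwap]⟩

lemma law_timeLaw_letter (hn : n ≠ 0) {S : Type*} [Fintype S] {p : S → ℝ} (h1 : ∑ s, p s = 1)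
    (a : S) : law (timeLaw n p) (fun ω => ω.2 ω.1) a = p a := by
  classical
  have hn' : (n : ℝ) ≠ 0 := by exact_mod_cast hn
  have key : ∀ i : Fin n, ∑ s : Fin n → S, (if s i = a then blockLaw n p s else 0) = p a := by
    intro i
    -- The indicator is absorbed into the factor at time `i`, so the sum over blocks splits into a
    -- product of sums over letters.
    have : ∀ s : Fin n → S, (if s i = a then blockLaw n p s else 0) =
        ∏ j, (if j = i then (if s j = a then p (s j) else 0) else p (s j)) := by
      intro s
      by_cases h : s i = a
      · rw [if_pos h]
        refine Finset.prod_congr rfl fun j _ => ?_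
        by_cases hj : j = i
        · subst hj
          simp [h]
        · simp [hj]
      · rw [if_neg h]
        exact (Finset.prod_eq_zero (Finset.mem_univ i) (by simp [h])).symm
    simp_rw [this]
    rw [← Fintype.piFinset_univ, ← Finset.prod_univ_sum (fun _ => Finset.univ)
      (fun j b => if j = i then (if b = a then p b else 0) else p b),
      Finset.prod_eq_single i]
    · simp
    · intro j _ hj
      simp [hj, h1]
    · simp
  unfold law timeLaw
  rw [Fintype.sum_prod_type]
  have : ∀ i : Fin n, ∑ s : Fin n → S, (if s i = a then 1 / (n : ℝ) * blockLaw n p s else 0) =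
      1 / (n : ℝ) * p a := by
    intro i
    rw [← key i, Finset.mul_sum]
    exact Finset.sum_congr rfl fun s _ => by split_ifs <;> simp
  calc _ = ∑ i : Fin n, 1 / (n : ℝ) * p a := Finset.sum_congr rfl fun i _ => by
        rw [← this i]
    _ = p a := by
        simp
        field_simp

namespace Code

variable (c : Code X Y Z Xh Zh n M₁ M₂ M₃)

/-- The past of `(X, Y)` together with the `Z`-letters at the other times. -/
def context {n : ℕ} {X Y Z : Type*} (ω : Fin n × (Fin n → X × Y × Z)) :
    Fin n × (Fin n → Option Z) × (Fin n → Option (X × Y)) :=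
  (ω.1, mask (· ≠ ω.1) (fun j => (ω.2 j).2.2),
    mask (· < ω.1) (fun j => ((ω.2 j).1, (ω.2 j).2.1)))

lemma context_eq_iff {n : ℕ} {X Y Z : Type*} {i i' : Fin n} {s s' : Fin n → X × Y × Z} :
    context (i, s) = context (i', s') ↔ i = i' ∧ (∀ j, j ≠ i → (s j).2.2 = (s' j).2.2) ∧
      (∀ j, j < i → (s j).1 = (s' j).1 ∧ (s j).2.1 = (s' j).2.1) := by
  simp only [context, Prod.mk.injEq]
  constructor
  · rintro ⟨rfl, h2, h3⟩
    exact ⟨rfl, mask_eq_mask_iff.1 h2, fun j hj => Prod.mk.injEq _ _ _ _ ▸ mask_eq_mask_iff.1 h3 j hj⟩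
  · rintro ⟨rfl, h2, h3⟩
    exact ⟨rfl, mask_eq_mask_iff.2 h2,
      mask_eq_mask_iff.2 fun j hj => Prod.ext (h3 j hj).1 (h3 j hj).2⟩

variable {p : X × Y × Z → ℝ}

/-- Enlarge Y to (X,Y) and condition also on the context, which is independent of the current pair
given Z. The context determines `U` up to `T₁`, so what is left is the drop of H(T₁ | Zⁿ, past of
(X,Y)) when one more pair is revealed. -/
lemma condMutualInfo_auxU_le (hn : n ≠ 0) (hp : p ∈ stdSimplex ℝ (X × Y × Z)) :
    condMutualInfo (timeLaw n p) (fun ω => (ω.2 ω.1).2.1) c.auxU (fun ω => (ω.2 ω.1).2.2) ≤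
      Real.logb 2 M₁ / n := by
  have hq := timeLaw_nonneg (n := n) hp.1
  have hI : CondIndep (timeLaw n p) (fun ω => ((ω.2 ω.1).1, (ω.2 ω.1).2.1)) context
      (fun ω => (ω.2 ω.1).2.2) := by
    refine condIndep_of_letterSwap (C := fun s => s.2.2) (fun i i' s s' => by simp)
      fun i s a _ => context_eq_iff.2 ⟨rfl, fun j hj => ?_, fun j hj => ?_⟩
    · rw [Function.update_of_ne hj]
    · rw [Function.update_of_ne hj.ne]
      exact ⟨rfl, rfl⟩
  have h1 := condMutualInfo_le_of_condIndep hq (B := c.auxU) hI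
  have h2 : condMutualInfo (timeLaw n p) (fun ω => (ω.2 ω.1).2.1) c.auxU
      (fun ω => (ω.2 ω.1).2.2) ≤ condMutualInfo (timeLaw n p)
      (fun ω => ((ω.2 ω.1).1, (ω.2 ω.1).2.1)) c.auxU (fun ω => (ω.2 ω.1).2.2) :=
    condMutualInfo_le_pair hq _ _ _ _
  -- Context and current Z-letter give D_i; adding the current pair (X,Y) gives D_(i+1).
  have h3 := abs_ent_telescope_le hn hp.1 hp.2 c.T₁
    (fun k s => ((fun j => (s j).2.2), mask (fun j : Fin n => (j : ℕ) < k)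
      (fun j => ((s j).1, (s j).2.1))))
  rw [Fintype.card_fin] at h3
  refine h2.trans (h1.trans (le_trans (le_of_eq ?_) ((le_abs_self _).trans h3)))
  clear h1 h2 h3 hI hq
  congr 1 <;> congr 1 <;> refine ent_congr_time ?_ ?_ ?_
  -- Each of the four entropies matches its counterpart because both tuples generate the same
  -- partition.
  iterate 4
  · simp +contextual [auxU, context]
  · simp +contextual
  · intro i s s'
    simp only [auxU_eq_iff, context_eq_iff, mask_eq_mask_iff, Prod.mk.injEq, true_and]
    simp only [funext_iff, Fin.lt_def, Fin.ext_iff, ne_eq]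
    grind

/-- Replacing the current letter by one with the same Y leaves Yⁿ, hence `T₁`, unchanged, and the
other components of `U` skip the current time. -/
lemma condIndep_y_auxU : CondIndep (timeLaw n p)
    (fun ω => ((ω.2 ω.1).1, (ω.2 ω.1).2.2)) c.auxU (fun ω => (ω.2 ω.1).2.1) := by
  refine condIndep_of_letterSwap (C := fun s => s.2.1) (fun i i' s s' => by simp)
    fun i s a h => (c.auxU_eq_iff).2 ⟨rfl, ?_, fun j hj => ?_, fun j hj => ?_⟩
  · unfold T₁
    congr 1
    funext j
    by_cases hj : j = i
    · subst hj
      simpa using h.symm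
    · rw [Function.update_of_ne hj]
  · rw [Function.update_of_ne hj.ne]
  · rw [Function.update_of_ne hj.ne']

/-- `U` and the current X fix the X-letters up to time i and the Z-letters after it: exactly what
the exchange over the cut `j ≤ i` requires. -/
lemma condIndep_xseq (hp : ∀ s, 0 ≤ p s) (hM : IsMarkovYXZ p) :
    CondIndep (timeLaw n p) (fun ω => (ω.2 ω.1).2.2) (fun ω j => (ω.2 j).1)
    (fun ω => (c.auxU ω, (ω.2 ω.1).1)) := by
  refine condIndep_of_cut hp hM (fun i j => j ≤ i) ?_ ?_
  · intro i i' s s' h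
    simp only [Prod.mk.injEq, auxU_eq_iff] at h
    grind
  · intro i s s' h hx hz
    simp only [Prod.mk.injEq, auxU_eq_iff, T₁_graftZ] at h ⊢
    simp only [graftZ]
    grind

/-- The two blocks agree on `T₂`, so it survives the exchange although it is computed from the
exchanged letters. -/
lemma condIndep_xseq_T₂ (hp : ∀ s, 0 ≤ p s) (hM : IsMarkovYXZ p) :
    CondIndep (timeLaw n p) (fun ω => (ω.2 ω.1).2.2)
    (fun ω j => (ω.2 j).1) (fun ω => (c.auxU ω, c.T₂ ω.2, (ω.2 ω.1).1)) := by
  refine condIndep_of_cut hp hM (fun i j => j ≤ i) ?_ ?_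
  · intro i i' s s' h
    simp only [Prod.mk.injEq, auxU_eq_iff] at h
    grind
  · intro i s s' h hx hz
    simp only [Prod.mk.injEq, auxU_eq_iff, T₁_graftZ] at h ⊢
    rw [c.T₂_graftZ h.1.2.1]
    simp only [graftZ]
    grind

lemma condIndep_auxW (hp : ∀ s, 0 ≤ p s) (hM : IsMarkovYXZ p) :
    CondIndep (timeLaw n p) (fun ω => (ω.2 ω.1).2.2)
    c.auxW (fun ω => (c.auxU ω, c.T₂ ω.2, (ω.2 ω.1).1)) := by
  refine condIndep_of_cut hp hM (fun i j => j ≤ i) ?_ ?_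
  · intro i i' s s' h
    simp only [Prod.mk.injEq, auxU_eq_iff] at h
    grind
  · intro i s s' h hx hz
    simp only [Prod.mk.injEq, auxU_eq_iff, T₁_graftZ, auxW] at h ⊢
    rw [c.T₂_graftZ h.1.2.1, c.T₃_graftZ h.1.2.1 h.2.1]
    simp only [graftZ]
    grind

/-- The current Z is now part of the condition, so the cut stops strictly before time i. The
exchange moves what the Z-letters determine, which makes `T₂` the first variable; symmetry restores
the order. -/
lemma condIndep_T₂ (hp : ∀ s, 0 ≤ p s) (hM : IsMarkovYXZ p) :
    CondIndep (timeLaw n p) (fun ω => (ω.2 ω.1).1)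
    (fun ω => c.T₂ ω.2) (fun ω => (c.auxU ω, (ω.2 ω.1).2.2)) := by
  refine (condIndep_of_cut hp hM (fun i j => j < i) ?_ ?_).symm
  · intro i i' s s' h
    simp only [Prod.mk.injEq, auxU_eq_iff] at h
    grind
  · intro i s s' h hx hz
    simp only [Prod.mk.injEq, auxU_eq_iff, T₁_graftZ] at h ⊢
    rw [c.T₂_graftZ h.1.2.1]
    simp only [graftZ]
    grind

lemma condIndep_zseq_T₂ (hp : ∀ s, 0 ≤ p s) (hM : IsMarkovYXZ p) :
    CondIndep (timeLaw n p) (fun ω => (ω.2 ω.1).1)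
    (fun ω j => (ω.2 j).2.2) (fun ω => (c.auxU ω, c.T₂ ω.2, (ω.2 ω.1).2.2)) := by
  refine (condIndep_of_cut hp hM (fun i j => j < i) ?_ ?_).symm
  · intro i i' s s' h
    simp only [Prod.mk.injEq, auxU_eq_iff] at h
    grind
  · intro i s s' h hx hz
    simp only [Prod.mk.injEq, auxU_eq_iff, T₁_graftZ] at h ⊢
    rw [c.T₂_graftZ h.1.2.1]
    simp only [graftZ]
    grind

/-- This is why `W` contains `T₂`: the reconstruction of X may not look at V, while `T₃` is stable
under the exchange only if `T₂` is held fixed. -/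
lemma condIndep_zseq_auxW (hp : ∀ s, 0 ≤ p s) (hM : IsMarkovYXZ p) :
    CondIndep (timeLaw n p) (fun ω => (ω.2 ω.1).1)
    (fun ω j => (ω.2 j).2.2) (fun ω => (c.auxU ω, c.auxW ω, (ω.2 ω.1).2.2)) := by
  refine (condIndep_of_cut hp hM (fun i j => j < i) ?_ ?_).symm
  · intro i i' s s' h
    simp only [Prod.mk.injEq, auxU_eq_iff] at h
    grind
  · intro i s s' h hx hz
    simp only [Prod.mk.injEq, auxU_eq_iff, T₁_graftZ, auxW] at h ⊢
    rw [c.T₂_graftZ h.1.2.1, c.T₃_graftZ h.1.2.1 h.2.1.1]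
    simp only [graftZ]
    grind

/-- Condition also on all of Xⁿ. What remains is the drop of H(T₂ | T₁, Xⁿ, future of Z) when the
current Z is revealed. -/
lemma condMutualInfo_T₂_le (hn : n ≠ 0) (hp : ∀ s, 0 ≤ p s) (h1 : ∑ s, p s = 1)
    (hM : IsMarkovYXZ p) :
    condMutualInfo (timeLaw n p) (fun ω => (ω.2 ω.1).2.2) (fun ω => c.T₂ ω.2)
      (fun ω => (c.auxU ω, (ω.2 ω.1).1)) ≤ Real.logb 2 M₂ / n := by
  have h1 := abs_ent_telescope_le hn hp h1 c.T₂ (fun k s => (c.T₁ s, (fun j => (s j).1),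
    mask (fun j : Fin n => k ≤ (j : ℕ)) (fun j => (s j).2.2)))
  -- Here the letters from time `k` on are known, so the conditioning weakens as `k` grows and the
  -- increment has the opposite sign.
  rw [Fintype.card_fin, abs_sub_comm] at h1
  refine (condMutualInfo_le_of_condIndep (timeLaw_nonneg hp) (B := fun ω => c.T₂ ω.2)
    (c.condIndep_xseq hp hM)).trans (le_trans (le_of_eq ?_) ((le_abs_self _).trans h1))
  clear h1
  congr 1 <;> congr 1 <;> refine ent_congr_time ?_ ?_ ?_
  iterate 4
  · simp +contextual [auxU]
  · simp +contextual
  · intro i s s'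
    simp only [auxU_eq_iff, mask_eq_mask_iff, Prod.mk.injEq, true_and]
    simp only [funext_iff, Fin.lt_def, Fin.ext_iff]
    grind

/-- Condition also on all of Zⁿ. As `T₂` is given, `W` contributes only `T₃`, and the X-letters are
revealed one at a time. -/
lemma condMutualInfo_auxW_le (hn : n ≠ 0) (hp : ∀ s, 0 ≤ p s) (h1 : ∑ s, p s = 1)
    (hM : IsMarkovYXZ p) :
    condMutualInfo (timeLaw n p) (fun ω => (ω.2 ω.1).1) c.auxW
      (fun ω => (c.auxU ω, c.T₂ ω.2, (ω.2 ω.1).2.2)) ≤ Real.logb 2 M₃ / n := by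
  have h1 := abs_ent_telescope_le hn hp h1 c.T₃ (fun k s => (c.T₁ s, c.T₂ s,
    (fun j => (s j).2.2), mask (fun j : Fin n => (j : ℕ) < k) (fun j => (s j).1)))
  rw [Fintype.card_fin] at h1
  refine (condMutualInfo_le_of_condIndep (timeLaw_nonneg hp) (B := c.auxW)
    (c.condIndep_zseq_T₂ hp hM)).trans (le_trans (le_of_eq ?_) ((le_abs_self _).trans h1))
  clear h1
  congr 1 <;> congr 1 <;> refine ent_congr_time ?_ ?_ ?_
  iterate 4
  · simp +contextual [auxU]
  · simp +contextual
  · intro i s s'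
    simp only [auxU_eq_iff, auxW, mask_eq_mask_iff, Prod.mk.injEq, true_and]
    simp only [funext_iff, Fin.lt_def, Fin.ext_iff]
    grind

lemma sum_timeLaw_mul {S : Type*} [Fintype S] {p : S → ℝ} (F : Fin n → (Fin n → S) → ℝ) :
    ∑ ω, timeLaw n p ω * F ω.1 ω.2 =
      ∑ s : Fin n → S, (∏ i, p (s i)) * ((1 / (n : ℝ)) * ∑ i, F i s) := by
  rw [Fintype.sum_prod_type_right]
  refine Finset.sum_congr rfl fun s _ => ?_
  rw [Finset.mul_sum, Finset.mul_sum]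
  refine Finset.sum_congr rfl fun i _ => ?_
  simp only [timeLaw, blockLaw]
  ring

/-- Every code yields a point of the single-letter region. -/
theorem mem_region (hn : n ≠ 0) (hp : p ∈ stdSimplex ℝ (X × Y × Z)) (hM : IsMarkovYXZ p)
    (dx : X → Xh → ℝ) (dz : Z → Zh → ℝ) :
    (Real.logb 2 M₁ / n, Real.logb 2 M₂ / n, Real.logb 2 M₃ / n) ∈
      region p dx dz (c.distX p dx) (c.distZ p dz) := by
  have hq := timeLaw_nonneg (n := n) hp.1
  obtain ⟨s₀⟩ : Nonempty (X × Y × Z) := by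
    by_contra h
    rw [not_nonempty_iff] at h
    simpa using hp.2
  have : Nonempty X := ⟨s₀.1⟩
  have : Nonempty Z := ⟨s₀.2.2⟩
  have : Nonempty (Fin n × (Fin n → X × Y × Z)) :=
    ⟨(⟨0, Nat.pos_of_ne_zero hn⟩, fun _ => s₀)⟩
  -- At the random time each decoder outputs a function of a full side-information sequence and the
  -- auxiliary variables; all but the current letter of that sequence is discarded at no cost.
  obtain ⟨gz, hgz⟩ := (c.condIndep_xseq_T₂ hp.1 hM).exists_estimator hq dz
    (fun xs s => c.g₂ xs s.1.2.1 s.2.1 s.1.1)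
  obtain ⟨gx, hgx⟩ := (c.condIndep_zseq_auxW hp.1 hM).exists_estimator hq dx
    (fun zs s => c.g₃ zs s.1.2.1 s.2.1.2 s.1.1)
  refine singleLetter_of_condIndep hq (x := fun ω => (ω.2 ω.1).1) (y := fun ω => (ω.2 ω.1).2.1)
    (z := fun ω => (ω.2 ω.1).2.2) (law_timeLaw_letter hn hp.2) c.condIndep_y_auxU
    (c.condIndep_T₂ hp.1 hM) (c.condIndep_auxW hp.1 hM) (c.condMutualInfo_auxU_le hn hp)
    (c.condMutualInfo_T₂_le hn hp.1 hp.2 hM) (c.condMutualInfo_auxW_le hn hp.1 hp.2 hM)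
    (fun u w z => gx (u, w, z)) (fun u v x => gz (u, v, x)) (hgx.trans (le_of_eq ?_))
    (hgz.trans (le_of_eq ?_))
  · exact sum_timeLaw_mul fun i s => dx (s i).1 (c.recX s i)
  · exact sum_timeLaw_mul fun i s => dz (s i).2.2 (c.recZ s i)

end Code

lemma region_mono {p : X × Y × Z → ℝ} {dx : X → Xh → ℝ} {dz : Z → Zh → ℝ} {Dx Dz Dx' Dz' : ℝ}
    {R R' : ℝ × ℝ × ℝ} (h : R ∈ region p dx dz Dx Dz) (hR : R ≤ R') (hx : Dx ≤ Dx')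
    (hz : Dz ≤ Dz') : R' ∈ region p dx dz Dx' Dz' := by
  obtain ⟨kU, kV, kW, a, xh, zh, h1, h2, h3, h4, h5⟩ := h
  exact ⟨kU, kV, kW, a, xh, zh, h1.trans hR.1, h2.trans hR.2.1, h3.trans hR.2.2, h4.trans hx,
    h5.trans hz⟩

lemma logb_floor_div_le {R : ℝ} (hn : n ≠ 0) (h : ⌊(2 : ℝ) ^ ((n : ℝ) * R)⌋₊ ≠ 0) :
    Real.logb 2 ⌊(2 : ℝ) ^ ((n : ℝ) * R)⌋₊ / n ≤ R := by
  have hn' : (0 : ℝ) < n := by exact_mod_cast Nat.pos_of_ne_zero hn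
  rw [div_le_iff₀ hn', mul_comm R]
  have h0 : (0 : ℝ) < ⌊(2 : ℝ) ^ ((n : ℝ) * R)⌋₊ := by exact_mod_cast Nat.pos_of_ne_zero h
  have := Real.logb_le_logb_of_le one_lt_two h0 (Nat.floor_le (by positivity))
  rwa [Real.logb_rpow two_pos (by norm_num)] at this

/-- The converse: an achievable rate triple lies in the single-letter region of every larger
distortion pair. -/
theorem Achievable.mem_region {p : X × Y × Z → ℝ} (hp : p ∈ stdSimplex ℝ (X × Y × Z))
    (hM : IsMarkovYXZ p) {dx : X → Xh → ℝ} {dz : Z → Zh → ℝ} {Dx Dz : ℝ} {R : ℝ × ℝ × ℝ}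
    (h : Achievable p dx dz Dx Dz R) {ε : ℝ} (hε : 0 < ε) :
    R ∈ region p dx dz (Dx + ε) (Dz + ε) := by
  obtain ⟨N, hN⟩ := h ε hε
  -- A single code suffices; the successor makes the block length nonzero.
  obtain ⟨c, hcx, hcz⟩ := hN (N + 1) (Nat.le_succ N)
  have hn : N + 1 ≠ 0 := N.succ_ne_zero
  obtain ⟨s₀⟩ : Nonempty (X × Y × Z) := by
    by_contra h
    rw [not_nonempty_iff] at h
    simpa using hp.2
  refine region_mono (c.mem_region hn hp hM dx dz) ⟨?_, ?_, ?_⟩ hcx hcz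
  -- A message of the code inhabits `Fin M`, which rules out `M = 0`; there `logb` would have the
  -- default value 0 and the bound could fail.
  · exact logb_floor_div_le hn fun h0 => (finCongr h0 (c.T₁ fun _ => s₀)).elim0
  · exact logb_floor_div_le hn fun h0 => (finCongr h0 (c.T₂ fun _ => s₀)).elim0
  · exact logb_floor_div_le hn fun h0 => (finCongr h0 (c.T₃ fun _ => s₀)).elim0

end Converse

/-! ### Basic feasible solutions. -/

section Sparse

variable {ι κ : Type*} [Fintype ι] [Fintype κ]

/-- A feasible direction with a negative coordinate can be followed until a coordinate vanishes. -/
lemma exists_support_ssubset {t δ : ι → ℝ} (ht : ∀ i, 0 ≤ t i) (hδ : ∀ i, t i = 0 → δ i = 0)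
    (hneg : ∃ i, δ i < 0) :
    ∃ r : ℝ, 0 ≤ r ∧ (∀ i, 0 ≤ t i + r * δ i) ∧
      (Finset.univ.filter fun i => t i + r * δ i ≠ 0) ⊂ Finset.univ.filter fun i => t i ≠ 0 := by
  classical
  obtain ⟨i₀, hi₀⟩ := hneg
  -- The ratio test of the simplex method: `i` is the first coordinate to reach zero.
  obtain ⟨i, hi, hmin⟩ := (Finset.univ.filter fun i => δ i < 0).exists_min_image
    (fun i => t i / (-δ i)) ⟨i₀, by simpa using hi₀⟩
  simp only [Finset.mem_filter, Finset.mem_univ, true_and] at hi hmin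
  have hr : 0 ≤ t i / (-δ i) := div_nonneg (ht i) (by linarith)
  refine ⟨t i / (-δ i), hr, fun j => ?_, ?_⟩
  · rcases lt_or_ge (δ j) 0 with hj | hj
    · have h1 := hmin j hj
      rw [le_div_iff₀ (by linarith)] at h1
      linarith
    · have := ht j
      positivity
  · refine (Finset.ssubset_iff_of_subset fun j hj => ?_).2 ⟨i, ?_, ?_⟩
    · simp only [Finset.mem_filter, Finset.mem_univ, true_and] at hj ⊢
      intro h
      exact hj (by rw [h, hδ j h]; ring)
    · simp only [Finset.mem_filter, Finset.mem_univ, true_and]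
      exact fun h => hi.ne (hδ i h)
    · simp only [Finset.mem_filter, Finset.mem_univ, true_and, not_not]
      have := hi.ne
      field_simp
      ring

/-- A basic feasible solution: nonnegative weights can be replaced by weights on at most `|κ|`
points that keep the `|κ|` linear functionals `A k` and do not increase the functional `c`. The
functionals indexed by `κ₁` are nonnegative and see every relevant point. -/
lemma exists_sparse_weights {κ₁ : Type*} (A : κ → ι → ℝ) (c : ι → ℝ) (e : κ₁ → κ)
    (hA : ∀ k i, 0 ≤ A (e k) i) (h0 : ∀ i, (∀ k, A (e k) i = 0) → (∀ k, A k i = 0) ∧ c i = 0) :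
    ∃ t : ι → ℝ, (∀ i, 0 ≤ t i) ∧ (∀ k, ∑ i, t i * A k i = ∑ i, A k i) ∧
      ∑ i, t i * c i ≤ ∑ i, c i ∧
      (Finset.univ.filter fun i => t i ≠ 0).card ≤ Fintype.card κ := by
  classical
  -- Choose feasible weights of least support; a support larger than `|κ|` will be shrunk further.
  let P : ℕ → Prop := fun m => ∃ t : ι → ℝ, (∀ i, 0 ≤ t i) ∧
    (∀ k, ∑ i, t i * A k i = ∑ i, A k i) ∧ ∑ i, t i * c i ≤ ∑ i, c i ∧
      (Finset.univ.filter fun i => t i ≠ 0).card = m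
  have hP : ∃ m, P m := ⟨_, fun _ => 1, fun _ => zero_le_one, by simp, by simp, rfl⟩
  obtain ⟨t, ht, htA, htc, hcard⟩ := Nat.find_spec hP
  refine ⟨t, ht, htA, htc, ?_⟩
  by_contra! hlt
  set s := Finset.univ.filter fun i => t i ≠ 0 with hs
  let f : (s → ℝ) →ₗ[ℝ] (κ → ℝ) :=
    { toFun := fun d k => ∑ i : s, d i * A k i
      map_add' := fun d d' => by
        funext k
        simp [add_mul, Finset.sum_add_distrib]
      map_smul' := fun r d => by
        funext k
        simp [mul_assoc, Finset.mul_sum] }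
  -- More points than functionals: some nonzero direction on the support leaves all functionals
  -- unchanged.
  have hker : LinearMap.ker f ≠ ⊥ := LinearMap.ker_ne_bot_of_finrank_lt (by simpa using hlt)
  obtain ⟨d, hd, hd0⟩ := (Submodule.ne_bot_iff _).1 hker
  let δ : ι → ℝ := fun i => if h : i ∈ s then d ⟨i, h⟩ else 0
  have hδt : ∀ i, t i = 0 → δ i = 0 := by
    intro i hi
    have : i ∉ s := by simp [hs, hi]
    simp [δ, this]
  have hδA : ∀ k, ∑ i, δ i * A k i = 0 := by
    intro k
    have h1 : ∑ i : s, d i * A k i = 0 := congrFun (LinearMap.mem_ker.1 hd) k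
    rw [← h1, ← Finset.sum_subset (Finset.subset_univ s), ← Finset.sum_coe_sort]
    · exact Finset.sum_congr rfl fun i _ => by simp [δ]
    · intro i _ hi
      simp [δ, hi]
  have hδ0 : ∃ i, δ i ≠ 0 := by
    by_contra! h
    exact hd0 (funext fun i => by simpa [δ] using h i)
  have main : ∀ δ : ι → ℝ, (∀ i, t i = 0 → δ i = 0) → (∀ k, ∑ i, δ i * A k i = 0) →
      ∑ i, δ i * c i ≤ 0 → (∃ i, δ i < 0) → False := by
    intro δ hδt hδA hδc hneg
    obtain ⟨r, hr, hpos, hsub⟩ := exists_support_ssubset ht hδt hneg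
    refine Nat.find_min hP ?_ ⟨fun i => t i + r * δ i, hpos, fun k => ?_, ?_, rfl⟩
    · rw [← hcard]
      exact Finset.card_lt_card hsub
    · simp only [add_mul, mul_assoc, Finset.sum_add_distrib, ← Finset.mul_sum, hδA, htA]
      ring
    · simp only [add_mul, mul_assoc, Finset.sum_add_distrib, ← Finset.mul_sum]
      nlinarith
  have main' : ∀ δ : ι → ℝ, (∀ i, t i = 0 → δ i = 0) → (∀ k, ∑ i, δ i * A k i = 0) →
      ∑ i, δ i * c i ≤ 0 → (∃ i, δ i ≠ 0) → False := by
    intro δ hδt hδA hδc ⟨i₀, hi₀⟩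
    by_cases hneg : ∃ i, δ i < 0
    · exact main δ hδt hδA hδc hneg
    push Not at hneg
    -- A nonnegative direction annihilated by the nonnegative functionals lives on points that no
    -- functional sees, so it may be reversed.
    have hz : ∀ i, δ i ≠ 0 → (∀ k, A k i = 0) ∧ c i = 0 := fun i hi => h0 i fun k => by
      have := (Finset.sum_eq_zero_iff_of_nonneg fun i _ => mul_nonneg (hneg i) (hA k i)).1
        (hδA (e k)) i (Finset.mem_univ _)
      exact (mul_eq_zero.1 this).resolve_left hi
    refine main (fun i => -δ i) (fun i hi => by simp [hδt i hi]) (fun k => ?_) ?_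
      ⟨i₀, by simpa using lt_of_le_of_ne (hneg i₀) hi₀.symm⟩
    · simp [hδA]
    · refine (Finset.sum_eq_zero fun i _ => ?_).le
      by_cases hi : δ i = 0
      · simp [hi]
      · simp [(hz i hi).2]
  -- The sign of the direction is free, so `c` can be kept from increasing. Since `c` need not be
  -- preserved, it costs no extra point.
  rcases le_total (∑ i, δ i * c i) 0 with hc | hc
  · exact main' δ hδt hδA hc hδ0
  · obtain ⟨i, hi⟩ := hδ0
    exact main' (fun i => -δ i) (fun i hi => by simp [hδt i hi]) (fun k => by simp [hδA])
      (by simpa using hc) ⟨i, by simpa using hi⟩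

end Sparse

/-! ### Reweighting and restricting an alphabet. -/

section Scale

variable {Ω Ω' α β γ κ : Type*} [Fintype Ω] [Fintype Ω'] {q : Ω → ℝ}

/-- The contribution of an outcome to `H(A|C)`. -/
def entDensity (q : Ω → ℝ) (A : Ω → α) (C : Ω → γ) (ω : Ω) : ℝ :=
  -(q ω * Real.logb 2 (law q (fun ω => (A ω, C ω)) (A ω, C ω) / law q C (C ω)))

lemma law_scale (t : κ → ℝ) (A : Ω → α) (g : α → κ) (a : α) :
    law (fun ω => t (g (A ω)) * q ω) A a = t (g a) * law q A a := by
  classical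
  unfold law
  rw [Finset.mul_sum]
  refine Finset.sum_congr rfl fun ω _ => ?_
  by_cases h : A ω = a <;> simp [h]

/-- Conditional entropy is linear in a reweighting that depends on the condition only. -/
lemma condEntropy_scale [Fintype α] [Fintype γ] (t : κ → ℝ) (A : Ω → α) (C : Ω → γ)
    (g : γ → κ) : condEntropy (fun ω => t (g (C ω)) * q ω) A C =
      ∑ ω, t (g (C ω)) * entDensity q A C ω := by
  rw [condEntropy_eq_sum, ← Finset.sum_neg_distrib]
  refine Finset.sum_congr rfl fun ω _ => ?_
  rw [law_scale (q := q) t C g, law_scale (q := q) t (fun ω => (A ω, C ω)) (fun x => g x.2)]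
  unfold entDensity
  by_cases h : t (g (C ω)) = 0
  · simp [h]
  -- The weight multiplies the joint law and the law of the condition alike and cancels in the
  -- ratio; hence the linearity in `t`.
  · rw [mul_div_mul_left _ _ h]
    ring

lemma sum_entDensity [Fintype α] [Fintype γ] (A : Ω → α) (C : Ω → γ) :
    ∑ ω, entDensity q A C ω = condEntropy q A C := by
  rw [condEntropy_eq_sum, ← Finset.sum_neg_distrib]
  rfl

lemma entDensity_eq_zero {A : Ω → α} {C : Ω → γ} {ω : Ω} (h : q ω = 0) :
    entDensity q A C ω = 0 := by
  simp [entDensity, h]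

/-- Sparse reweighting of one coordinate `π` that keeps the kernel constraints `A`, the
functionals `G`, and does not increase the functional `c`. -/
lemma exists_sparse_reweighting {ι : Type*} [Fintype ι] [Fintype κ] (A : κ → ι → ℝ)
    (hA : ∀ k i, 0 ≤ A k i) (π : Ω → ι) {m : ℕ} (G : Fin m → Ω → ℝ) (c : Ω → ℝ)
    (h0 : ∀ ω, (∀ k, A k (π ω) = 0) → (∀ j, G j ω = 0) ∧ c ω = 0) :
    ∃ t : ι → ℝ, (∀ i, 0 ≤ t i) ∧ (∀ k, ∑ i, t i * A k i = ∑ i, A k i) ∧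
      (∀ j, ∑ ω, t (π ω) * G j ω = ∑ ω, G j ω) ∧ ∑ ω, t (π ω) * c ω ≤ ∑ ω, c ω ∧
      (Finset.univ.filter fun i => t i ≠ 0).card ≤ Fintype.card κ + m := by
  have hs : ∀ (G : Ω → ℝ) (t : ι → ℝ), ∑ ω, t (π ω) * G ω = ∑ i, t i * law G π i := by
    intro G t
    have := sum_mul_comp G π t
    simpa only [mul_comm] using this
  have hlaw : ∀ (G : Ω → ℝ) (i : ι), (∀ ω, π ω = i → G ω = 0) → law G π i = 0 := by
    classical
    intro G i h
    unfold law
    exact Finset.sum_eq_zero fun ω _ => by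
      by_cases hk : π ω = i
      · simp [hk, h ω hk]
      · simp [hk]
  obtain ⟨t, h1, h2, h3, h4⟩ := exists_sparse_weights (κ := κ ⊕ Fin m)
    (Sum.elim A fun j => law (G j) π) (law c π) Sum.inl (fun k i => hA k i) (fun i hi => by
      refine ⟨?_, hlaw _ _ fun ω hω => (h0 ω (hω ▸ hi)).2⟩
      rintro (k | j)
      · exact hi k
      · exact hlaw _ _ fun ω hω => (h0 ω (hω ▸ hi)).1 j)
  refine ⟨t, h1, fun k => h2 (Sum.inl k), fun j => ?_, ?_, by simpa using h4⟩
  · rw [hs]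
    exact (h2 (Sum.inr j)).trans (sum_law _ _)
  · rw [hs]
    exact h3.trans (sum_law _ _).le

/-- Letters of weight zero may be deleted: a law carried by the image of an injection has the same
expectations as its pullback. -/
lemma sum_comp_embed {q' : Ω' → ℝ} {φ : Ω' → Ω} (hφ : Function.Injective φ)
    (h : ∀ ω, q' ω = q (φ ω)) (h0 : ∀ ω, ω ∉ Set.range φ → q ω = 0) (F : Ω → ℝ) :
    ∑ ω, q' ω * F (φ ω) = ∑ ω, q ω * F ω := by
  classical
  simp_rw [h]
  rw [← Finset.sum_image (s := Finset.univ) (g := φ) (f := fun ω => q ω * F ω) hφ.injOn]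
  refine Finset.sum_subset (Finset.subset_univ _) fun ω _ hω => ?_
  rw [h0 ω (by simpa using hω), zero_mul]

lemma condMutualInfo_embed {α' β' γ' : Type*} [Fintype α] [Fintype β] [Fintype γ] [Fintype α']
    [Fintype β'] [Fintype γ'] {q' : Ω' → ℝ} (hq' : ∀ ω, 0 ≤ q' ω) {φ : Ω' → Ω}
    (hφ : Function.Injective φ) (h : ∀ ω, q' ω = q (φ ω))
    (h0 : ∀ ω, ω ∉ Set.range φ → q ω = 0)
    {A : Ω → α} {B : Ω → β} {C : Ω → γ} {A' : Ω' → α'} {B' : Ω' → β'} {C' : Ω' → γ'}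
    (hA : ∀ ω ω', A' ω' = A' ω ↔ A (φ ω') = A (φ ω))
    (hB : ∀ ω ω', B' ω' = B' ω ↔ B (φ ω') = B (φ ω))
    (hC : ∀ ω ω', C' ω' = C' ω ↔ C (φ ω') = C (φ ω)) :
    condMutualInfo q' A' B' C' = condMutualInfo q A B C := by
  rw [condMutualInfo_congr_partition hq' (A' := fun ω => A (φ ω)) (B' := fun ω => B (φ ω))
    (C' := fun ω => C (φ ω)) hA hB hC]
  exact condMutualInfo_congr_of_expect fun F =>
    sum_comp_embed hφ h h0 (fun ω => F (A ω) (B ω) (C ω))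

lemma condEntropy_congr_of_expect {q' : Ω' → ℝ} [Fintype α] [Fintype γ]
    {A : Ω → α} {C : Ω → γ} {A' : Ω' → α} {C' : Ω' → γ}
    (h : ∀ F : α → γ → ℝ, ∑ ω, q ω * F (A ω) (C ω) = ∑ ω, q' ω * F (A' ω) (C' ω)) :
    condEntropy q A C = condEntropy q' A' C' := by
  unfold condEntropy
  rw [law_congr_of_expect (A := C) (A' := C') fun F => h fun _ c => F c,
    law_congr_of_expect (A := fun ω => (A ω, C ω)) (A' := fun ω => (A' ω, C' ω))
      fun F => h fun a c => F (a, c)]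

end Scale

/-! ### Cardinality bounds for the auxiliary alphabets. -/

section Cardinality

variable {X Y Z Xh Zh : Type*} [Fintype X] [Fintype Y] [Fintype Z] {kU kV kW : ℕ}
  {p : X × Y × Z → ℝ} {dx : X → Xh → ℝ} {dz : Z → Zh → ℝ} {Dx Dz : ℝ} {R : ℝ × ℝ × ℝ}

lemma sum_support_equiv {ι : Type*} [Fintype ι] (t : ι → ℝ) (f : ι → ℝ)
    {k : ℕ} (e : Fin k ≃ (Finset.univ.filter fun i => t i ≠ 0)) :
    ∑ j, t (e j) * f (e j) = ∑ i, t i * f i := by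
  rw [e.sum_comp (fun i => t i * f i), Finset.sum_coe_sort _ (fun i => t i * f i)]
  refine Finset.sum_subset (Finset.subset_univ _) fun i _ hi => ?_
  have : t i = 0 := by simpa using hi
  simp [this]

/-- The map on outcomes induced by maps of the auxiliary alphabets. -/
def Outcome.map {X Y Z : Type*} {kU kV kW kU' kV' kW' : ℕ} (eU : Fin kU' → Fin kU)
    (eV : Fin kV' → Fin kV) (eW : Fin kW' → Fin kW) (o : Outcome X Y Z kU' kV' kW') :
    Outcome X Y Z kU kV kW :=
  (o.x, o.y, o.z, eU o.u, eV o.v, eW o.w)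

lemma Outcome.map_injective {X Y Z : Type*} {kU kV kW kU' kV' kW' : ℕ} {eU : Fin kU' → Fin kU}
    {eV : Fin kV' → Fin kV} {eW : Fin kW' → Fin kW} (hU : Function.Injective eU)
    (hV : Function.Injective eV) (hW : Function.Injective eW) :
    Function.Injective (Outcome.map (X := X) (Y := Y) (Z := Z) eU eV eW) := by
  rintro ⟨x, y, z, u, v, w⟩ ⟨x', y', z', u', v', w'⟩ h
  simpa only [Outcome.map, Outcome.x, Outcome.y, Outcome.z, Outcome.u, Outcome.v, Outcome.w,
    Prod.mk.injEq, hU.eq_iff, hV.eq_iff, hW.eq_iff] using h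

lemma singleLetter_of_embed (hp : ∀ s, 0 ≤ p s) {kU' kV' kW' : ℕ} {eU : Fin kU' → Fin kU}
    {eV : Fin kV' → Fin kV} {eW : Fin kW' → Fin kW} (hU : Function.Injective eU)
    (hV : Function.Injective eV) (hW : Function.Injective eW) (a : Aux X Y Z kU' kV' kW')
    {q : Outcome X Y Z kU kV kW → ℝ} (h : ∀ o, a.joint p o = q (o.map eU eV eW))
    (h0 : ∀ o, o ∉ Set.range (Outcome.map eU eV eW) → q o = 0)
    (xhat : Fin kU → Fin kW → Z → Xh) (zhat : Fin kU → Fin kV → X → Zh)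
    (h1 : condMutualInfo q Outcome.y Outcome.u Outcome.z ≤ R.1)
    (h2 : condMutualInfo q Outcome.z Outcome.v (fun o => (o.u, o.x)) ≤ R.2.1)
    (h3 : condMutualInfo q Outcome.x Outcome.w (fun o => (o.u, o.v, o.z)) ≤ R.2.2)
    (h4 : ∑ o, q o * dx o.x (xhat o.u o.w o.z) ≤ Dx)
    (h5 : ∑ o, q o * dz o.z (zhat o.u o.v o.x) ≤ Dz) :
    SingleLetter p dx dz Dx Dz kU' kV' kW' R := by
  have hφ := Outcome.map_injective (X := X) (Y := Y) (Z := Z) hU hV hW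
  have hq' := a.joint_nonneg hp
  have hu : ∀ o o' : Outcome X Y Z kU' kV' kW', o'.u = o.u ↔
      (o'.map eU eV eW).u = (o.map eU eV eW).u := fun o o' => hU.eq_iff.symm
  have hv : ∀ o o' : Outcome X Y Z kU' kV' kW', o'.v = o.v ↔
      (o'.map eU eV eW).v = (o.map eU eV eW).v := fun o o' => hV.eq_iff.symm
  have hw : ∀ o o' : Outcome X Y Z kU' kV' kW', o'.w = o.w ↔
      (o'.map eU eV eW).w = (o.map eU eV eW).w := fun o o' => hW.eq_iff.symm
  have hx : ∀ o o' : Outcome X Y Z kU' kV' kW', o'.x = o.x ↔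
      (o'.map eU eV eW).x = (o.map eU eV eW).x := fun o o' => Iff.rfl
  have hy : ∀ o o' : Outcome X Y Z kU' kV' kW', o'.y = o.y ↔
      (o'.map eU eV eW).y = (o.map eU eV eW).y := fun o o' => Iff.rfl
  have hz : ∀ o o' : Outcome X Y Z kU' kV' kW', o'.z = o.z ↔
      (o'.map eU eV eW).z = (o.map eU eV eW).z := fun o o' => Iff.rfl
  refine ⟨a, fun u w => xhat (eU u) (eW w), fun u v => zhat (eU u) (eV v),
    le_of_eq_of_le (condMutualInfo_embed hq' hφ h h0 hy hu hz) h1,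
    le_of_eq_of_le (condMutualInfo_embed hq' hφ h h0 hz hv fun o o' => ?_) h2,
    le_of_eq_of_le (condMutualInfo_embed hq' hφ h h0 hx hw fun o o' => ?_) h3,
    le_of_eq_of_le (sum_comp_embed hφ h h0 fun o => dx o.x (xhat o.u o.w o.z)) h4,
    le_of_eq_of_le (sum_comp_embed hφ h h0 fun o => dz o.z (zhat o.u o.v o.x)) h5⟩
  · rw [Prod.mk.injEq, Prod.mk.injEq, hu o o', hx o o']
  · rw [Prod.mk.injEq, Prod.mk.injEq, Prod.mk.injEq, Prod.mk.injEq, hu o, hv o, hz o]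

/-- Reweight the alphabet of `U` and restrict it to the support of the weights. -/
def Aux.restrictU {X Y Z : Type*} (a : Aux X Y Z kU kV kW) (t : Fin kU → ℝ) (ht : ∀ u, 0 ≤ t u)
    (h : ∀ y, ∑ u, t u * a.pU y u = 1) {k : ℕ}
    (e : Fin k ≃ (Finset.univ.filter fun i => t i ≠ 0)) : Aux X Y Z k kV kW where
  pU y j := t (e j) * a.pU y (e j)
  pV j := a.pV (e j)
  pW j := a.pW (e j)
  pU_mem y := ⟨fun _ => mul_nonneg (ht _) ((a.pU_mem y).1 _),
    (sum_support_equiv t (a.pU y) e).trans (h y)⟩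
  pV_mem _ := a.pV_mem _
  pW_mem _ := a.pW_mem _

/-- Reweight the alphabet of `V` and restrict it to the support of the weights. -/
def Aux.restrictV {X Y Z : Type*} (a : Aux X Y Z kU kV kW) (t : Fin kV → ℝ) (ht : ∀ v, 0 ≤ t v)
    (h : ∀ u z, ∑ v, t v * a.pV u z v = 1) {k : ℕ}
    (e : Fin k ≃ (Finset.univ.filter fun i => t i ≠ 0)) : Aux X Y Z kU k kW where
  pU := a.pU
  pV u z j := t (e j) * a.pV u z (e j)
  pW u j := a.pW u (e j)
  pU_mem := a.pU_mem
  pV_mem u z := ⟨fun _ => mul_nonneg (ht _) ((a.pV_mem u z).1 _),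
    (sum_support_equiv t (a.pV u z) e).trans (h u z)⟩
  pW_mem _ _ := a.pW_mem _ _

/-- Reweight the alphabet of `W` and restrict it to the support of the weights. -/
def Aux.restrictW {X Y Z : Type*} (a : Aux X Y Z kU kV kW) (t : Fin kW → ℝ) (ht : ∀ w, 0 ≤ t w)
    (h : ∀ u v x, ∑ w, t w * a.pW u v x w = 1) {k : ℕ}
    (e : Fin k ≃ (Finset.univ.filter fun i => t i ≠ 0)) : Aux X Y Z kU kV k where
  pU := a.pU
  pV := a.pV
  pW u v x j := t (e j) * a.pW u v x (e j)
  pU_mem := a.pU_mem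
  pV_mem := a.pV_mem
  pW_mem u v x := ⟨fun _ => mul_nonneg (ht _) ((a.pW_mem u v x).1 _),
    (sum_support_equiv t (a.pW u v x) e).trans (h u v x)⟩

/-- Reweight the letters of U. The `|Y|` normalizations keep the source law, hence H(Y|Z).
Quantities conditioned on U are linear in the weights: four of them are preserved, namely H(Y|U,Z),
the two other mutual informations and the X-distortion. The Z-distortion is the functional that may
only decrease. -/
lemma SingleLetter.exists_card_U_le (hp : ∀ s, 0 ≤ p s)
    (h : SingleLetter p dx dz Dx Dz kU kV kW R) :
    ∃ k ≤ Fintype.card Y + 4, SingleLetter p dx dz Dx Dz k kV kW R := by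
  obtain ⟨a, xhat, zhat, h1, h2, h3, h4, h5⟩ := h
  set q := a.joint p with hq
  obtain ⟨t, ht, htA, htG, htc, hcard⟩ := exists_sparse_reweighting (Ω := Outcome X Y Z kU kV kW)
    a.pU (fun y => (a.pU_mem y).1) Outcome.u
    ![entDensity q Outcome.y (fun o => (o.u, o.z)),
      fun o => entDensity q Outcome.z (fun o => (o.u, o.x)) o -
        entDensity q Outcome.z (fun o => (o.v, o.u, o.x)) o,
      fun o => entDensity q Outcome.x (fun o => (o.u, o.v, o.z)) o -
        entDensity q Outcome.x (fun o => (o.w, o.u, o.v, o.z)) o,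
      fun o => q o * dx o.x (xhat o.u o.w o.z)]
    (fun o => q o * dz o.z (zhat o.u o.v o.x)) (by
      intro o ho
      have h0 : q o = 0 := by simp [hq, Aux.joint, ho]
      refine ⟨fun j => ?_, by simp [h0]⟩
      fin_cases j <;> simp [entDensity_eq_zero h0, h0])
  have hone : ∀ y, ∑ u, t u * a.pU y u = 1 := fun y => (htA y).trans (a.pU_mem y).2
  let e := (Finset.univ.filter fun i => t i ≠ 0).equivFin.symm
  let a' := a.restrictU t ht hone e
  let qt : Outcome X Y Z kU kV kW → ℝ := fun o => t o.u * q o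
  have he : Function.Injective fun j => (e j : Fin kU) :=
    Subtype.val_injective.comp e.injective
  have hqφ : ∀ o, a'.joint p o = qt (o.map (fun j => (e j : Fin kU)) id id) := by
    rintro ⟨x, y, z, u, v, w⟩
    simp only [a', qt, hq, Aux.joint, Aux.restrictU, Outcome.map, Outcome.x, Outcome.y, Outcome.z,
      Outcome.u, Outcome.v, Outcome.w, id]
    ring
  have hrange : ∀ o, o ∉ Set.range (Outcome.map (fun j => (e j : Fin kU)) id id) → qt o = 0 := by
    rintro ⟨x, y, z, u, v, w⟩ ho
    by_contra hne
    have hne : t u ≠ 0 := left_ne_zero_of_mul hne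
    refine ho ⟨(x, y, z, e.symm ⟨u, by simpa using hne⟩, v, w), ?_⟩
    simp [Outcome.map, Outcome.x, Outcome.y, Outcome.z, Outcome.u, Outcome.v, Outcome.w]
  have hyz : condEntropy qt Outcome.y Outcome.z = condEntropy q Outcome.y Outcome.z := by
    refine condEntropy_congr_of_expect fun F => ?_
    rw [← sum_comp_embed (Outcome.map_injective he Function.injective_id Function.injective_id) hqφ
      hrange (fun o => F o.y o.z)]
    have e1 := a'.sum_joint_xyzu p fun _ y z _ => F y z
    have e2 := a.sum_joint_xyzu p fun _ y z _ => F y z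
    simp only [← Finset.sum_mul, ← Finset.mul_sum, (a'.pU_mem _).2, (a.pU_mem _).2] at e1 e2
    exact e1.trans e2.symm
  refine ⟨_, hcard, singleLetter_of_embed hp he Function.injective_id Function.injective_id a' hqφ
    hrange xhat zhat (le_of_eq_of_le ?_ h1) (le_of_eq_of_le ?_ h2) (le_of_eq_of_le ?_ h3)
    (le_of_eq_of_le ?_ h4) ((le_of_eq_of_le ?_ htc).trans h5)⟩
  · have := htG 0
    simp only [Matrix.cons_val_zero, sum_entDensity] at this
    rw [← condEntropy_scale t Outcome.y (fun o : Outcome X Y Z kU kV kW => (o.u, o.z)) Prod.fst]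
      at this
    unfold condMutualInfo
    rw [hyz, this]
  · have := htG 1
    simp only [Matrix.cons_val, mul_sub, Finset.sum_sub_distrib, sum_entDensity] at this
    rw [← condEntropy_scale t Outcome.z (fun o : Outcome X Y Z kU kV kW => (o.u, o.x)) Prod.fst,
      ← condEntropy_scale t Outcome.z (fun o : Outcome X Y Z kU kV kW => (o.v, o.u, o.x))
        (fun c => c.2.1)] at this
    exact this
  · have := htG 2
    simp only [Matrix.cons_val, mul_sub, Finset.sum_sub_distrib, sum_entDensity] at this
    rw [← condEntropy_scale t Outcome.x (fun o : Outcome X Y Z kU kV kW => (o.u, o.v, o.z))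
        Prod.fst,
      ← condEntropy_scale t Outcome.x (fun o : Outcome X Y Z kU kV kW => (o.w, o.u, o.v, o.z))
        (fun c => c.2.1)] at this
    exact this
  · have := htG 3
    simp only [Matrix.cons_val] at this
    simpa only [qt, mul_assoc] using this
  · simp only [qt, mul_assoc]

/-- The `|Z||U|` normalizations keep the law of (X,Y,Z,U), so I(Y;U|Z) and H(Z|U,X) need no
attention. Three functionals remain: H(Z|V,U,X), I(X;W|U,V,Z) and the X-distortion; the Z-distortion
is the objective. -/
lemma SingleLetter.exists_card_V_le (hp : ∀ s, 0 ≤ p s)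
    (h : SingleLetter p dx dz Dx Dz kU kV kW R) :
    ∃ k ≤ Fintype.card Z * kU + 3, SingleLetter p dx dz Dx Dz kU k kW R := by
  obtain ⟨a, xhat, zhat, h1, h2, h3, h4, h5⟩ := h
  set q := a.joint p with hq
  obtain ⟨t, ht, htA, htG, htc, hcard⟩ := exists_sparse_reweighting (Ω := Outcome X Y Z kU kV kW)
    (fun s : Z × Fin kU => a.pV s.2 s.1) (fun s => (a.pV_mem s.2 s.1).1) Outcome.v
    ![entDensity q Outcome.z (fun o => (o.v, o.u, o.x)),
      fun o => entDensity q Outcome.x (fun o => (o.u, o.v, o.z)) o -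
        entDensity q Outcome.x (fun o => (o.w, o.u, o.v, o.z)) o,
      fun o => q o * dx o.x (xhat o.u o.w o.z)]
    (fun o => q o * dz o.z (zhat o.u o.v o.x)) (by
      intro o ho
      have h0 : q o = 0 := by simp [hq, Aux.joint, ho (o.z, o.u)]
      refine ⟨fun j => ?_, by simp [h0]⟩
      fin_cases j <;> simp [entDensity_eq_zero h0, h0])
  rw [Fintype.card_prod, Fintype.card_fin] at hcard
  have hone : ∀ u z, ∑ v, t v * a.pV u z v = 1 :=
    fun u z => (htA (z, u)).trans (a.pV_mem u z).2
  let e := (Finset.univ.filter fun i => t i ≠ 0).equivFin.symm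
  let a' := a.restrictV t ht hone e
  let qt : Outcome X Y Z kU kV kW → ℝ := fun o => t o.v * q o
  have he : Function.Injective fun j => (e j : Fin kV) :=
    Subtype.val_injective.comp e.injective
  have hqφ : ∀ o, a'.joint p o = qt (o.map id (fun j => (e j : Fin kV)) id) := by
    rintro ⟨x, y, z, u, v, w⟩
    simp only [a', qt, hq, Aux.joint, Aux.restrictV, Outcome.map, Outcome.x, Outcome.y, Outcome.z,
      Outcome.u, Outcome.v, Outcome.w, id]
    ring
  have hrange : ∀ o, o ∉ Set.range (Outcome.map id (fun j => (e j : Fin kV)) id) → qt o = 0 := by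
    rintro ⟨x, y, z, u, v, w⟩ ho
    by_contra hne
    have hne : t v ≠ 0 := left_ne_zero_of_mul hne
    refine ho ⟨(x, y, z, u, e.symm ⟨v, by simpa using hne⟩, w), ?_⟩
    simp [Outcome.map, Outcome.x, Outcome.y, Outcome.z, Outcome.u, Outcome.v, Outcome.w]
  have hxyzu : ∀ F : X → Y → Z → Fin kU → ℝ, ∑ o, qt o * F o.x o.y o.z o.u =
      ∑ o, q o * F o.x o.y o.z o.u := by
    intro F
    rw [← sum_comp_embed (Outcome.map_injective Function.injective_id he Function.injective_id) hqφ
      hrange (fun o => F o.x o.y o.z o.u)]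
    exact (a'.sum_joint_xyzu p F).trans (a.sum_joint_xyzu p F).symm
  refine ⟨_, hcard, singleLetter_of_embed hp Function.injective_id he Function.injective_id a' hqφ
    hrange xhat zhat (le_of_eq_of_le ?_ h1) (le_of_eq_of_le ?_ h2) (le_of_eq_of_le ?_ h3)
    (le_of_eq_of_le ?_ h4) ((le_of_eq_of_le ?_ htc).trans h5)⟩
  · exact condMutualInfo_congr_of_expect fun F => hxyzu fun _ y z u => F y u z
  · have := htG 0
    simp only [Matrix.cons_val_zero, sum_entDensity] at this
    rw [← condEntropy_scale t Outcome.z (fun o : Outcome X Y Z kU kV kW => (o.v, o.u, o.x))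
      Prod.fst] at this
    unfold condMutualInfo
    rw [← this, condEntropy_congr_of_expect (q := qt) (q' := q) (A := Outcome.z) (A' := Outcome.z)
      (C := fun o => (o.u, o.x)) fun F => hxyzu fun x _ z u => F z (u, x)]
  · have := htG 1
    simp only [Matrix.cons_val, mul_sub, Finset.sum_sub_distrib, sum_entDensity] at this
    rw [← condEntropy_scale t Outcome.x (fun o : Outcome X Y Z kU kV kW => (o.u, o.v, o.z))
        (fun c => c.2.1),
      ← condEntropy_scale t Outcome.x (fun o : Outcome X Y Z kU kV kW => (o.w, o.u, o.v, o.z))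
        (fun c => c.2.2.1)] at this
    exact this
  · have := htG 2
    simp only [Matrix.cons_val] at this
    simpa only [qt, mul_assoc] using this
  · simp only [qt, mul_assoc]

/-- The `|U||V||X|` normalizations keep the law of (X,Y,Z,U,V). Only H(X|W,U,V,Z) has to be
preserved, with the X-distortion as the objective. -/
lemma SingleLetter.exists_card_W_le (hp : ∀ s, 0 ≤ p s)
    (h : SingleLetter p dx dz Dx Dz kU kV kW R) :
    ∃ k ≤ kU * kV * Fintype.card X + 1, SingleLetter p dx dz Dx Dz kU kV k R := by
  obtain ⟨a, xhat, zhat, h1, h2, h3, h4, h5⟩ := h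
  set q := a.joint p with hq
  obtain ⟨t, ht, htA, htG, htc, hcard⟩ := exists_sparse_reweighting (Ω := Outcome X Y Z kU kV kW)
    (fun s : (Fin kU × Fin kV) × X => a.pW s.1.1 s.1.2 s.2)
    (fun s => (a.pW_mem s.1.1 s.1.2 s.2).1) Outcome.w
    ![entDensity q Outcome.x (fun o => (o.w, o.u, o.v, o.z))]
    (fun o => q o * dx o.x (xhat o.u o.w o.z)) (by
      intro o ho
      have h0 : q o = 0 := by simp [hq, Aux.joint, ho ((o.u, o.v), o.x)]
      refine ⟨fun j => ?_, by simp [h0]⟩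
      fin_cases j
      simp [entDensity_eq_zero h0])
  rw [Fintype.card_prod, Fintype.card_prod, Fintype.card_fin, Fintype.card_fin] at hcard
  have hone : ∀ u v x, ∑ w, t w * a.pW u v x w = 1 :=
    fun u v x => (htA ((u, v), x)).trans (a.pW_mem u v x).2
  let e := (Finset.univ.filter fun i => t i ≠ 0).equivFin.symm
  let a' := a.restrictW t ht hone e
  let qt : Outcome X Y Z kU kV kW → ℝ := fun o => t o.w * q o
  have he : Function.Injective fun j => (e j : Fin kW) :=
    Subtype.val_injective.comp e.injective
  have hqφ : ∀ o, a'.joint p o = qt (o.map id id (fun j => (e j : Fin kW))) := by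
    rintro ⟨x, y, z, u, v, w⟩
    simp only [a', qt, hq, Aux.joint, Aux.restrictW, Outcome.map, Outcome.x, Outcome.y, Outcome.z,
      Outcome.u, Outcome.v, Outcome.w, id]
    ring
  have hrange : ∀ o, o ∉ Set.range (Outcome.map id id (fun j => (e j : Fin kW))) → qt o = 0 := by
    rintro ⟨x, y, z, u, v, w⟩ ho
    by_contra hne
    have hne : t w ≠ 0 := left_ne_zero_of_mul hne
    refine ho ⟨(x, y, z, u, v, e.symm ⟨w, by simpa using hne⟩), ?_⟩
    simp [Outcome.map, Outcome.x, Outcome.y, Outcome.z, Outcome.u, Outcome.v, Outcome.w]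
  have hall : ∀ F : X → Y → Z → Fin kU → Fin kV → ℝ, ∑ o, qt o * F o.x o.y o.z o.u o.v =
      ∑ o, q o * F o.x o.y o.z o.u o.v := by
    intro F
    rw [← sum_comp_embed (Outcome.map_injective Function.injective_id Function.injective_id he) hqφ
      hrange (fun o => F o.x o.y o.z o.u o.v)]
    have e1 := a'.sum_joint p fun x y z u v _ => F x y z u v
    have e2 := a.sum_joint p fun x y z u v _ => F x y z u v
    simp only [← Finset.sum_mul, ← Finset.mul_sum, (a'.pW_mem _ _ _).2, (a.pW_mem _ _ _).2]
      at e1 e2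
    exact e1.trans e2.symm
  refine ⟨_, hcard, singleLetter_of_embed hp Function.injective_id Function.injective_id he a' hqφ
    hrange xhat zhat (le_of_eq_of_le ?_ h1) (le_of_eq_of_le ?_ h2) (le_of_eq_of_le ?_ h3)
    ((le_of_eq_of_le ?_ htc).trans h4) (le_of_eq_of_le ?_ h5)⟩
  · exact condMutualInfo_congr_of_expect fun F => hall fun _ y z u _ => F y u z
  · exact condMutualInfo_congr_of_expect fun F => hall fun x _ z u v => F z v (u, x)
  · have := htG 0
    simp only [Matrix.cons_val_zero, sum_entDensity] at this
    rw [← condEntropy_scale t Outcome.x (fun o : Outcome X Y Z kU kV kW => (o.w, o.u, o.v, o.z))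
      Prod.fst] at this
    unfold condMutualInfo
    rw [← this, condEntropy_congr_of_expect (q := qt) (q' := q) (A := Outcome.x) (A' := Outcome.x)
      (C := fun o => (o.u, o.v, o.z)) fun F => hall fun x _ z u v => F x (u, v, z)]
  · simp only [qt, mul_assoc]
  · exact hall fun x _ z u v => dz z (zhat u v x)

/-- The cardinality bounds. -/
theorem region_subset_boundedRegion (hp : ∀ s, 0 ≤ p s) :
    region p dx dz Dx Dz ⊆ boundedRegion p dx dz Dx Dz := by
  rintro R ⟨kU, kV, kW, h⟩
  -- The order matters: the bound for V refers to the reduced U, and the bound for W to both reduced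
  -- alphabets.
  obtain ⟨kU', hU, h⟩ := h.exists_card_U_le hp
  obtain ⟨kV', hV, h⟩ := h.exists_card_V_le hp
  obtain ⟨kW', hW, h⟩ := h.exists_card_W_le hp
  exact ⟨kU', kV', kW', hU, hV, hW, h⟩

end Cardinality

/-! ### Closedness of the bounded region and the converse. -/

section Closed

/-- As a sum of t ↦ -t log t, entropy is visibly continuous in the law, also where probabilities
vanish. -/
lemma ent_eq_sum_negMulLog {Ω α : Type*} [Fintype Ω] [Fintype α] (q : Ω → ℝ) (A : Ω → α) :
    ent q A = (∑ a, Real.negMulLog (law q A a)) / Real.log 2 := by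
  unfold ent
  rw [sum_mul_comp q A (fun a => Real.logb 2 (law q A a)), Finset.sum_div,
    ← Finset.sum_neg_distrib]
  refine Finset.sum_congr rfl fun a _ => ?_
  simp only [Real.negMulLog, Real.logb]
  ring

variable {𝒯 Ω α β γ : Type*} [TopologicalSpace 𝒯] [Fintype Ω] {q : 𝒯 → Ω → ℝ}

lemma continuous_law (hc : Continuous q) (A : Ω → α) (a : α) :
    Continuous fun τ => law (q τ) A a := by
  unfold law
  refine continuous_finsetSum _ fun ω _ => ?_
  split_ifs
  · exact (continuous_apply ω).comp hc
  · exact continuous_const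

lemma continuous_ent [Fintype α] (hc : Continuous q) (A : Ω → α) :
    Continuous fun τ => ent (q τ) A := by
  simp_rw [ent_eq_sum_negMulLog]
  exact (continuous_finsetSum _ fun a _ =>
    Real.continuous_negMulLog.comp (continuous_law hc A a)).div_const _

lemma continuous_condMutualInfo [Fintype α] [Fintype β] [Fintype γ] (hc : Continuous q)
    (hq : ∀ τ ω, 0 ≤ q τ ω) (A : Ω → α) (B : Ω → β) (C : Ω → γ) :
    Continuous fun τ => condMutualInfo (q τ) A B C := by
  simp_rw [fun τ => condMutualInfo_eq_ent (hq τ) A B C]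
  exact (((continuous_ent hc _).sub (continuous_ent hc _)).sub (continuous_ent hc _)).add
    (continuous_ent hc _)

variable {X Y Z Xh Zh : Type*}

/-- The space of conditional laws of the auxiliary variables. -/
def auxSet (X Y Z : Type*) (kU kV kW : ℕ) :
    Set ((Y → Fin kU → ℝ) × (Fin kU → Z → Fin kV → ℝ) × (Fin kU → Fin kV → X → Fin kW → ℝ)) :=
  (Set.univ.pi fun _ => stdSimplex ℝ (Fin kU)) ×ˢ
    (Set.univ.pi fun _ => Set.univ.pi fun _ => stdSimplex ℝ (Fin kV)) ×ˢ
    (Set.univ.pi fun _ => Set.univ.pi fun _ => Set.univ.pi fun _ => stdSimplex ℝ (Fin kW))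

lemma isCompact_auxSet (X Y Z : Type*) (kU kV kW : ℕ) : IsCompact (auxSet X Y Z kU kV kW) :=
  (isCompact_univ_pi fun _ => isCompact_stdSimplex ℝ _).prod
    ((isCompact_univ_pi fun _ => isCompact_univ_pi fun _ => isCompact_stdSimplex ℝ _).prod
      (isCompact_univ_pi fun _ => isCompact_univ_pi fun _ => isCompact_univ_pi fun _ =>
        isCompact_stdSimplex ℝ _))

/-- The auxiliary variables with the given conditional laws. -/
def auxOf {kU kV kW : ℕ} (f : auxSet X Y Z kU kV kW) : Aux X Y Z kU kV kW where
  pU := f.1.1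
  pV := f.1.2.1
  pW := f.1.2.2
  pU_mem y := f.2.1 y trivial
  pV_mem u z := f.2.2.1 u trivial z trivial
  pW_mem u v x := f.2.2.2 u trivial v trivial x trivial

lemma exists_auxOf_eq {kU kV kW : ℕ} (a : Aux X Y Z kU kV kW) : ∃ f, auxOf f = a :=
  ⟨⟨(a.pU, a.pV, a.pW), fun _ _ => a.pU_mem _, fun _ _ _ _ => a.pV_mem _ _,
    fun _ _ _ _ _ _ => a.pW_mem _ _ _⟩, rfl⟩

lemma continuous_joint_auxOf {kU kV kW : ℕ} (p : X × Y × Z → ℝ) :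
    Continuous fun f : auxSet X Y Z kU kV kW => (auxOf f).joint p := by
  refine continuous_pi fun o => ?_
  simp only [Aux.joint, auxOf]
  fun_prop

variable [Fintype X] [Fintype Y] [Fintype Z] [Finite Xh] [Finite Zh]

/-- For each of the finitely many pairs of reconstructions, the constraints are closed in kernels,
distortions and rates jointly. Projecting out the compact space of kernels keeps this, and the union
is finite. -/
lemma isClosed_singleLetter {p : X × Y × Z → ℝ} (hp : ∀ s, 0 ≤ p s) (dx : X → Xh → ℝ)
    (dz : Z → Zh → ℝ) (kU kV kW : ℕ) :
    IsClosed {r : ℝ × ℝ × ℝ × ℝ × ℝ | SingleLetter p dx dz r.1 r.2.1 kU kV kW r.2.2} := by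
  have : CompactSpace (auxSet X Y Z kU kV kW) :=
    isCompact_iff_compactSpace.1 (isCompact_auxSet X Y Z kU kV kW)
  have hc := continuous_joint_auxOf (kU := kU) (kV := kV) (kW := kW) p
  have hq : ∀ (f : auxSet X Y Z kU kV kW) o, 0 ≤ (auxOf f).joint p o :=
    fun f => (auxOf f).joint_nonneg hp
  let S : (Fin kU → Fin kW → Z → Xh) × (Fin kU → Fin kV → X → Zh) →
      Set (auxSet X Y Z kU kV kW × (ℝ × ℝ × ℝ × ℝ × ℝ)) := fun g =>
    {r | condMutualInfo ((auxOf r.1).joint p) Outcome.y Outcome.u Outcome.z ≤ r.2.2.2.1 ∧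
      condMutualInfo ((auxOf r.1).joint p) Outcome.z Outcome.v (fun o => (o.u, o.x)) ≤
        r.2.2.2.2.1 ∧
      condMutualInfo ((auxOf r.1).joint p) Outcome.x Outcome.w (fun o => (o.u, o.v, o.z)) ≤
        r.2.2.2.2.2 ∧
      ∑ o, (auxOf r.1).joint p o * dx o.x (g.1 o.u o.w o.z) ≤ r.2.1 ∧
      ∑ o, (auxOf r.1).joint p o * dz o.z (g.2 o.u o.v o.x) ≤ r.2.2.1}
  have hS : ∀ g, IsClosed (S g) := by
    intro g
    have hsum : ∀ d : Outcome X Y Z kU kV kW → ℝ, Continuous fun f : auxSet X Y Z kU kV kW =>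
        ∑ o, (auxOf f).joint p o * d o := fun d =>
      continuous_finsetSum _ fun o _ => ((continuous_apply o).comp hc).mul continuous_const
    refine (isClosed_le ((continuous_condMutualInfo hc hq _ _ _).comp continuous_fst)
      (by fun_prop)).inter ((isClosed_le ((continuous_condMutualInfo hc hq _ _ _).comp
      continuous_fst) (by fun_prop)).inter ((isClosed_le ((continuous_condMutualInfo hc hq _ _
      _).comp continuous_fst) (by fun_prop)).inter ((isClosed_le ((hsum _).comp continuous_fst)
      (by fun_prop)).inter (isClosed_le ((hsum _).comp continuous_fst) (by fun_prop)))))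
  have : {r : ℝ × ℝ × ℝ × ℝ × ℝ | SingleLetter p dx dz r.1 r.2.1 kU kV kW r.2.2} =
      ⋃ g, Prod.snd '' S g := by
    ext r
    simp only [Set.mem_ofPred_eq, Set.mem_iUnion, Set.mem_image]
    constructor
    · rintro ⟨a, xhat, zhat, h⟩
      obtain ⟨f, rfl⟩ := exists_auxOf_eq a
      exact ⟨(xhat, zhat), (f, r), h, rfl⟩
    · rintro ⟨g, ⟨f, r⟩, h, rfl⟩
      exact ⟨auxOf f, g.1, g.2, h⟩
  rw [this]
  exact isClosed_iUnion_of_finite fun g => isClosedMap_snd_of_compactSpace _ (hS g)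

/-- Here the cardinality bounds are indispensable: they leave only finitely many alphabet sizes, so
the union stays closed. -/
lemma isClosed_boundedRegion {p : X × Y × Z → ℝ} (hp : ∀ s, 0 ≤ p s) (dx : X → Xh → ℝ)
    (dz : Z → Zh → ℝ) :
    IsClosed {r : ℝ × ℝ × ℝ × ℝ × ℝ | r.2.2 ∈ boundedRegion p dx dz r.1 r.2.1} := by
  let T : Set (ℕ × ℕ × ℕ) := {k | k.1 ≤ Fintype.card Y + 4 ∧ k.2.1 ≤ Fintype.card Z * k.1 + 3 ∧
    k.2.2 ≤ k.1 * k.2.1 * Fintype.card X + 1}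
  have hT : T.Finite := by
    refine Set.Finite.subset (s := Set.Iic (Fintype.card Y + 4) ×ˢ
      Set.Iic (Fintype.card Z * (Fintype.card Y + 4) + 3) ×ˢ
      Set.Iic ((Fintype.card Y + 4) * (Fintype.card Z * (Fintype.card Y + 4) + 3) *
        Fintype.card X + 1))
      ((Set.finite_Iic _).prod ((Set.finite_Iic _).prod (Set.finite_Iic _))) ?_
    rintro ⟨a, b, c⟩ ⟨h1, h2, h3⟩
    simp only at h1 h2 h3
    have h4 : b ≤ Fintype.card Z * (Fintype.card Y + 4) + 3 := h2.trans (by gcongr)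
    exact ⟨h1, h4, h3.trans (by gcongr)⟩
  have : {r : ℝ × ℝ × ℝ × ℝ × ℝ | r.2.2 ∈ boundedRegion p dx dz r.1 r.2.1} =
      ⋃ k ∈ T, {r | SingleLetter p dx dz r.1 r.2.1 k.1 k.2.1 k.2.2 r.2.2} := by
    ext r
    simp only [boundedRegion, Set.mem_ofPred_eq, Set.mem_iUnion, T]
    constructor
    · rintro ⟨a, b, c, h1, h2, h3, h⟩
      exact ⟨(a, b, c), ⟨h1, h2, h3⟩, h⟩
    · rintro ⟨⟨a, b, c⟩, ⟨h1, h2, h3⟩, h⟩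
      exact ⟨a, b, c, h1, h2, h3, h⟩
  rw [this]
  exact hT.isClosed_biUnion fun k _ => isClosed_singleLetter hp dx dz _ _ _

/-- The converse part of the coding theorem, with the cardinality bounds. -/
theorem operationalRegion_subset {p : X × Y × Z → ℝ} (hp : p ∈ stdSimplex ℝ (X × Y × Z))
    (hM : IsMarkovYXZ p) (dx : X → Xh → ℝ) (dz : Z → Zh → ℝ) (Dx Dz : ℝ) :
    operationalRegion p dx dz Dx Dz ⊆ boundedRegion p dx dz Dx Dz := by
  have hcl := isClosed_boundedRegion hp.1 dx dz
  have hA : {R | Achievable p dx dz Dx Dz R} ⊆ boundedRegion p dx dz Dx Dz := by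
    intro R hR
    -- The rates stay fixed while the slack in the distortions tends to 0.
    have hlim : Filter.Tendsto (fun ε : ℝ => (Dx + ε, Dz + ε, R)) (nhdsWithin 0 (Set.Ioi 0))
        (nhds (Dx, Dz, R)) := by
      have : Continuous fun ε : ℝ => (Dx + ε, Dz + ε, R) := by fun_prop
      have h := this.tendsto 0
      simp only [add_zero] at h
      exact h.mono_left nhdsWithin_le_nhds
    exact hcl.mem_of_tendsto hlim (Filter.eventually_of_mem self_mem_nhdsWithin fun ε hε =>
      region_subset_boundedRegion hp.1 (hR.mem_region hp hM hε))
  refine closure_minimal hA ?_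
  have : Continuous fun R : ℝ × ℝ × ℝ => (Dx, Dz, R) := by fun_prop
  exact hcl.preimage this

end Closed

/-! ### Races of exponential clocks. -/

section Race

open MeasureTheory ProbabilityTheory

lemma expMeasure_Ioi {a : ℝ} (ha : 0 ≤ a) :
    expMeasure 1 (Set.Ioi a) = ENNReal.ofReal (Real.exp (-a)) := by
  have := isProbabilityMeasure_expMeasure one_pos
  have h := cdf_expMeasure_eq one_pos a
  rw [cdf_eq_real, if_pos ha, one_mul] at h
  rw [← Set.compl_Iic, prob_compl_eq_one_sub measurableSet_Iic, ← ofReal_measureReal, h,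
    ← ENNReal.ofReal_one, ← ENNReal.ofReal_sub _ (by simp [ha])]
  simp

/-- The integrand times the density of rate 1 is `1 / (1 + S)` times the density of rate `1 + S`.
The indicator discards negative times, which carry no mass. -/
lemma lintegral_exp_expMeasure {S : ℝ} (hS : 0 ≤ S) :
    ∫⁻ t, (Set.Ici 0).indicator (fun t => ENNReal.ofReal (Real.exp (-(S * t)))) t ∂(expMeasure 1) =
      ENNReal.ofReal (1 / (1 + S)) := by
  have hm : Measurable (exponentialPDF 1) := (measurable_exponentialPDFReal 1).ennreal_ofReal
  have hS' : 0 < 1 + S := by linarith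
  change ∫⁻ t, _ ∂(volume.withDensity (exponentialPDF 1)) = _
  rw [lintegral_withDensity_eq_lintegral_mul _ hm (by
    refine Measurable.indicator (by fun_prop) measurableSet_Ici)]
  have : ∀ t, (exponentialPDF 1 * (Set.Ici 0).indicator
      (fun t => ENNReal.ofReal (Real.exp (-(S * t))))) t =
      ENNReal.ofReal (1 / (1 + S)) * exponentialPDF (1 + S) t := by
    intro t
    simp only [Pi.mul_apply, exponentialPDF_eq]
    by_cases ht : 0 ≤ t
    · rw [Set.indicator_of_mem (Set.mem_Ici.2 ht), if_pos ht, if_pos ht,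
        ← ENNReal.ofReal_mul (by positivity), ← ENNReal.ofReal_mul (by positivity)]
      congr 1
      rw [mul_assoc, ← Real.exp_add]
      field_simp
      congr 1
      ring
    · rw [Set.indicator_of_notMem (by simpa using ht), if_neg ht, if_neg ht]
      simp
  simp_rw [this]
  have hm' : Measurable (exponentialPDF (1 + S)) :=
    (measurable_exponentialPDFReal _).ennreal_ofReal
  rw [lintegral_const_mul _ hm',
    lintegral_exponentialPDF_eq_one hS', mul_one]

variable {ι : Type*} [Fintype ι]

/-- Condition on the clock of `i` showing t: the others independently exceed `r j * t` with
probability exp(-r_j t). Then average over t. -/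
lemma pi_expMeasure_race (i : ι) {r : ι → ℝ} (hr : ∀ j, 0 ≤ r j) [DecidableEq ι] :
    Measure.pi (fun _ : ι => expMeasure 1) {T | 0 ≤ T i ∧ ∀ j, j ≠ i → r j * T i < T j} =
      ENNReal.ofReal (1 / (1 + ∑ j ∈ Finset.univ.erase i, r j)) := by
  have := isProbabilityMeasure_expMeasure one_pos
  let s : Set (({j // j = i} → ℝ) × ({j // ¬ j = i} → ℝ)) :=
    {x | 0 ≤ x.1 ⟨i, rfl⟩ ∧ ∀ j : {j // ¬ j = i}, r j * x.1 ⟨i, rfl⟩ < x.2 j}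
  have hs : MeasurableSet s := by
    have h1 : MeasurableSet {x : ({j // j = i} → ℝ) × ({j // ¬ j = i} → ℝ) | 0 ≤ x.1 ⟨i, rfl⟩} :=
      measurableSet_le (by fun_prop) (by fun_prop)
    have h2 : MeasurableSet (⋂ j : {j // ¬ j = i},
        {x : ({j // j = i} → ℝ) × ({j // ¬ j = i} → ℝ) | r j * x.1 ⟨i, rfl⟩ < x.2 j}) :=
      MeasurableSet.iInter fun j => measurableSet_lt (by fun_prop) (by fun_prop)
    convert h1.inter h2 using 1
    ext x
    simp [s]
  have hpre : {T : ι → ℝ | 0 ≤ T i ∧ ∀ j, j ≠ i → r j * T i < T j} =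
      MeasurableEquiv.piEquivPiSubtypeProd (fun _ : ι => ℝ) (· = i) ⁻¹' s := by
    ext T
    simp [s, MeasurableEquiv.piEquivPiSubtypeProd, Equiv.piEquivPiSubtypeProd]
  rw [hpre, (measurePreserving_piEquivPiSubtypeProd (fun _ : ι => expMeasure 1)
    (· = i)).measure_preimage hs.nullMeasurableSet, Measure.prod_apply hs]
  have hsec : ∀ x : {j // j = i} → ℝ,
      Measure.pi (fun _ : {j // ¬ j = i} => expMeasure 1) (Prod.mk x ⁻¹' s) =
      (Set.Ici 0).indicator (fun t => ENNReal.ofReal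
        (Real.exp (-((∑ j ∈ Finset.univ.erase i, r j) * t)))) (x ⟨i, rfl⟩) := by
    intro x
    by_cases hx : 0 ≤ x ⟨i, rfl⟩
    · have : Prod.mk x ⁻¹' s = Set.univ.pi fun j : {j // ¬ j = i} =>
          Set.Ioi (r j * x ⟨i, rfl⟩) := by
        ext y
        simp [s, hx]
      rw [this, Measure.pi_pi, Set.indicator_of_mem (Set.mem_Ici.2 hx)]
      simp_rw [fun j => expMeasure_Ioi (mul_nonneg (hr j) hx)]
      rw [← ENNReal.ofReal_prod_of_nonneg (fun _ _ => (Real.exp_pos _).le), ← Real.exp_sum,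
        Finset.sum_neg_distrib, ← Finset.sum_mul]
      rw [Finset.sum_subtype (Finset.univ.erase i) (p := fun j => ¬ j = i) (by simp) r]
    · have : Prod.mk x ⁻¹' s = ∅ := by
        ext y
        simp [s, hx]
      rw [this, Set.indicator_of_notMem (by simpa using hx), measure_empty]
  simp_rw [hsec]
  rw [← lintegral_exp_expMeasure (Finset.sum_nonneg fun j _ => hr j)]
  have hmeas : Measurable ((Set.Ici (0 : ℝ)).indicator fun t => ENNReal.ofReal
      (Real.exp (-((∑ j ∈ Finset.univ.erase i, r j) * t)))) :=
    Measurable.indicator (by fun_prop) measurableSet_Ici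
  convert (measurePreserving_eval (fun _ : {j // j = i} => expMeasure 1) ⟨i, rfl⟩).lintegral_comp
    hmeas

/-- `i` wins the race with speeds `P` and clocks `T`. -/
def Wins {ι : Type*} (P : ι → ℝ) (T : ι → ℝ) (i : ι) : Prop := ∀ j, j ≠ i → P j * T i < P i * T j

/-- A winner has the strictly smallest ratio of clock to speed. The cross-multiplied form also makes
sense for speed zero. -/
lemma Wins.unique {ι : Type*} {P T : ι → ℝ} {i j : ι} (hi : Wins P T i) (hj : Wins P T j) : i = j := by
  by_contra h
  have h1 := hi j (Ne.symm h)
  have h2 := hj i h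
  linarith

/-- The matching lemma: `i` wins three races with common exponential clocks with probability at
least `1 / (1 / P i + 1 / Q i + 1 / Q' i)`. -/
lemma exists_measurableSet_wins {P Q Q' : ι → ℝ} (hP : ∀ j, 0 ≤ P j) (hQ : ∀ j, 0 ≤ Q j)
    (hQ' : ∀ j, 0 ≤ Q' j) (sP : ∑ j, P j ≤ 1) (sQ : ∑ j, Q j ≤ 1) (sQ' : ∑ j, Q' j ≤ 1) {i : ι}
    (pP : 0 < P i) (pQ : 0 < Q i) (pQ' : 0 < Q' i) :
    ∃ E : Set (ι → ℝ), (∀ T ∈ E, Wins P T i ∧ Wins Q T i ∧ Wins Q' T i) ∧ MeasurableSet E ∧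
      1 / (1 / P i + 1 / Q i + 1 / Q' i) ≤ (Measure.pi fun _ : ι => expMeasure 1).real E := by
  classical
  -- The sum dominates each of the three ratios, so one race with these thresholds implies all three
  -- victories.
  set r : ι → ℝ := fun j => P j / P i + Q j / Q i + Q' j / Q' i with hr
  have hr0 : ∀ j, 0 ≤ r j := fun j =>
    add_nonneg (add_nonneg (div_nonneg (hP j) pP.le) (div_nonneg (hQ j) pQ.le))
      (div_nonneg (hQ' j) pQ'.le)
  have hw : ∀ (P : ι → ℝ) (T : ι → ℝ), 0 < P i → (∀ j, P j / P i ≤ r j) → 0 ≤ T i →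
      (∀ j, j ≠ i → r j * T i < T j) → Wins P T i := by
    intro P T pP hPr hT h j hj
    have h1 := (mul_le_mul_of_nonneg_right (hPr j) hT).trans_lt (h j hj)
    rw [div_mul_eq_mul_div, div_lt_iff₀ pP] at h1
    linarith
  refine ⟨{T | 0 ≤ T i ∧ ∀ j, j ≠ i → r j * T i < T j}, fun T hT => ⟨?_, ?_, ?_⟩, ?_, ?_⟩
  · refine hw P T pP (fun j => ?_) hT.1 hT.2
    have := div_nonneg (hQ j) pQ.le
    have := div_nonneg (hQ' j) pQ'.le
    simp only [hr]
    linarith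
  · refine hw Q T pQ (fun j => ?_) hT.1 hT.2
    have := div_nonneg (hP j) pP.le
    have := div_nonneg (hQ' j) pQ'.le
    simp only [hr]
    linarith
  · refine hw Q' T pQ' (fun j => ?_) hT.1 hT.2
    have := div_nonneg (hP j) pP.le
    have := div_nonneg (hQ j) pQ.le
    simp only [hr]
    linarith
  · have h1 : MeasurableSet {T : ι → ℝ | 0 ≤ T i} := measurableSet_le (by fun_prop) (by fun_prop)
    have h2 : MeasurableSet (⋂ (j : ι) (_ : j ≠ i), {T : ι → ℝ | r j * T i < T j}) :=
      MeasurableSet.iInter fun j => MeasurableSet.iInter fun _ =>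
        measurableSet_lt (by fun_prop) (by fun_prop)
    convert h1.inter h2 using 1
    ext x
    simp
  · have hS : 0 ≤ ∑ j ∈ Finset.univ.erase i, r j := Finset.sum_nonneg fun j _ => hr0 j
    rw [measureReal_def, pi_expMeasure_race i hr0, ENNReal.toReal_ofReal (by positivity)]
    refine one_div_le_one_div_of_le (by positivity) ?_
    -- The index `i` itself accounts for 3 in the full sum, which more than pays for the 1 in the
    -- denominator.
    have h1 : ∑ j, r j = (∑ j, P j) / P i + (∑ j, Q j) / Q i + (∑ j, Q' j) / Q' i := by
      simp only [hr, Finset.sum_add_distrib, Finset.sum_div]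
    have h2 := Finset.add_sum_erase Finset.univ r (Finset.mem_univ i)
    have h3 : r i = 3 := by
      simp only [hr, div_self pP.ne', div_self pQ.ne', div_self pQ'.ne']
      norm_num
    have h4 : (∑ j, P j) / P i ≤ 1 / P i := by gcongr
    have h5 : (∑ j, Q j) / Q i ≤ 1 / Q i := by gcongr
    have h6 : (∑ j, Q' j) / Q' i ≤ 1 / Q' i := by gcongr
    linarith

/-- Derandomization: some realization does at least as well as the average. -/
lemma exists_sum_indicator_ge {Ω κ : Type*} [MeasurableSpace Ω] [Fintype κ] (μ : Measure Ω)
    [IsProbabilityMeasure μ] (E : κ → Set Ω) (hE : ∀ k, MeasurableSet (E k)) (c : κ → ℝ) :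
    ∃ ω, ∑ k, c k * μ.real (E k) ≤ ∑ k, c k * (E k).indicator 1 ω := by
  have hInteg : ∀ k, Integrable (fun ω => c k * (E k).indicator (1 : Ω → ℝ) ω) μ := fun k =>
    ((integrable_const (1 : ℝ)).indicator (hE k)).const_mul _
  obtain ⟨ω, hω⟩ := exists_integral_le (μ := μ) (integrable_finsetSum Finset.univ fun k _ => hInteg k)
  refine ⟨ω, le_of_eq_of_le ?_ hω⟩
  rw [integral_finsetSum _ fun k _ => hInteg k]
  refine Finset.sum_congr rfl fun k _ => ?_
  rw [integral_const_mul, integral_indicator_one (hE k)]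

end Race

/-! ### One-shot coding with shared clocks. -/

section OneShot

open MeasureTheory ProbabilityTheory

/-- Nonnegative weights of total mass at most one. -/
def SubProb {ι : Type*} [Fintype ι] (f : ι → ℝ) : Prop := (∀ i, 0 ≤ f i) ∧ ∑ i, f i ≤ 1

/-- The encoder's weights on pairs of a codeword and a message. -/
def encRate {𝒰 : Type*} {M : ℕ} (K : 𝒰 → ℝ) (x : 𝒰 × Fin M) : ℝ := K x.1 / M

/-- The decoder's weights on pairs of a codeword and a message, given the message. -/
def decRate {𝒰 : Type*} {M : ℕ} (Q : 𝒰 → ℝ) (m : Fin M) (x : 𝒰 × Fin M) : ℝ :=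
  if x.2 = m then Q x.1 else 0

lemma SubProb.encRate {𝒰 : Type*} [Fintype 𝒰] {M : ℕ} {K : 𝒰 → ℝ} (hK : SubProb K)
    (hM : 0 < M) : SubProb (encRate (M := M) K) := by
  have hM' : (0 : ℝ) < M := by exact_mod_cast hM
  refine ⟨fun x => div_nonneg (hK.1 _) hM'.le, ?_⟩
  rw [Fintype.sum_prod_type]
  simp only [TwoWay.encRate, Finset.sum_const, Finset.card_univ, Fintype.card_fin, nsmul_eq_mul]
  simp_rw [mul_div_cancel₀ _ hM'.ne']
  exact hK.2

lemma SubProb.decRate {𝒰 : Type*} [Fintype 𝒰] {M : ℕ} {Q : 𝒰 → ℝ} (hQ : SubProb Q)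
    (m : Fin M) : SubProb (decRate Q m) := by
  refine ⟨fun x => ?_, ?_⟩
  · unfold TwoWay.decRate
    split_ifs
    · exact hQ.1 _
    · exact le_rfl
  · rw [Fintype.sum_prod_type]
    simpa [TwoWay.decRate] using hQ.2

/-- The event that an encoder and two decoders agree on the codeword `u` and the message `m`. -/
lemma exists_measurableSet_agree {𝒰 : Type*} [Fintype 𝒰] {M : ℕ} {K Q Q' : 𝒰 → ℝ}
    (hK : SubProb K) (hQ : SubProb Q) (hQ' : SubProb Q') (hM : 0 < M) (u : 𝒰) (m : Fin M)
    (pK : 0 < K u) (pQ : 0 < Q u) (pQ' : 0 < Q' u) :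
    ∃ E : Set (𝒰 × Fin M → ℝ), (∀ T ∈ E, Wins (encRate K) T (u, m) ∧
      Wins (decRate Q m) T (u, m) ∧ Wins (decRate Q' m) T (u, m)) ∧ MeasurableSet E ∧
      K u / (1 + K u / (M * Q u) + K u / (M * Q' u)) / M ≤
        (Measure.pi fun _ : 𝒰 × Fin M => expMeasure 1).real E := by
  have hM' : (0 : ℝ) < M := by exact_mod_cast hM
  obtain ⟨E, h1, h2, h3⟩ := exists_measurableSet_wins (hK.encRate hM).1 (hQ.decRate m).1
    (hQ'.decRate m).1 (hK.encRate hM).2 (hQ.decRate m).2 (hQ'.decRate m).2 (i := (u, m))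
    (by unfold encRate; positivity) (by simpa [decRate] using pQ) (by simpa [decRate] using pQ')
  -- The reciprocal bound for speeds K/M, Q, Q' is rewritten as the conditional probability K, times
  -- a penalty factor, times 1/M.
  refine ⟨E, h1, h2, le_of_eq_of_le ?_ h3⟩
  simp only [encRate, decRate, if_true]
  field_simp

/-- The clocks make every encoder and decoder agree on the outcome `o` above the source value `s`. -/
def Agree {O 𝒮 𝒰 𝒱 𝒲 : Type*} {M₁ M₂ M₃ : ℕ} (σ : O → 𝒮) (U : O → 𝒰) (V : O → 𝒱) (W : O → 𝒲)
    (K₁ Qz Qx : 𝒮 → 𝒰 → ℝ) (K₂ Q₂ : 𝒮 → 𝒰 → 𝒱 → ℝ) (K₃ Q₃ : 𝒮 → 𝒰 → 𝒱 → 𝒲 → ℝ)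
    (T₁ : 𝒰 × Fin M₁ → ℝ) (T₂ : 𝒱 × Fin M₂ → ℝ) (T₃ : 𝒲 × Fin M₃ → ℝ) (s : 𝒮)
    (o : O) (m₁ : Fin M₁) (m₂ : Fin M₂) (m₃ : Fin M₃) : Prop :=
  σ o = s ∧
    (Wins (encRate (K₁ s)) T₁ (U o, m₁) ∧ Wins (decRate (Qz s) m₁) T₁ (U o, m₁) ∧
      Wins (decRate (Qx s) m₁) T₁ (U o, m₁)) ∧
    (Wins (encRate (K₂ s (U o))) T₂ (V o, m₂) ∧ Wins (decRate (Q₂ s (U o)) m₂) T₂ (V o, m₂)) ∧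
    (Wins (encRate (K₃ s (U o) (V o))) T₃ (W o, m₃) ∧
      Wins (decRate (Q₃ s (U o) (V o)) m₃) T₃ (W o, m₃))

open Classical in
/-- One-shot coding: for suitable clocks the probability that all encoders and decoders agree on an
outcome in `G` is at least the average over the exponential clocks. -/
theorem exists_clocks {O 𝒮 𝒰 𝒱 𝒲 : Type*} [Fintype O] [Fintype 𝒮] [Fintype 𝒰] [Fintype 𝒱]
    [Fintype 𝒲] {M₁ M₂ M₃ : ℕ} (hM₁ : 0 < M₁) (hM₂ : 0 < M₂) (hM₃ : 0 < M₃)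
    (σ : O → 𝒮) (U : O → 𝒰) (V : O → 𝒱) (W : O → 𝒲)
    (hinj : ∀ o o', σ o = σ o' → U o = U o' → V o = V o' → W o = W o' → o = o')
    {P : 𝒮 → ℝ} (hP : ∀ s, 0 ≤ P s)
    {K₁ Qz Qx : 𝒮 → 𝒰 → ℝ} {K₂ Q₂ : 𝒮 → 𝒰 → 𝒱 → ℝ} {K₃ Q₃ : 𝒮 → 𝒰 → 𝒱 → 𝒲 → ℝ}
    (hK₁ : ∀ s, SubProb (K₁ s)) (hQz : ∀ s, SubProb (Qz s)) (hQx : ∀ s, SubProb (Qx s))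
    (hK₂ : ∀ s u, SubProb (K₂ s u)) (hQ₂ : ∀ s u, SubProb (Q₂ s u))
    (hK₃ : ∀ s u v, SubProb (K₃ s u v)) (hQ₃ : ∀ s u v, SubProb (Q₃ s u v))
    (G : O → Prop)
    (hG₁ : ∀ o, G o → 0 < K₁ (σ o) (U o) ∧ 0 < Qz (σ o) (U o) ∧ 0 < Qx (σ o) (U o))
    (hG₂ : ∀ o, G o → 0 < K₂ (σ o) (U o) (V o) ∧ 0 < Q₂ (σ o) (U o) (V o))
    (hG₃ : ∀ o, G o → 0 < K₃ (σ o) (U o) (V o) (W o) ∧ 0 < Q₃ (σ o) (U o) (V o) (W o)) :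
    ∃ (T₁ : 𝒰 × Fin M₁ → ℝ) (T₂ : 𝒱 × Fin M₂ → ℝ) (T₃ : 𝒲 × Fin M₃ → ℝ)
      (good : Set 𝒮), (∀ s ∈ good, ∃ o m₁ m₂ m₃, G o ∧
        Agree σ U V W K₁ Qz Qx K₂ Q₂ K₃ Q₃ T₁ T₂ T₃ s o m₁ m₂ m₃) ∧
      ∑ o, (if G o then P (σ o) *
        (K₁ (σ o) (U o) / (1 + K₁ (σ o) (U o) / (M₁ * Qz (σ o) (U o)) +
          K₁ (σ o) (U o) / (M₁ * Qx (σ o) (U o)))) *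
        (K₂ (σ o) (U o) (V o) / (1 + K₂ (σ o) (U o) (V o) / (M₂ * Q₂ (σ o) (U o) (V o)) +
          K₂ (σ o) (U o) (V o) / (M₂ * Q₂ (σ o) (U o) (V o)))) *
        (K₃ (σ o) (U o) (V o) (W o) /
          (1 + K₃ (σ o) (U o) (V o) (W o) / (M₃ * Q₃ (σ o) (U o) (V o) (W o)) +
          K₃ (σ o) (U o) (V o) (W o) / (M₃ * Q₃ (σ o) (U o) (V o) (W o)))) else 0) ≤
      ∑ s, good.indicator P s := by
  have := isProbabilityMeasure_expMeasure one_pos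
  have hM₁' : (0 : ℝ) < M₁ := by exact_mod_cast hM₁
  have hM₂' : (0 : ℝ) < M₂ := by exact_mod_cast hM₂
  have hM₃' : (0 : ℝ) < M₃ := by exact_mod_cast hM₃
  choose E₁ hE₁ mE₁ bE₁ using fun (k : {o // G o}) (m : Fin M₁) => exists_measurableSet_agree
    (hK₁ (σ k)) (hQz (σ k)) (hQx (σ k)) hM₁ (U k) m (hG₁ k k.2).1 (hG₁ k k.2).2.1 (hG₁ k k.2).2.2
  -- The second and third messages have one decoder each; listing it twice reuses the lemma for two
  -- decoders and only doubles the penalty.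
  choose E₂ hE₂ mE₂ bE₂ using fun (k : {o // G o}) (m : Fin M₂) => exists_measurableSet_agree
    (hK₂ (σ k) (U k)) (hQ₂ (σ k) (U k)) (hQ₂ (σ k) (U k)) hM₂ (V k) m (hG₂ k k.2).1 (hG₂ k k.2).2
    (hG₂ k k.2).2
  choose E₃ hE₃ mE₃ bE₃ using fun (k : {o // G o}) (m : Fin M₃) => exists_measurableSet_agree
    (hK₃ (σ k) (U k) (V k)) (hQ₃ (σ k) (U k) (V k)) (hQ₃ (σ k) (U k) (V k)) hM₃ (W k) m
    (hG₃ k k.2).1 (hG₃ k k.2).2 (hG₃ k k.2).2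
  set μ₁ := Measure.pi fun _ : 𝒰 × Fin M₁ => expMeasure 1
  set μ₂ := Measure.pi fun _ : 𝒱 × Fin M₂ => expMeasure 1
  set μ₃ := Measure.pi fun _ : 𝒲 × Fin M₃ => expMeasure 1
  -- The clocks are fixed one family at a time, with the families not yet fixed still represented by
  -- their probabilities.
  obtain ⟨T₁, hT₁⟩ := exists_sum_indicator_ge μ₁
    (fun k : {o // G o} × Fin M₁ × Fin M₂ × Fin M₃ => E₁ k.1 k.2.1) (fun k => mE₁ _ _)
    (fun k => P (σ k.1) * μ₂.real (E₂ k.1 k.2.2.1) * μ₃.real (E₃ k.1 k.2.2.2))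
  obtain ⟨T₂, hT₂⟩ := exists_sum_indicator_ge μ₂
    (fun k : {o // G o} × Fin M₁ × Fin M₂ × Fin M₃ => E₂ k.1 k.2.2.1) (fun k => mE₂ _ _)
    (fun k => P (σ k.1) * (E₁ k.1 k.2.1).indicator 1 T₁ * μ₃.real (E₃ k.1 k.2.2.2))
  obtain ⟨T₃, hT₃⟩ := exists_sum_indicator_ge μ₃
    (fun k : {o // G o} × Fin M₁ × Fin M₂ × Fin M₃ => E₃ k.1 k.2.2.2) (fun k => mE₃ _ _)
    (fun k => P (σ k.1) * (E₁ k.1 k.2.1).indicator 1 T₁ * (E₂ k.1 k.2.2.1).indicator 1 T₂)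
  refine ⟨T₁, T₂, T₃, {s | ∃ o m₁ m₂ m₃, G o ∧
    Agree σ U V W K₁ Qz Qx K₂ Q₂ K₃ Q₃ T₁ T₂ T₃ s o m₁ m₂ m₃}, fun s hs => hs, ?_⟩
  simp only [Set.indicator_apply, Set.mem_ofPred_eq]
  have hchain : ∑ k : {o // G o} × Fin M₁ × Fin M₂ × Fin M₃, P (σ k.1) *
      μ₁.real (E₁ k.1 k.2.1) * μ₂.real (E₂ k.1 k.2.2.1) * μ₃.real (E₃ k.1 k.2.2.2) ≤
      ∑ k : {o // G o} × Fin M₁ × Fin M₂ × Fin M₃, P (σ k.1) *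
        (E₁ k.1 k.2.1).indicator 1 T₁ * (E₂ k.1 k.2.2.1).indicator 1 T₂ *
        (E₃ k.1 k.2.2.2).indicator 1 T₃ := by
    refine le_trans (le_of_eq_of_le ?_ hT₁) (le_of_eq_of_le ?_ (hT₂.trans (le_of_eq_of_le ?_ hT₃))) <;>
    exact Finset.sum_congr rfl fun k _ => by ring
  refine le_trans ?_ (hchain.trans ?_)
  · rw [← Finset.sum_filter, Finset.sum_subtype (p := G) _ (by simp), Fintype.sum_prod_type]
    refine Finset.sum_le_sum fun o _ => ?_
    have p1 := hG₁ o o.2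
    have p2 := hG₂ o o.2
    have p3 := hG₃ o o.2
    set w₁ := K₁ (σ o) (U o) / (1 + K₁ (σ o) (U o) / (M₁ * Qz (σ o) (U o)) +
      K₁ (σ o) (U o) / (M₁ * Qx (σ o) (U o))) with hw₁
    set w₂ := K₂ (σ o) (U o) (V o) / (1 + K₂ (σ o) (U o) (V o) / (M₂ * Q₂ (σ o) (U o) (V o)) +
          K₂ (σ o) (U o) (V o) / (M₂ * Q₂ (σ o) (U o) (V o))) with hw₂
    set w₃ := K₃ (σ o) (U o) (V o) (W o) /
          (1 + K₃ (σ o) (U o) (V o) (W o) / (M₃ * Q₃ (σ o) (U o) (V o) (W o)) +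
          K₃ (σ o) (U o) (V o) (W o) / (M₃ * Q₃ (σ o) (U o) (V o) (W o))) with hw₃
    have n1 : 0 ≤ w₁ := by
      obtain ⟨h1, h2, h3⟩ := p1
      positivity
    have n2 : 0 ≤ w₂ := by
      obtain ⟨h1, h2⟩ := p2
      positivity
    have n3 : 0 ≤ w₃ := by
      obtain ⟨h1, h2⟩ := p3
      positivity
    -- Summing over the message triples removes the three factors 1/M.
    have hsum : P (σ o) * w₁ * w₂ * w₃ = ∑ _m : Fin M₁ × Fin M₂ × Fin M₃,
        P (σ o) * (w₁ / M₁) * (w₂ / M₂) * (w₃ / M₃) := by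
      rw [Finset.sum_const, Finset.card_univ, Fintype.card_prod, Fintype.card_prod]
      simp only [Fintype.card_fin, nsmul_eq_mul, Nat.cast_mul]
      field_simp
    rw [hsum]
    refine Finset.sum_le_sum fun m _ => ?_
    have h0 := hP (σ o)
    have b1 := bE₁ o m.1
    have b2 := bE₂ o m.2.1
    have b3 := bE₃ o m.2.2
    rw [← hw₁] at b1
    rw [← hw₂] at b2
    rw [← hw₃] at b3
    gcongr
  · have hone : ∀ s, ∑ k : {o // G o} × Fin M₁ × Fin M₂ × Fin M₃,
        (if σ k.1 = s ∧ T₁ ∈ E₁ k.1 k.2.1 ∧ T₂ ∈ E₂ k.1 k.2.2.1 ∧ T₃ ∈ E₃ k.1 k.2.2.2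
          then (1 : ℝ) else 0) ≤
        if ∃ o m₁ m₂ m₃, G o ∧ Agree σ U V W K₁ Qz Qx K₂ Q₂ K₃ Q₃ T₁ T₂ T₃ s o m₁ m₂ m₃
          then 1 else 0 := by
      intro s
      have hag : ∀ k : {o // G o} × Fin M₁ × Fin M₂ × Fin M₃,
          (σ k.1 = s ∧ T₁ ∈ E₁ k.1 k.2.1 ∧ T₂ ∈ E₂ k.1 k.2.2.1 ∧ T₃ ∈ E₃ k.1 k.2.2.2) →
          Agree σ U V W K₁ Qz Qx K₂ Q₂ K₃ Q₃ T₁ T₂ T₃ s k.1 k.2.1 k.2.2.1 k.2.2.2 := by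
        rintro k ⟨rfl, h1, h2, h3⟩
        exact ⟨rfl, hE₁ _ _ _ h1, ⟨(hE₂ _ _ _ h2).1, (hE₂ _ _ _ h2).2.1⟩,
          ⟨(hE₃ _ _ _ h3).1, (hE₃ _ _ _ h3).2.1⟩⟩
      by_cases hex : ∃ k : {o // G o} × Fin M₁ × Fin M₂ × Fin M₃,
          σ k.1 = s ∧ T₁ ∈ E₁ k.1 k.2.1 ∧ T₂ ∈ E₂ k.1 k.2.2.1 ∧ T₃ ∈ E₃ k.1 k.2.2.2
      · obtain ⟨k, hk⟩ := hex
        rw [if_pos ⟨k.1, k.2.1, k.2.2.1, k.2.2.2, k.1.2, hag k hk⟩, Finset.sum_eq_single k]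
        · rw [if_pos hk]
        · intro k' _ hne
          refine if_neg fun hk' => hne ?_
          obtain ⟨e0, ⟨e1, -, -⟩, ⟨e2, -⟩, ⟨e3, -⟩⟩ := hag k hk
          obtain ⟨e0', ⟨e1', -, -⟩, ⟨e2', -⟩, ⟨e3', -⟩⟩ := hag k' hk'
          obtain ⟨f1, f1'⟩ := Prod.mk.inj (e1'.unique e1)
          rw [f1] at e2' e3'
          obtain ⟨f2, f2'⟩ := Prod.mk.inj (e2'.unique e2)
          rw [f2] at e3'
          obtain ⟨f3, f3'⟩ := Prod.mk.inj (e3'.unique e3)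
          exact Prod.ext (Subtype.ext (hinj _ _ (e0'.trans e0.symm) f1 f2 f3))
            (Prod.ext f1' (Prod.ext f2' f3'))
        · simp
      · push Not at hex
        rw [Finset.sum_eq_zero fun k _ => if_neg fun h => hex k h.1 h.2.1 h.2.2.1 h.2.2.2]
        split_ifs <;> simp
    calc _ = ∑ k : {o // G o} × Fin M₁ × Fin M₂ × Fin M₃, ∑ s, P s *
          (if σ k.1 = s ∧ T₁ ∈ E₁ k.1 k.2.1 ∧ T₂ ∈ E₂ k.1 k.2.2.1 ∧ T₃ ∈ E₃ k.1 k.2.2.2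
            then (1 : ℝ) else 0) := by
          refine Finset.sum_congr rfl fun k _ => ?_
          rw [Finset.sum_eq_single (σ k.1)]
          · by_cases h1 : T₁ ∈ E₁ k.1 k.2.1 <;> by_cases h2 : T₂ ∈ E₂ k.1 k.2.2.1 <;>
              by_cases h3 : T₃ ∈ E₃ k.1 k.2.2.2 <;> simp [h1, h2, h3]
          · intro s _ hs
            rw [if_neg fun h => hs h.1.symm, mul_zero]
          · simp
      _ = ∑ s, P s * ∑ k : {o // G o} × Fin M₁ × Fin M₂ × Fin M₃,
          (if σ k.1 = s ∧ T₁ ∈ E₁ k.1 k.2.1 ∧ T₂ ∈ E₂ k.1 k.2.2.1 ∧ T₃ ∈ E₃ k.1 k.2.2.2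
            then (1 : ℝ) else 0) := by
          rw [Finset.sum_comm]
          exact Finset.sum_congr rfl fun s _ => by rw [Finset.mul_sum]
      _ ≤ ∑ s, P s * (if ∃ o m₁ m₂ m₃, G o ∧
            Agree σ U V W K₁ Qz Qx K₂ Q₂ K₃ Q₃ T₁ T₂ T₃ s o m₁ m₂ m₃ then 1 else 0) :=
          Finset.sum_le_sum fun s _ => mul_le_mul_of_nonneg_left (hone s) (hP s)
      _ = _ := Finset.sum_congr rfl fun s _ => by rw [mul_ite, mul_one, mul_zero]

end OneShot

/-! ### Exponential bounds for sums of letter costs. -/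

section Chernoff

variable {O : Type*} [Fintype O] {q : O → ℝ}

/-- The moment generating function is 1 at 0 with negative slope, so it dips below 1 to the right.
The bound `θ ≤ 1` is needed when exp F is compared with exp(θF) for negative F. -/
lemma exists_sum_exp_lt_one (h1 : ∑ o, q o = 1) {f : O → ℝ} (hf : ∑ o, q o * f o < 0) :
    ∃ θ : ℝ, 0 < θ ∧ θ ≤ 1 ∧ ∑ o, q o * Real.exp (θ * f o) < 1 := by
  have hd : HasDerivAt (fun θ : ℝ => ∑ o, q o * Real.exp (θ * f o)) (∑ o, q o * f o) 0 := by
    refine HasDerivAt.fun_sum fun o _ => ?_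
    have h := (((hasDerivAt_id (0 : ℝ)).mul_const (f o)).exp).const_mul (q o)
    simpa using h
  have ht : Filter.Tendsto _ (nhdsWithin (0 : ℝ) (Set.Ioi 0)) _ :=
    (hasDerivAt_iff_tendsto_slope_zero.1 hd).mono_left
      (nhdsWithin_mono 0 fun t ht => (Set.mem_Ioi.1 ht).ne')
  have he := (ht.eventually_lt_const hf).and
    ((Ioc_mem_nhdsGT (zero_lt_one (α := ℝ))) : ∀ᶠ t in nhdsWithin (0 : ℝ) (Set.Ioi 0),
      t ∈ Set.Ioc (0 : ℝ) 1)
  obtain ⟨θ, h, hθ⟩ := he.exists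
  refine ⟨θ, hθ.1, hθ.2, ?_⟩
  simp only [zero_add, zero_mul, Real.exp_zero, mul_one, h1, smul_eq_mul] at h
  have := neg_of_mul_neg_right h (inv_pos.2 hθ.1).le
  linarith

lemma sum_blockLaw_prod (n : ℕ) (g : O → ℝ) :
    ∑ o : Fin n → O, blockLaw n q o * ∏ i, g (o i) = (∑ o, q o * g o) ^ n := by
  classical
  simp only [blockLaw, ← Finset.prod_mul_distrib]
  rw [← Fintype.piFinset_univ, ← Finset.prod_univ_sum (fun _ => Finset.univ)
    (fun _ o => q o * g o)]
  simp

/-- Chernoff bound. -/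
lemma tendsto_sum_blockLaw_min (hq : ∀ o, 0 ≤ q o) (h1 : ∑ o, q o = 1) {f : O → ℝ}
    (hf : ∑ o, q o * f o < 0) {C : ℝ} (hC : 1 ≤ C) :
    Filter.Tendsto (fun n : ℕ => ∑ o : Fin n → O, blockLaw n q o *
      min 1 (C * Real.exp (∑ i, f (o i)))) Filter.atTop (nhds 0) := by
  obtain ⟨θ, hθ, hθ1, hlt⟩ := exists_sum_exp_lt_one h1 hf
  have h0 : 0 ≤ ∑ o, q o * Real.exp (θ * f o) :=
    Finset.sum_nonneg fun o _ => mul_nonneg (hq o) (Real.exp_pos _).le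
  have hlim := (tendsto_pow_atTop_nhds_zero_of_lt_one h0 hlt).const_mul C
  rw [mul_zero] at hlim
  refine squeeze_zero (fun n => Finset.sum_nonneg fun o _ => mul_nonneg (blockLaw_nonneg hq o)
    (le_min zero_le_one (by positivity))) (fun n => ?_) hlim
  rw [← sum_blockLaw_prod, Finset.mul_sum]
  refine Finset.sum_le_sum fun o _ => ?_
  rw [← Real.exp_sum, ← Finset.mul_sum, mul_left_comm]
  refine mul_le_mul_of_nonneg_left ?_ (blockLaw_nonneg hq o)
  -- min(1, C exp F) ≤ C exp(θF): for F ≤ 0 because θ ≤ 1, for F ≥ 0 because C ≥ 1.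
  rcases le_total (∑ i, f (o i)) 0 with hF | hF
  · refine (min_le_right _ _).trans ?_
    gcongr
    nlinarith
  · refine (min_le_left _ _).trans ?_
    have : 1 ≤ Real.exp (θ * ∑ i, f (o i)) := Real.one_le_exp (by positivity)
    nlinarith

/-- Each factor satisfies 1/(1+t) ≥ 1 - min(1,t), and a product of numbers in [0,1] loses at most
the sum of the individual losses. The doubled terms come from the decoders listed twice. -/
lemma one_sub_le_prod_inv {a b c d : ℝ} (ha : 0 ≤ a) (hb : 0 ≤ b) (hc : 0 ≤ c) (hd : 0 ≤ d) :
    1 - (min 1 a + min 1 b + min 1 (c + c) + min 1 (d + d)) ≤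
      1 / (1 + a + b) * (1 / (1 + c + c)) * (1 / (1 + d + d)) := by
  have key : ∀ t : ℝ, 0 ≤ t → 1 - min 1 t ≤ 1 / (1 + t) := by
    intro t ht
    rw [le_div_iff₀ (by linarith)]
    rcases le_total 1 t with h | h
    · rw [min_eq_left h]
      linarith
    · rw [min_eq_right h]
      nlinarith
  have key' : ∀ t : ℝ, 0 ≤ t → 1 / (1 + t) ≤ 1 := fun t ht => by
    rw [div_le_one (by linarith)]
    linarith
  have key0 : ∀ t : ℝ, 0 ≤ t → 0 ≤ 1 / (1 + t) := fun t ht => by positivity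
  have hab : min 1 (a + b) ≤ min 1 a + min 1 b := by
    rcases le_total 1 a with h | h
    · rw [min_eq_left h]
      linarith [min_le_left 1 (a + b), le_min zero_le_one hb]
    · rcases le_total 1 b with h' | h'
      · rw [min_eq_left h']
        linarith [min_le_left 1 (a + b), le_min zero_le_one ha]
      · rw [min_eq_right h, min_eq_right h']
        exact min_le_right _ _
  have h1 := key (a + b) (by positivity)
  have h2 := key (c + c) (by positivity)
  have h3 := key (d + d) (by positivity)
  have h1' := key' (a + b) (by positivity)
  have h2' := key' (c + c) (by positivity)
  have h3' := key' (d + d) (by positivity)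
  have h1'' := key0 (a + b) (by positivity)
  have h2'' := key0 (c + c) (by positivity)
  rw [← add_assoc] at h1 h2 h3 h1' h2' h3' h1'' h2''
  set x := 1 / (1 + a + b)
  set y := 1 / (1 + c + c)
  set z := 1 / (1 + d + d)
  have e1 : x + y - 1 ≤ x * y := by nlinarith
  have e2 : x * y ≤ 1 := by nlinarith
  have e3 : x * y + z - 1 ≤ x * y * z := by nlinarith
  linarith

end Chernoff

/-! ### Conditional laws and information densities. -/

section Kernels

/-- The conditional law of `B` given `C = c`. -/
def condLaw {Ω β γ : Type*} [Fintype Ω] (q : Ω → ℝ) (B : Ω → β) (C : Ω → γ) (c : γ) (b : β) : ℝ :=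
  law q (fun ω => (B ω, C ω)) (b, c) / law q C c

variable {Ω α β γ : Type*} [Fintype Ω] {q : Ω → ℝ}

/-- Total mass is only at most 1: where the condition has probability zero, division by zero gives
the zero law. -/
lemma subProb_condLaw [Fintype β] (hq : ∀ ω, 0 ≤ q ω) (B : Ω → β) (C : Ω → γ) (c : γ) :
    SubProb (condLaw q B C c) := by
  refine ⟨fun b => div_nonneg (law_nonneg hq _ _) (law_nonneg hq _ _), ?_⟩
  simp only [condLaw]
  rw [← Finset.sum_div, law_snd]
  exact div_self_le_one _

lemma condLaw_pos (hq : ∀ ω, 0 ≤ q ω) (B : Ω → β) (C : Ω → γ) {ω : Ω} (h : 0 < q ω) :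
    0 < condLaw q B C (C ω) (B ω) :=
  div_pos (law_pos hq (fun ω => (B ω, C ω)) h) (law_pos hq C h)

lemma subProb_of_mem_stdSimplex [Fintype β] {f : β → ℝ} (h : f ∈ stdSimplex ℝ β) : SubProb f :=
  ⟨h.1, h.2.le⟩

lemma subProb_prod [Fintype β] {n : ℕ} {k : Fin n → β → ℝ} (h : ∀ i, SubProb (k i)) :
    SubProb fun b : Fin n → β => ∏ i, k i (b i) := by
  classical
  refine ⟨fun b => Finset.prod_nonneg fun i _ => (h i).1 _, ?_⟩
  rw [← Fintype.piFinset_univ, ← Finset.prod_univ_sum (fun _ => Finset.univ) k]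
  exact Finset.prod_le_one (fun i _ => Finset.sum_nonneg fun b _ => (h i).1 b) fun i _ => (h i).2

/-- Conditional mutual information as the expectation of an information density. -/
lemma sum_log_div_condLaw [Fintype α] [Fintype β] [Fintype γ] (hq : ∀ ω, 0 ≤ q ω) {A : Ω → α}
    {B : Ω → β} {C : Ω → γ} {κ : Ω → ℝ} (hκ : ∀ ω, law q (fun ω => (A ω, B ω, C ω))
      (A ω, B ω, C ω) = law q (fun ω => (A ω, C ω)) (A ω, C ω) * κ ω) :
    ∑ ω, q ω * Real.log (κ ω / condLaw q B C (C ω) (B ω)) =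
      Real.log 2 * condMutualInfo q A B C := by
  have h2 : Real.log 2 ≠ 0 := (Real.log_pos one_lt_two).ne'
  rw [condMutualInfo_eq_ent hq]
  unfold ent
  rw [neg_sub_neg, sub_neg_eq_add, ← sub_eq_add_neg, ← Finset.sum_sub_distrib,
    ← Finset.sum_add_distrib, ← Finset.sum_sub_distrib, Finset.mul_sum]
  refine Finset.sum_congr rfl fun ω _ => ?_
  rcases (hq ω).eq_or_lt with h0 | h0
  · simp [← h0]
  · have e1 := law_pos hq (fun ω => (A ω, C ω)) h0
    have e2 := law_pos hq (fun ω => (B ω, C ω)) h0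
    have e3 := law_pos hq (fun ω => (A ω, B ω, C ω)) h0
    have e4 := law_pos hq C h0
    rw [hκ ω] at e3
    have e5 : 0 < κ ω := (mul_pos_iff_of_pos_left e1).1 e3
    rw [hκ ω, condLaw, Real.log_div e5.ne' (div_pos e2 e4).ne', Real.log_div e2.ne' e4.ne',
      Real.logb_mul e1.ne' e5.ne']
    simp only [Real.logb]
    field_simp
    ring

lemma condMutualInfo_nonneg [Fintype α] [Fintype β] [Fintype γ] (hq : ∀ ω, 0 ≤ q ω) (A : Ω → α)
    (B : Ω → β) (C : Ω → γ) : 0 ≤ condMutualInfo q A B C := by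
  rw [condMutualInfo_eq_ent hq]
  linarith [ent_submodular hq A B C]

end Kernels

/-! ### Information densities of the auxiliary variables. -/

namespace Aux

variable {X Y Z : Type*} [Fintype X] [Fintype Y] [Fintype Z] {kU kV kW : ℕ}
  (a : Aux X Y Z kU kV kW) (p : X × Y × Z → ℝ)

/-- After V and W are summed out, p(u|y) is constant on the event and factors out. This identifies
the encoder's kernel as a conditional law given any data that determine y; the next two lemmas do
the same for V and W. -/
lemma law_u {γ : Type*} (g : X → Y → Z → γ) (c : γ) (u : Fin kU) (κ : ℝ)
    (h : ∀ x y z, g x y z = c → a.pU y u = κ) :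
    law (a.joint p) (fun o => (o.u, g o.x o.y o.z)) (u, c) =
      law (a.joint p) (fun o => g o.x o.y o.z) c * κ := by
  classical
  have e1 := a.sum_joint_xyzu p fun x y z u' => if u' = u ∧ g x y z = c then 1 else 0
  have e2 := a.sum_joint_xyzu p fun x y z _ => if g x y z = c then 1 else 0
  simp only [law, Prod.mk.injEq]
  simp only [mul_ite, mul_one, mul_zero] at e1 e2
  refine Eq.trans ?_ (Eq.trans e1 (Eq.trans ?_ (congrArg (· * κ) (Eq.trans e2.symm ?_))))
  · exact Finset.sum_congr rfl fun o _ => by congr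
  · simp only [Finset.sum_mul]
    refine Finset.sum_congr rfl fun x _ => Finset.sum_congr rfl fun y _ =>
      Finset.sum_congr rfl fun z _ => ?_
    by_cases hc : g x y z = c
    · simp [hc, ← Finset.sum_mul, ← Finset.mul_sum, (a.pU_mem y).2, h x y z hc]
    · simp [hc]
  · exact Finset.sum_congr rfl fun o _ => by congr

lemma law_v {γ : Type*} (g : X → Y → Z → Fin kU → γ) (c : γ) (v : Fin kV) (κ : ℝ)
    (h : ∀ x y z u, g x y z u = c → a.pV u z v = κ) :
    law (a.joint p) (fun o => (o.v, g o.x o.y o.z o.u)) (v, c) =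
      law (a.joint p) (fun o => g o.x o.y o.z o.u) c * κ := by
  classical
  have e1 := a.sum_joint p fun x y z u v' _ => if v' = v ∧ g x y z u = c then 1 else 0
  have e2 := a.sum_joint_xyzu p fun x y z u => if g x y z u = c then 1 else 0
  simp only [law, Prod.mk.injEq]
  simp only [mul_ite, mul_one, mul_zero] at e1 e2
  refine Eq.trans ?_ (Eq.trans e1 (Eq.trans ?_ (congrArg (· * κ) (Eq.trans e2.symm ?_))))
  · exact Finset.sum_congr rfl fun o _ => by congr
  · simp only [Finset.sum_mul]
    refine Finset.sum_congr rfl fun x _ => Finset.sum_congr rfl fun y _ =>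
      Finset.sum_congr rfl fun z _ => Finset.sum_congr rfl fun u _ => ?_
    by_cases hc : g x y z u = c
    · simp [hc, h x y z u hc, ← Finset.mul_sum, (a.pW_mem _ _ _).2, Finset.sum_ite_irrel]
    · simp [hc]
  · exact Finset.sum_congr rfl fun o _ => by congr

lemma law_w {γ : Type*} (g : X → Y → Z → Fin kU → Fin kV → γ) (c : γ) (w : Fin kW) (κ : ℝ)
    (h : ∀ x y z u v, g x y z u v = c → a.pW u v x w = κ) :
    law (a.joint p) (fun o => (o.w, g o.x o.y o.z o.u o.v)) (w, c) =
      law (a.joint p) (fun o => g o.x o.y o.z o.u o.v) c * κ := by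
  classical
  have e1 := a.sum_joint p fun x y z u v w' => if w' = w ∧ g x y z u v = c then 1 else 0
  have e2 := a.sum_joint p fun x y z u v _ => if g x y z u v = c then 1 else 0
  simp only [law, Prod.mk.injEq]
  simp only [mul_ite, mul_one, mul_zero] at e1 e2
  refine Eq.trans ?_ (Eq.trans e1 (Eq.trans ?_ (congrArg (· * κ) (Eq.trans e2.symm ?_))))
  · exact Finset.sum_congr rfl fun o _ => by congr
  · simp only [Finset.sum_mul]
    refine Finset.sum_congr rfl fun x _ => Finset.sum_congr rfl fun y _ =>
      Finset.sum_congr rfl fun z _ => Finset.sum_congr rfl fun u _ =>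
      Finset.sum_congr rfl fun v _ => ?_
    by_cases hc : g x y z u v = c
    · simp [hc, h x y z u v hc, ← Finset.mul_sum, ← Finset.sum_mul, (a.pW_mem _ _ _).2]
    · simp [hc]
  · exact Finset.sum_congr rfl fun o _ => by congr

end Aux

namespace Aux

variable {X Y Z : Type*} [Fintype X] [Fintype Y] [Fintype Z] {kU kV kW : ℕ}
  (a : Aux X Y Z kU kV kW) {p : X × Y × Z → ℝ}

lemma condIndep_u_of_y {γ : Type*} (p : X × Y × Z → ℝ) (g : X → Z → γ) :
    CondIndep (a.joint p) Outcome.u (fun o => g o.x o.z) Outcome.y := by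
  intro u c y
  have e1 := a.law_u p (fun x y z => (g x z, y)) (c, y) u (a.pU y u) (by
    rintro x y' z h
    rw [(Prod.mk.inj h).2])
  have e2 := a.law_u p (fun x y z => y) y u (a.pU y u) (by
    rintro x y' z rfl
    rfl)
  rw [e1, e2]
  ring

lemma condIndep_u_z_x (hM : IsMarkovYXZ p) :
    CondIndep (a.joint p) Outcome.u Outcome.z Outcome.x := by
  classical
  have hlaw : ∀ (g : X → Y → Z → Fin kU → Prop)
      [∀ x y z u, Decidable (g x y z u)], law (a.joint p)
      (fun o => g o.x o.y o.z o.u) True = ∑ x, ∑ y, ∑ z, ∑ u,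
        if g x y z u then p (x, y, z) * a.pU y u else 0 := by
    intro g _
    have e := a.sum_joint_xyzu p fun x y z u => if g x y z u then 1 else 0
    simp only [mul_ite, mul_one, mul_zero] at e
    rw [← e]
    exact Finset.sum_congr rfl fun o _ => by simp
  intro u z x
  have h1 : law (a.joint p) (fun o => (o.u, o.z, o.x)) (u, z, x) =
      ∑ y, p (x, y, z) * a.pU y u := by
    rw [law_eq_of_iff (B := fun o => o.u = u ∧ o.z = z ∧ o.x = x) (b := True) (by simp),
      hlaw fun x' _ z' u' => u' = u ∧ z' = z ∧ x' = x]
    simp [ite_and, Finset.sum_ite_irrel]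
  have h2 : law (a.joint p) (fun o => (o.u, o.x)) (u, x) =
      ∑ y, ∑ z, p (x, y, z) * a.pU y u := by
    rw [law_eq_of_iff (B := fun o => o.u = u ∧ o.x = x) (b := True) (by simp),
      hlaw fun x' _ _ u' => u' = u ∧ x' = x]
    simp [ite_and, Finset.sum_ite_irrel]
  have h3 : law (a.joint p) (fun o => (o.z, o.x)) (z, x) = ∑ y, p (x, y, z) := by
    rw [law_eq_of_iff (B := fun o => o.z = z ∧ o.x = x) (b := True) (by simp),
      hlaw fun x' _ z' _ => z' = z ∧ x' = x]
    simp [ite_and, Finset.sum_ite_irrel, ← Finset.mul_sum, (a.pU_mem _).2]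
  have h4 : law (a.joint p) Outcome.x x = ∑ y, ∑ z, p (x, y, z) := by
    rw [law_eq_of_iff (B := fun o => o.x = x) (b := True) (by simp),
      hlaw fun x' _ _ _ => x' = x]
    simp [Finset.sum_ite_irrel, ← Finset.mul_sum, (a.pU_mem _).2]
  rw [h1, h2, h3, h4, Finset.sum_mul, Finset.sum_mul]
  refine Finset.sum_congr rfl fun y _ => ?_
  rw [← Finset.sum_mul, mul_right_comm, hM x y z]
  ring

/-- Since U - Y - (X,Z), the two sides are H(U|X) - H(U|Y) and H(U|Z) - H(U|Y). Since U - X - Z,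
H(U|X) = H(U|X,Z) ≤ H(U|Z). -/
lemma condMutualInfo_x_le_z (hp : ∀ s, 0 ≤ p s) (hM : IsMarkovYXZ p) :
    condMutualInfo (a.joint p) Outcome.y Outcome.u Outcome.x ≤
      condMutualInfo (a.joint p) Outcome.y Outcome.u Outcome.z := by
  have hq := a.joint_nonneg hp
  have e1 := (a.condIndep_u_of_y p fun x _ => x).ent_eq hq
  have e2 := (a.condIndep_u_of_y p fun _ z => z).ent_eq hq
  have e3 := (a.condIndep_u_z_x hM).ent_eq hq
  have e4 := ent_submodular hq Outcome.u Outcome.x Outcome.z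
  rw [condMutualInfo_eq_ent hq, condMutualInfo_eq_ent hq]
  have c1 : ent (a.joint p) (fun o => (o.y, o.u, o.x)) = ent (a.joint p) fun o => (o.u, o.x, o.y) :=
    ent_congr fun _ _ => by simp only [Prod.mk.injEq]; tauto
  have c2 : ent (a.joint p) (fun o => (o.y, o.u, o.z)) = ent (a.joint p) fun o => (o.u, o.z, o.y) :=
    ent_congr fun _ _ => by simp only [Prod.mk.injEq]; tauto
  have c3 : ent (a.joint p) (fun o => (o.y, o.x)) = ent (a.joint p) fun o => (o.x, o.y) :=
    ent_congr fun _ _ => by simp only [Prod.mk.injEq]; tauto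
  have c4 : ent (a.joint p) (fun o => (o.y, o.z)) = ent (a.joint p) fun o => (o.z, o.y) :=
    ent_congr fun _ _ => by simp only [Prod.mk.injEq]; tauto
  have c5 : ent (a.joint p) (fun o => (o.u, o.z, o.x)) = ent (a.joint p) fun o => (o.u, o.x, o.z) :=
    ent_congr fun _ _ => by simp only [Prod.mk.injEq]; tauto
  have c6 : ent (a.joint p) (fun o => (o.z, o.x)) = ent (a.joint p) fun o => (o.x, o.z) :=
    ent_congr fun _ _ => by simp only [Prod.mk.injEq]; tauto
  linarith

lemma sum_log_u_z (hp : ∀ s, 0 ≤ p s) :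
    ∑ o, a.joint p o * Real.log (a.pU o.y o.u / condLaw (a.joint p) Outcome.u Outcome.z o.z o.u) =
      Real.log 2 * condMutualInfo (a.joint p) Outcome.y Outcome.u Outcome.z := by
  refine sum_log_div_condLaw (a.joint_nonneg hp) fun o => ?_
  rw [← a.law_u p (fun _ y z => (y, z)) (o.y, o.z) o.u (a.pU o.y o.u) (by
    rintro x y z h
    rw [(Prod.mk.inj h).1])]
  exact law_eq_of_iff fun _ => by simp only [Prod.mk.injEq]; tauto

lemma sum_log_u_x (hp : ∀ s, 0 ≤ p s) :
    ∑ o, a.joint p o * Real.log (a.pU o.y o.u / condLaw (a.joint p) Outcome.u Outcome.x o.x o.u) =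
      Real.log 2 * condMutualInfo (a.joint p) Outcome.y Outcome.u Outcome.x := by
  refine sum_log_div_condLaw (a.joint_nonneg hp) fun o => ?_
  rw [← a.law_u p (fun x y _ => (y, x)) (o.y, o.x) o.u (a.pU o.y o.u) (by
    rintro x y z h
    rw [(Prod.mk.inj h).1])]
  exact law_eq_of_iff fun _ => by simp only [Prod.mk.injEq]; tauto

lemma sum_log_v (hp : ∀ s, 0 ≤ p s) :
    ∑ o, a.joint p o * Real.log (a.pV o.u o.z o.v /
      condLaw (a.joint p) Outcome.v (fun o => (o.u, o.x)) (o.u, o.x) o.v) =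
      Real.log 2 * condMutualInfo (a.joint p) Outcome.z Outcome.v (fun o => (o.u, o.x)) := by
  refine sum_log_div_condLaw (C := fun o : Outcome X Y Z kU kV kW => (o.u, o.x))
    (a.joint_nonneg hp) fun o => ?_
  rw [← a.law_v p (fun x _ z u => (z, u, x)) (o.z, o.u, o.x) o.v (a.pV o.u o.z o.v) (by
    rintro x y z u h
    simp only [Prod.mk.injEq] at h
    rw [h.1, h.2.1])]
  exact law_eq_of_iff fun _ => by simp only [Prod.mk.injEq]; tauto

lemma sum_log_w (hp : ∀ s, 0 ≤ p s) :
    ∑ o, a.joint p o * Real.log (a.pW o.u o.v o.x o.w /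
      condLaw (a.joint p) Outcome.w (fun o => (o.u, o.v, o.z)) (o.u, o.v, o.z) o.w) =
      Real.log 2 * condMutualInfo (a.joint p) Outcome.x Outcome.w (fun o => (o.u, o.v, o.z)) := by
  refine sum_log_div_condLaw (C := fun o : Outcome X Y Z kU kV kW => (o.u, o.v, o.z))
    (a.joint_nonneg hp) fun o => ?_
  rw [← a.law_w p (fun x _ z u v => (x, u, v, z)) (o.x, o.u, o.v, o.z) o.w
    (a.pW o.u o.v o.x o.w) (by
      rintro x y z u v h
      simp only [Prod.mk.injEq] at h
      rw [h.1, h.2.1, h.2.2.1])]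
  exact law_eq_of_iff fun _ => by simp only [Prod.mk.injEq]; tauto

end Aux

/-- The index that wins the race, if there is one. -/
def winner {ι : Type*} [Nonempty ι] (P T : ι → ℝ) : ι :=
  Classical.epsilon fun i => Wins P T i

lemma Wins.winner_eq {ι : Type*} [Nonempty ι] {P T : ι → ℝ} {i : ι} (h : Wins P T i) :
    winner P T = i :=
  (Classical.epsilon_spec (p := fun i => Wins P T i) ⟨i, h⟩).unique h

/-- A code all of whose maps follow the winner of a race. -/
lemma exists_code {X Y Z Xh Zh 𝒰 𝒱 𝒲 : Type*} [Nonempty 𝒰] [Nonempty 𝒱] [Nonempty 𝒲]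
    {n M₁ M₂ M₃ : ℕ} (hM₁ : 0 < M₁) (hM₂ : 0 < M₂) (hM₃ : 0 < M₃)
    (K₁ : (Fin n → Y) → 𝒰 → ℝ) (Qz : (Fin n → Z) → 𝒰 → ℝ) (Qx : (Fin n → X) → 𝒰 → ℝ)
    (K₂ : (Fin n → Z) → 𝒰 → 𝒱 → ℝ) (Q₂ : (Fin n → X) → 𝒰 → 𝒱 → ℝ)
    (K₃ : (Fin n → X) → 𝒰 → 𝒱 → 𝒲 → ℝ) (Q₃ : (Fin n → Z) → 𝒰 → 𝒱 → 𝒲 → ℝ)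
    (T₁ : 𝒰 × Fin M₁ → ℝ) (T₂ : 𝒱 × Fin M₂ → ℝ) (T₃ : 𝒲 × Fin M₃ → ℝ)
    (rX : 𝒰 → 𝒲 → (Fin n → Z) → Fin n → Xh) (rZ : 𝒰 → 𝒱 → (Fin n → X) → Fin n → Zh) :
    ∃ c : Code X Y Z Xh Zh n M₁ M₂ M₃, ∀ (x : Fin n → X) (y : Fin n → Y) (z : Fin n → Z)
      u v w m₁ m₂ m₃,
      Wins (encRate (K₁ y)) T₁ (u, m₁) → Wins (decRate (Qz z) m₁) T₁ (u, m₁) →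
      Wins (decRate (Qx x) m₁) T₁ (u, m₁) →
      Wins (encRate (K₂ z u)) T₂ (v, m₂) → Wins (decRate (Q₂ x u) m₂) T₂ (v, m₂) →
      Wins (encRate (K₃ x u v)) T₃ (w, m₃) → Wins (decRate (Q₃ z u v) m₃) T₃ (w, m₃) →
      c.recX (fun i => (x i, y i, z i)) = rX u w z ∧
        c.recZ (fun i => (x i, y i, z i)) = rZ u v x := by
  have : Nonempty (Fin M₁) := ⟨⟨0, hM₁⟩⟩
  have : Nonempty (Fin M₂) := ⟨⟨0, hM₂⟩⟩
  have : Nonempty (Fin M₃) := ⟨⟨0, hM₃⟩⟩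
  -- Each user recovers the codewords from its own sequence and the messages it has; the recovered
  -- values coincide only when the races agree.
  let uZ (z : Fin n → Z) (m₁ : Fin M₁) : 𝒰 := (winner (decRate (Qz z) m₁) T₁).1
  let uX (x : Fin n → X) (m₁ : Fin M₁) : 𝒰 := (winner (decRate (Qx x) m₁) T₁).1
  let vZ (z : Fin n → Z) (m₁ : Fin M₁) : 𝒱 × Fin M₂ := winner (encRate (K₂ z (uZ z m₁))) T₂
  let vX (x : Fin n → X) (m₁ : Fin M₁) (m₂ : Fin M₂) : 𝒱 :=
    (winner (decRate (Q₂ x (uX x m₁)) m₂) T₂).1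
  let wX (x : Fin n → X) (m₁ : Fin M₁) (m₂ : Fin M₂) : 𝒲 × Fin M₃ :=
    winner (encRate (K₃ x (uX x m₁) (vX x m₁ m₂))) T₃
  let wZ (z : Fin n → Z) (m₁ : Fin M₁) (m₃ : Fin M₃) : 𝒲 :=
    (winner (decRate (Q₃ z (uZ z m₁) (vZ z m₁).1) m₃) T₃).1
  refine ⟨⟨fun y => (winner (encRate (K₁ y)) T₁).2, fun z m₁ => (vZ z m₁).2,
    fun x m₁ m₂ => (wX x m₁ m₂).2, fun x m₁ m₂ => rZ (uX x m₁) (vX x m₁ m₂) x,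
    fun z m₁ m₃ => rX (uZ z m₁) (wZ z m₁ m₃) z⟩, ?_⟩
  intro x y z u v w m₁ m₂ m₃ h1 h2 h3 h4 h5 h6 h7
  have a1 : (winner (encRate (K₁ y)) T₁).2 = m₁ := by rw [h1.winner_eq]
  have a2 : uZ z m₁ = u := by simp only [uZ, h2.winner_eq]
  have a3 : uX x m₁ = u := by simp only [uX, h3.winner_eq]
  have a4 : vZ z m₁ = (v, m₂) := by simp only [vZ, a2, h4.winner_eq]
  have a5 : vX x m₁ m₂ = v := by simp only [vX, a3, h5.winner_eq]
  have a6 : wX x m₁ m₂ = (w, m₃) := by simp only [wX, a3, a5, h6.winner_eq]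
  have a7 : wZ z m₁ m₃ = w := by simp only [wZ, a2, a4, h7.winner_eq]
  constructor
  · simp only [Code.recX, Code.T₃, Code.T₂, Code.T₁, a1, a4, a6, a7, a2]
  · simp only [Code.recZ, Code.T₂, Code.T₁, a1, a4, a5, a3]

/-- The cost is at most `A` on the good set and at most `B` on its complement, whose mass is at most
`err`. -/
lemma sum_mul_le_of_good {S : Type*} [Fintype S] {P D : S → ℝ} {good : Set S} (hP : ∀ s, 0 ≤ P s) (h1 : ∑ s, P s = 1) {A B err : ℝ} (hA : 0 ≤ A)
    (hB : 0 ≤ B) (hgood : ∀ s ∈ good, D s ≤ A) (hD : ∀ s, D s ≤ B)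
    (herr : 1 - err ≤ ∑ s, good.indicator P s) :
    ∑ s, P s * D s ≤ A + B * err := by
  classical
  have h : ∀ s, P s * D s ≤ P s * A + B * (P s - good.indicator P s) := by
    intro s
    rw [Set.indicator_apply]
    split_ifs with hs
    · have := mul_le_mul_of_nonneg_left (hgood s hs) (hP s)
      linarith
    · have := mul_le_mul_of_nonneg_left (hD s) (hP s)
      have := mul_nonneg (hP s) hA
      linarith
  refine (Finset.sum_le_sum fun s _ => h s).trans ?_
  rw [Finset.sum_add_distrib, ← Finset.sum_mul, ← Finset.mul_sum, Finset.sum_sub_distrib, h1]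
  have := mul_le_mul_of_nonneg_left (show 1 - (∑ s, good.indicator P s) ≤ err by linarith) hB
  linarith

lemma floor_two_rpow_pos {n : ℕ} {R : ℝ} (hR : 0 ≤ R) : 0 < ⌊(2 : ℝ) ^ ((n : ℝ) * R)⌋₊ :=
  Nat.floor_pos.2 (Real.one_le_rpow one_le_two (by positivity))

/-- The factor 2 pays for rounding: 2^(nR) ≤ 2⌊2^(nR)⌋ because the floor is at least 1. -/
lemma prod_div_floor_le {n : ℕ} {R : ℝ} (hR : 0 ≤ R) {k c : Fin n → ℝ} (hk : ∀ i, 0 < k i)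
    (hc : ∀ i, 0 < c i) :
    (∏ i, k i) / (⌊(2 : ℝ) ^ ((n : ℝ) * R)⌋₊ * ∏ i, c i) ≤
      2 * Real.exp (∑ i, (Real.log (k i / c i) - R * Real.log 2)) := by
  have hM : (0 : ℝ) < ⌊(2 : ℝ) ^ ((n : ℝ) * R)⌋₊ := by exact_mod_cast floor_two_rpow_pos hR
  have hM1 : (1 : ℝ) ≤ ⌊(2 : ℝ) ^ ((n : ℝ) * R)⌋₊ := by
    exact_mod_cast floor_two_rpow_pos (n := n) hR
  have h2 : (2 : ℝ) ^ ((n : ℝ) * R) ≤ 2 * ⌊(2 : ℝ) ^ ((n : ℝ) * R)⌋₊ := by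
    linarith [Nat.lt_floor_add_one ((2 : ℝ) ^ ((n : ℝ) * R))]
  have hexp : Real.exp (∑ i, (Real.log (k i / c i) - R * Real.log 2)) =
      (∏ i, k i) / (∏ i, c i) / (2 : ℝ) ^ ((n : ℝ) * R) := by
    rw [Finset.sum_sub_distrib, Real.exp_sub, Real.exp_sum, ← Finset.prod_div_distrib]
    congr 1
    · exact Finset.prod_congr rfl fun i _ => Real.exp_log (div_pos (hk i) (hc i))
    · rw [Finset.sum_const, Finset.card_univ, Fintype.card_fin, nsmul_eq_mul,
        Real.rpow_def_of_pos two_pos]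
      congr 1
      ring
  rw [hexp, mul_comm (⌊_⌋₊ : ℝ), ← div_div, mul_div_assoc', mul_comm (2 : ℝ), mul_div_assoc,
    div_eq_mul_one_div _ (⌊_⌋₊ : ℝ)]
  have hpos : 0 ≤ (∏ i, k i) / ∏ i, c i :=
    div_nonneg (Finset.prod_nonneg fun i _ => (hk i).le) (Finset.prod_nonneg fun i _ => (hc i).le)
  refine mul_le_mul_of_nonneg_left ?_ hpos
  rw [div_le_div_iff₀ hM (by positivity)]
  linarith

/-- A bounded exponential weight of a sum of letter costs over a block; it is `1` when the sum is
positive. -/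
def excess {O : Type*} {n : ℕ} (f : O → ℝ) (o : Fin n → O) : ℝ :=
  min 1 (4 * Real.exp (∑ i, f (o i)))

lemma excess_nonneg {O : Type*} {n : ℕ} (f : O → ℝ) (o : Fin n → O) : 0 ≤ excess f o :=
  le_min zero_le_one (by positivity)

lemma excess_eq_one {O : Type*} {n : ℕ} {f : O → ℝ} {o : Fin n → O} (h : 0 < ∑ i, f (o i)) :
    excess f o = 1 :=
  min_eq_left (by linarith [Real.one_le_exp h.le])

/-! ### Achievability at a fixed block length. -/

section Achievability

variable {X Y Z Xh Zh : Type*} [Fintype X] [Fintype Y] [Fintype Z] {kU kV kW : ℕ}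
  (a : Aux X Y Z kU kV kW) {p : X × Y × Z → ℝ}

/-- The log-likelihood ratios compared with the rates, and the distortions compared with their
targets. -/
def Aux.cost (p : X × Y × Z → ℝ) (dx : X → Xh → ℝ) (dz : Z → Zh → ℝ) (Ax Az : ℝ)
    (R : ℝ × ℝ × ℝ) (xhat : Fin kU → Fin kW → Z → Xh) (zhat : Fin kU → Fin kV → X → Zh) :
    Fin 6 → Outcome X Y Z kU kV kW → ℝ :=
  ![fun o => Real.log (a.pU o.y o.u / condLaw (a.joint p) Outcome.u Outcome.z o.z o.u) -
      R.1 * Real.log 2,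
    fun o => Real.log (a.pU o.y o.u / condLaw (a.joint p) Outcome.u Outcome.x o.x o.u) -
      R.1 * Real.log 2,
    fun o => Real.log (a.pV o.u o.z o.v /
      condLaw (a.joint p) Outcome.v (fun o => (o.u, o.x)) (o.u, o.x) o.v) - R.2.1 * Real.log 2,
    fun o => Real.log (a.pW o.u o.v o.x o.w /
      condLaw (a.joint p) Outcome.w (fun o => (o.u, o.v, o.z)) (o.u, o.v, o.z) o.w) -
      R.2.2 * Real.log 2,
    fun o => dx o.x (xhat o.u o.w o.z) - Ax,
    fun o => dz o.z (zhat o.u o.v o.x) - Az]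

/-- For every block length there is a code which, up to a small set of source blocks, meets the
distortion targets. -/
lemma Aux.exists_code_good (hp : p ∈ stdSimplex ℝ (X × Y × Z)) (dx : X → Xh → ℝ) (dz : Z → Zh → ℝ)
    (Ax Az : ℝ) {R₁ R₂ R₃ : ℝ} (hR₁ : 0 ≤ R₁) (hR₂ : 0 ≤ R₂) (hR₃ : 0 ≤ R₃)
    (xhat : Fin kU → Fin kW → Z → Xh) (zhat : Fin kU → Fin kV → X → Zh) (n : ℕ) :
    ∃ (c : Code X Y Z Xh Zh n ⌊(2 : ℝ) ^ ((n : ℝ) * R₁)⌋₊ ⌊(2 : ℝ) ^ ((n : ℝ) * R₂)⌋₊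
        ⌊(2 : ℝ) ^ ((n : ℝ) * R₃)⌋₊) (good : Set (Fin n → X × Y × Z)),
      (∀ s ∈ good, ∑ i, dx (s i).1 (c.recX s i) ≤ n * Ax ∧
        ∑ i, dz (s i).2.2 (c.recZ s i) ≤ n * Az) ∧
      1 - ∑ j, ∑ o : Fin n → Outcome X Y Z kU kV kW, blockLaw n (a.joint p) o *
          excess (a.cost p dx dz Ax Az (R₁, R₂, R₃) xhat zhat j) o ≤
        ∑ s, good.indicator (blockLaw n p) s := by
  classical
  set q := a.joint p with hqdef
  have hq : ∀ o, 0 ≤ q o := a.joint_nonneg hp.1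
  have hq1 : ∑ o, q o = 1 := a.sum_joint_eq_one hp
  obtain ⟨⟨x₀, y₀, z₀⟩, -⟩ : ∃ s, p s ≠ 0 := by
    by_contra! h
    have := hp.2
    simp [h] at this
  have simplex_ne : ∀ {k : ℕ} {f : Fin k → ℝ}, f ∈ stdSimplex ℝ (Fin k) → Nonempty (Fin k) := by
    intro k f hf
    by_contra h
    rw [not_nonempty_iff] at h
    simpa using hf.2
  have nU : Nonempty (Fin kU) := simplex_ne (a.pU_mem y₀)
  have nV : Nonempty (Fin kV) := simplex_ne (a.pV_mem nU.some z₀)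
  have nW : Nonempty (Fin kW) := simplex_ne (a.pW_mem nU.some nV.some x₀)
  set f := a.cost p dx dz Ax Az (R₁, R₂, R₃) xhat zhat with hf
  let K₁ (y : Fin n → Y) (u : Fin n → Fin kU) : ℝ := ∏ i, a.pU (y i) (u i)
  let Qz (z : Fin n → Z) (u : Fin n → Fin kU) : ℝ :=
    ∏ i, condLaw q Outcome.u Outcome.z (z i) (u i)
  let Qx (x : Fin n → X) (u : Fin n → Fin kU) : ℝ :=
    ∏ i, condLaw q Outcome.u Outcome.x (x i) (u i)
  let K₂ (z : Fin n → Z) (u : Fin n → Fin kU) (v : Fin n → Fin kV) : ℝ :=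
    ∏ i, a.pV (u i) (z i) (v i)
  let Q₂ (x : Fin n → X) (u : Fin n → Fin kU) (v : Fin n → Fin kV) : ℝ :=
    ∏ i, condLaw q Outcome.v (fun o => (o.u, o.x)) (u i, x i) (v i)
  let K₃ (x : Fin n → X) (u : Fin n → Fin kU) (v : Fin n → Fin kV) (w : Fin n → Fin kW) : ℝ :=
    ∏ i, a.pW (u i) (v i) (x i) (w i)
  let Q₃ (z : Fin n → Z) (u : Fin n → Fin kU) (v : Fin n → Fin kV) (w : Fin n → Fin kW) : ℝ :=
    ∏ i, condLaw q Outcome.w (fun o => (o.u, o.v, o.z)) (u i, v i, z i) (w i)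
  -- Only outcomes of positive probability that already meet the distortion targets count as
  -- successes, so agreement on them gives the required reconstructions.
  let G (o : Fin n → Outcome X Y Z kU kV kW) : Prop :=
    (∀ i, 0 < q (o i)) ∧ ∑ i, f 4 (o i) ≤ 0 ∧ ∑ i, f 5 (o i) ≤ 0
  have qpos : ∀ {o : Outcome X Y Z kU kV kW}, 0 < q o →
      0 < a.pU o.y o.u ∧ 0 < a.pV o.u o.z o.v ∧ 0 < a.pW o.u o.v o.x o.w := by
    intro o ho
    have hne : p (o.x, o.y, o.z) * a.pU o.y o.u * a.pV o.u o.z o.v * a.pW o.u o.v o.x o.w ≠ 0 :=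
      ho.ne'
    simp only [mul_ne_zero_iff] at hne
    exact ⟨((a.pU_mem _).1 _).lt_of_ne' hne.1.1.2, ((a.pV_mem _ _).1 _).lt_of_ne' hne.1.2,
      ((a.pW_mem _ _ _).1 _).lt_of_ne' hne.2⟩
  have cpos : ∀ {o : Outcome X Y Z kU kV kW}, 0 < q o →
      0 < condLaw q Outcome.u Outcome.z o.z o.u ∧ 0 < condLaw q Outcome.u Outcome.x o.x o.u ∧
      0 < condLaw q Outcome.v (fun o => (o.u, o.x)) (o.u, o.x) o.v ∧
      0 < condLaw q Outcome.w (fun o => (o.u, o.v, o.z)) (o.u, o.v, o.z) o.w := fun ho =>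
    ⟨condLaw_pos hq _ _ ho, condLaw_pos hq _ _ ho,
      condLaw_pos hq Outcome.v (fun o : Outcome X Y Z kU kV kW => (o.u, o.x)) ho,
      condLaw_pos hq Outcome.w (fun o : Outcome X Y Z kU kV kW => (o.u, o.v, o.z)) ho⟩
  obtain ⟨T₁, T₂, T₃, good, hgood, hT⟩ := exists_clocks (floor_two_rpow_pos (n := n) hR₁)
    (floor_two_rpow_pos (n := n) hR₂) (floor_two_rpow_pos (n := n) hR₃)
    (fun (o : Fin n → Outcome X Y Z kU kV kW) i => ((o i).x, (o i).y, (o i).z))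
    (fun o i => (o i).u) (fun o i => (o i).v) (fun o i => (o i).w)
    (fun o o' h1 h2 h3 h4 => by
      funext i
      have e1 := congrFun h1 i
      simp only [Prod.mk.injEq] at e1
      exact Prod.ext e1.1 (Prod.ext e1.2.1 (Prod.ext e1.2.2 (Prod.ext (congrFun h2 i)
        (Prod.ext (congrFun h3 i) (congrFun h4 i))))))
    (P := blockLaw n p) (fun s => blockLaw_nonneg hp.1 s)
    (K₁ := fun s => K₁ fun i => (s i).2.1) (Qz := fun s => Qz fun i => (s i).2.2)
    (Qx := fun s => Qx fun i => (s i).1) (K₂ := fun s => K₂ fun i => (s i).2.2)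
    (Q₂ := fun s => Q₂ fun i => (s i).1) (K₃ := fun s => K₃ fun i => (s i).1)
    (Q₃ := fun s => Q₃ fun i => (s i).2.2)
    (fun s => subProb_prod fun i => subProb_of_mem_stdSimplex (a.pU_mem _))
    (fun s => subProb_prod fun i => subProb_condLaw hq _ _ _)
    (fun s => subProb_prod fun i => subProb_condLaw hq _ _ _)
    (fun s u => subProb_prod fun i => subProb_of_mem_stdSimplex (a.pV_mem _ _))
    (fun s u => subProb_prod fun i => subProb_condLaw hq _ _ _)
    (fun s u v => subProb_prod fun i => subProb_of_mem_stdSimplex (a.pW_mem _ _ _))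
    (fun s u v => subProb_prod fun i => subProb_condLaw hq _ _ _) G
    (fun o ho => ⟨Finset.prod_pos fun i _ => (qpos (ho.1 i)).1,
      Finset.prod_pos fun i _ => (cpos (ho.1 i)).1,
      Finset.prod_pos fun i _ => (cpos (ho.1 i)).2.1⟩)
    (fun o ho => ⟨Finset.prod_pos fun i _ => (qpos (ho.1 i)).2.1,
      Finset.prod_pos fun i _ => (cpos (ho.1 i)).2.2.1⟩)
    (fun o ho => ⟨Finset.prod_pos fun i _ => (qpos (ho.1 i)).2.2,
      Finset.prod_pos fun i _ => (cpos (ho.1 i)).2.2.2⟩)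
  obtain ⟨c, hc⟩ := exists_code (Xh := Xh) (Zh := Zh) (floor_two_rpow_pos (n := n) hR₁)
    (floor_two_rpow_pos (n := n) hR₂) (floor_two_rpow_pos (n := n) hR₃)
    K₁ Qz Qx K₂ Q₂ K₃ Q₃ T₁ T₂ T₃ (fun u w z i => xhat (u i) (w i) (z i))
    (fun u v x i => zhat (u i) (v i) (x i))
  refine ⟨c, good, ?_, le_trans ?_ hT⟩
  · intro s hs
    obtain ⟨o, m₁, m₂, m₃, ho, rfl, ⟨w1, w2, w3⟩, ⟨w4, w5⟩, w6, w7⟩ := hgood s hs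
    obtain ⟨hX, hZ⟩ := hc _ _ _ _ _ _ _ _ _ w1 w2 w3 w4 w5 w6 w7
    have h4 := ho.2.1
    have h5 := ho.2.2
    constructor
    · rw [hX]
      simp [hf, Aux.cost, Finset.sum_sub_distrib] at h4
      linarith
    · rw [hZ]
      simp [hf, Aux.cost, Finset.sum_sub_distrib] at h5
      linarith
  · have hsum : 1 - ∑ j, ∑ o : Fin n → Outcome X Y Z kU kV kW, blockLaw n q o * excess (f j) o =
        ∑ o : Fin n → Outcome X Y Z kU kV kW, blockLaw n q o * (1 - ∑ j, excess (f j) o) := by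
      simp only [mul_sub, mul_one, Finset.sum_sub_distrib, sum_blockLaw hq1, Finset.mul_sum]
      rw [Finset.sum_comm]
    rw [hsum]
    refine Finset.sum_le_sum fun o _ => ?_
    have hnn := blockLaw_nonneg hq o
    have hj : ∀ j, excess (f j) o ≤ ∑ j, excess (f j) o := fun j =>
      Finset.single_le_sum (f := fun j => excess (f j) o) (fun j _ => excess_nonneg _ _)
        (Finset.mem_univ j)
    split_ifs with ho
    · have b0 := prod_div_floor_le hR₁ (fun i => (qpos (ho.1 i)).1) fun i => (cpos (ho.1 i)).1
      have b1 := prod_div_floor_le hR₁ (fun i => (qpos (ho.1 i)).1) fun i => (cpos (ho.1 i)).2.1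
      have b2 := prod_div_floor_le hR₂ (fun i => (qpos (ho.1 i)).2.1) fun i =>
        (cpos (ho.1 i)).2.2.1
      have b3 := prod_div_floor_le hR₃ (fun i => (qpos (ho.1 i)).2.2) fun i =>
        (cpos (ho.1 i)).2.2.2
      have hprod : blockLaw n q o = blockLaw n p (fun i => ((o i).x, (o i).y, (o i).z)) *
          (∏ i, a.pU (o i).y (o i).u) * (∏ i, a.pV (o i).u (o i).z (o i).v) *
          ∏ i, a.pW (o i).u (o i).v (o i).x (o i).w := by
        simp only [blockLaw, ← Finset.prod_mul_distrib]
        rfl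
      have nn : ∀ {k c : Fin n → ℝ} (M : ℕ), (∀ i, 0 < k i) → (∀ i, 0 < c i) →
          0 ≤ (∏ i, k i) / (M * ∏ i, c i) := fun M hk hc =>
        div_nonneg (Finset.prod_nonneg fun i _ => (hk i).le)
          (mul_nonneg M.cast_nonneg (Finset.prod_nonneg fun i _ => (hc i).le))
      have key := one_sub_le_prod_inv
        (nn ⌊(2 : ℝ) ^ ((n : ℝ) * R₁)⌋₊ (fun i => (qpos (ho.1 i)).1) fun i => (cpos (ho.1 i)).1)
        (nn ⌊(2 : ℝ) ^ ((n : ℝ) * R₁)⌋₊ (fun i => (qpos (ho.1 i)).1) fun i => (cpos (ho.1 i)).2.1)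
        (nn ⌊(2 : ℝ) ^ ((n : ℝ) * R₂)⌋₊ (fun i => (qpos (ho.1 i)).2.1) fun i =>
          (cpos (ho.1 i)).2.2.1)
        (nn ⌊(2 : ℝ) ^ ((n : ℝ) * R₃)⌋₊ (fun i => (qpos (ho.1 i)).2.2) fun i =>
          (cpos (ho.1 i)).2.2.2)
      have c0 := min_le_min_left 1 (b0.trans (mul_le_mul_of_nonneg_right
        (show (2 : ℝ) ≤ 4 by norm_num) (Real.exp_pos _).le))
      have c1 := min_le_min_left 1 (b1.trans (mul_le_mul_of_nonneg_right
        (show (2 : ℝ) ≤ 4 by norm_num) (Real.exp_pos _).le))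
      -- The constant 4 in `excess` is 2 from rounding the number of messages times 2 from the
      -- decoder listed twice.
      have c2 := min_le_min_left 1 ((add_le_add b2 b2).trans_eq
        (show _ = 4 * Real.exp (∑ i, f 2 (o i)) by simp only [hf, Aux.cost]; simp; ring))
      have c3 := min_le_min_left 1 ((add_le_add b3 b3).trans_eq
        (show _ = 4 * Real.exp (∑ i, f 3 (o i)) by simp only [hf, Aux.cost]; simp; ring))
      have hle : 1 - ∑ j, excess (f j) o ≤ _ := le_trans (by
        rw [Fin.sum_univ_six]
        have := excess_nonneg (f 4) o
        have := excess_nonneg (f 5) o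
        have d0 : _ ≤ excess (f 0) o := c0
        have d1 : _ ≤ excess (f 1) o := c1
        have d2 : _ ≤ excess (f 2) o := c2
        have d3 : _ ≤ excess (f 3) o := c3
        linarith) key
      refine (mul_le_mul_of_nonneg_left hle hnn).trans_eq ?_
      rw [hprod]
      simp only [K₁, K₂, K₃, Qz, Qx, Q₂, Q₃]
      ring
    -- Outside `G` either the outcome has probability zero, or a distortion target is missed; then
    -- one excess equals 1 and the left side is at most 0.
    · by_cases h0 : ∀ i, 0 < q (o i)
      · refine mul_nonpos_of_nonneg_of_nonpos hnn ?_
        by_cases h4 : ∑ i, f 4 (o i) ≤ 0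
        · have h5 : 0 < ∑ i, f 5 (o i) := not_le.1 fun h5 => ho ⟨h0, h4, h5⟩
          linarith [hj 5, excess_eq_one h5]
        · linarith [hj 4, excess_eq_one (not_le.1 h4)]
      · push Not at h0
        obtain ⟨i, hi⟩ := h0
        have : blockLaw n q o = 0 :=
          Finset.prod_eq_zero (Finset.mem_univ i) (le_antisymm hi (hq _))
        rw [this, zero_mul]

end Achievability

/-! ### Passage to the limit and the coding theorem. -/

section Main

variable {X Y Z Xh Zh : Type*} [Fintype X] [Fintype Y] [Fintype Z] {kU kV kW : ℕ}
  {p : X × Y × Z → ℝ}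

/-- The first four costs have as mean log 2 times (mutual information minus rate). The second is
User X decoding U, where the required rate is no larger than for User Z. -/
lemma Aux.sum_cost_neg (a : Aux X Y Z kU kV kW) (hp : p ∈ stdSimplex ℝ (X × Y × Z))
    (hM : IsMarkovYXZ p) {dx : X → Xh → ℝ} {dz : Z → Zh → ℝ} {Ax Az : ℝ} {R : ℝ × ℝ × ℝ}
    {xhat : Fin kU → Fin kW → Z → Xh} {zhat : Fin kU → Fin kV → X → Zh}
    (h1 : condMutualInfo (a.joint p) Outcome.y Outcome.u Outcome.z < R.1)
    (h2 : condMutualInfo (a.joint p) Outcome.z Outcome.v (fun o => (o.u, o.x)) < R.2.1)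
    (h3 : condMutualInfo (a.joint p) Outcome.x Outcome.w (fun o => (o.u, o.v, o.z)) < R.2.2)
    (h4 : ∑ o, a.joint p o * dx o.x (xhat o.u o.w o.z) < Ax)
    (h5 : ∑ o, a.joint p o * dz o.z (zhat o.u o.v o.x) < Az) (j : Fin 6) :
    ∑ o, a.joint p o * a.cost p dx dz Ax Az R xhat zhat j o < 0 := by
  have e : ∀ (g : Outcome X Y Z kU kV kW → ℝ) (r : ℝ),
      ∑ o, a.joint p o * (g o - r) = ∑ o, a.joint p o * g o - r := by
    intro g r
    simp only [mul_sub, Finset.sum_sub_distrib, ← Finset.sum_mul, a.sum_joint_eq_one hp, one_mul]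
  have h0 := a.condMutualInfo_x_le_z hp.1 hM
  have hlog : 0 < Real.log 2 := Real.log_pos one_lt_two
  have key : ∀ {s I r : ℝ}, s = Real.log 2 * I → I < r → s - r * Real.log 2 < 0 := by
    intro s I r hs hI
    nlinarith
  fin_cases j
  · exact (e _ _).trans_lt (key (a.sum_log_u_z hp.1) h1)
  · exact (e _ _).trans_lt (key (a.sum_log_u_x hp.1) (h0.trans_lt h1))
  · exact (e _ _).trans_lt (key (a.sum_log_v hp.1) h2)
  · exact (e _ _).trans_lt (key (a.sum_log_w hp.1) h3)
  · exact (e _ _).trans_lt (sub_neg.2 h4)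
  · exact (e _ _).trans_lt (sub_neg.2 h5)

lemma exists_upper_bound [Finite Xh] (dx : X → Xh → ℝ) : ∃ B : ℝ, 0 ≤ B ∧ ∀ x xh, dx x xh ≤ B := by
  obtain ⟨B, hB⟩ := (Set.finite_range fun t : X × Xh => dx t.1 t.2).bddAbove
  exact ⟨max 0 B, le_max_left _ _, fun x xh => le_max_of_le_right (hB ⟨(x, xh), rfl⟩)⟩

lemma average_le {n : ℕ} {d : Fin n → ℝ} {B : ℝ} (hn : 0 < n) (h : ∑ i, d i ≤ n * B) :
    1 / (n : ℝ) * ∑ i, d i ≤ B := by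
  have hn' : (0 : ℝ) < n := by exact_mod_cast hn
  rw [one_div, inv_mul_le_iff₀ hn']
  exact h

/-- The extra rate δ and the slack ε/2 in the distortions make all six mean costs strictly negative,
so the exceptional set of source blocks has vanishing mass; off it the targets are met, and on it
the distortion is bounded. -/
theorem SingleLetter.achievable [Finite Xh] [Finite Zh] (hp : p ∈ stdSimplex ℝ (X × Y × Z))
    (hM : IsMarkovYXZ p) {dx : X → Xh → ℝ} (hdx : ∀ x xh, 0 ≤ dx x xh)
    {dz : Z → Zh → ℝ} (hdz : ∀ z zh, 0 ≤ dz z zh) {Dx Dz : ℝ} {R : ℝ × ℝ × ℝ}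
    (h : SingleLetter p dx dz Dx Dz kU kV kW R) {δ : ℝ} (hδ : 0 < δ) :
    Achievable p dx dz Dx Dz (R.1 + δ, R.2.1 + δ, R.2.2 + δ) := by
  obtain ⟨a, xhat, zhat, h1, h2, h3, h4, h5⟩ := h
  have hq := a.joint_nonneg hp.1
  have hR₁ : 0 ≤ R.1 + δ := by linarith [condMutualInfo_nonneg hq Outcome.y Outcome.u Outcome.z]
  have hR₂ : 0 ≤ R.2.1 + δ := by
    linarith [condMutualInfo_nonneg hq Outcome.z Outcome.v fun o => (o.u, o.x)]
  have hR₃ : 0 ≤ R.2.2 + δ := by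
    linarith [condMutualInfo_nonneg hq Outcome.x Outcome.w fun o => (o.u, o.v, o.z)]
  have hDx : 0 ≤ Dx := (Finset.sum_nonneg fun o _ => mul_nonneg (hq o) (hdx _ _)).trans h4
  have hDz : 0 ≤ Dz := (Finset.sum_nonneg fun o _ => mul_nonneg (hq o) (hdz _ _)).trans h5
  intro ε hε
  obtain ⟨B, hB, hBx⟩ := exists_upper_bound dx
  obtain ⟨B', hB', hBz⟩ := exists_upper_bound dz
  have hneg := a.sum_cost_neg hp hM (R := (R.1 + δ, R.2.1 + δ, R.2.2 + δ))
    (h1.trans_lt (lt_add_of_pos_right _ hδ)) (h2.trans_lt (lt_add_of_pos_right _ hδ))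
    (h3.trans_lt (lt_add_of_pos_right _ hδ)) (h4.trans_lt (lt_add_of_pos_right _ (half_pos hε)))
    (h5.trans_lt (lt_add_of_pos_right _ (half_pos hε)))
  have hlim := tendsto_finsetSum Finset.univ fun j _ => tendsto_sum_blockLaw_min hq
    (a.sum_joint_eq_one hp) (hneg j) (show (1 : ℝ) ≤ 4 by norm_num)
  rw [Finset.sum_const_zero] at hlim
  -- The exceptional set then costs at most ε/2 in either distortion; the summand 1 keeps the
  -- denominator positive.
  have hsmall : 0 < ε / (2 * (B + B' + 1)) := by positivity
  obtain ⟨N, hN⟩ := Filter.eventually_atTop.1 (hlim.eventually_lt_const hsmall)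
  refine ⟨max N 1, fun n hn => ?_⟩
  have hn0 : 0 < n := (le_max_right N 1).trans hn
  have herr := hN n ((le_max_left N 1).trans hn)
  obtain ⟨c, good, hgood, hle⟩ := a.exists_code_good hp dx dz (Dx + ε / 2) (Dz + ε / 2)
    hR₁ hR₂ hR₃ xhat zhat n
  have hle' : 1 - ε / (2 * (B + B' + 1)) ≤ ∑ s, good.indicator (blockLaw n p) s :=
    (sub_le_sub_left herr.le 1).trans hle
  have hsum := sum_blockLaw (n := n) hp.2
  have hcard : ∀ {d : Fin n → ℝ} {B : ℝ}, (∀ i, d i ≤ B) → ∑ i, d i ≤ n * B := fun hd =>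
    (Finset.sum_le_sum fun i _ => hd i).trans_eq (by simp)
  have hfrac : ∀ b, 0 ≤ b → b ≤ B + B' + 1 → b * (ε / (2 * (B + B' + 1))) ≤ ε / 2 := by
    intro b _ hb
    rw [mul_div_assoc', div_le_div_iff₀ (by positivity) two_pos]
    nlinarith
  refine ⟨c, ?_, ?_⟩
  · refine (sum_mul_le_of_good (blockLaw_nonneg hp.1) hsum (by linarith) hB
      (fun s hs => average_le hn0 (hgood s hs).1)
      (fun s => average_le hn0 (hcard fun i => hBx _ _)) hle').trans ?_
    linarith [hfrac B hB (by linarith)]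
  · refine (sum_mul_le_of_good (blockLaw_nonneg hp.1) hsum (by linarith) hB'
      (fun s hs => average_le hn0 (hgood s hs).2)
      (fun s => average_le hn0 (hcard fun i => hBz _ _)) hle').trans ?_
    linarith [hfrac B' hB' (by linarith)]

theorem region_subset_operationalRegion [Finite Xh] [Finite Zh]
    (hp : p ∈ stdSimplex ℝ (X × Y × Z)) (hM : IsMarkovYXZ p)
    {dx : X → Xh → ℝ} (hdx : ∀ x xh, 0 ≤ dx x xh)
    {dz : Z → Zh → ℝ} (hdz : ∀ z zh, 0 ≤ dz z zh) (Dx Dz : ℝ) :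
    region p dx dz Dx Dz ⊆ operationalRegion p dx dz Dx Dz := by
  rintro R ⟨kU, kV, kW, h⟩
  have hlim : Filter.Tendsto (fun δ : ℝ => (R.1 + δ, R.2.1 + δ, R.2.2 + δ))
      (nhdsWithin 0 (Set.Ioi 0)) (nhds R) := by
    have hc : Continuous fun δ : ℝ => (R.1 + δ, R.2.1 + δ, R.2.2 + δ) := by fun_prop
    have := hc.tendsto 0
    simp only [add_zero] at this
    exact this.mono_left nhdsWithin_le_nhds
  exact mem_closure_of_tendsto hlim (Filter.eventually_of_mem self_mem_nhdsWithin
    fun δ hδ => h.achievable hp hM hdx hdz hδ)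

lemma boundedRegion_subset_region (p : X × Y × Z → ℝ) (dx : X → Xh → ℝ) (dz : Z → Zh → ℝ)
    (Dx Dz : ℝ) : boundedRegion p dx dz Dx Dz ⊆ region p dx dz Dx Dz :=
  fun _ ⟨kU, kV, kW, _, _, _, h⟩ => ⟨kU, kV, kW, h⟩

end Main

end

end TwoWay

theorem theorem1 {X Y Z Xh Zh : Type*} [Fintype X] [Fintype Y] [Fintype Z]
    [Finite Xh] [Finite Zh]
    (p : X × Y × Z → ℝ) (hp : p ∈ stdSimplex ℝ (X × Y × Z)) (hM : TwoWay.IsMarkovYXZ p)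
    (dx : X → Xh → ℝ) (hdx : ∀ x xh, 0 ≤ dx x xh)
    (dz : Z → Zh → ℝ) (hdz : ∀ z zh, 0 ≤ dz z zh) (Dx Dz : ℝ) :
    TwoWay.operationalRegion p dx dz Dx Dz = TwoWay.region p dx dz Dx Dz ∧
    TwoWay.operationalRegion p dx dz Dx Dz = TwoWay.boundedRegion p dx dz Dx Dz := by
  -- The three inclusions form a cycle through the operational, bounded and single-letter regions,
  -- so all three coincide.
  have h₁ := TwoWay.operationalRegion_subset hp hM dx dz Dx Dz
  have h₂ := TwoWay.boundedRegion_subset_region p dx dz Dx Dz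
  have h₃ := TwoWay.region_subset_operationalRegion hp hM hdx hdz Dx Dz
  exact ⟨(h₁.trans h₂).antisymm h₃, h₁.antisymm (h₂.trans h₃)⟩
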